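/- A literal is a propositional variable $x$ or its negation $\neg x$, a clause is a finite set of literals (read as a disjunction), and a CNF formula is a finite set of clauses (read as a conjunction). Consider the following classes of CNF formulas: $\mathrm{Horn}$ (every clause has at most one positive literal), $\mathrm{Krom}$ (every clause has at most two literals), and $\mathrm{ID}$ (every clause has at most one literal, and only positive literals occur). For a CNF formula $\varphi$ and an assignment $\theta\colon B\to\{0,1\}$ on a finite set $B$ of variables, the reduct $\varphi[\theta]$ is obtained by removing all clauses that contain a literal true under $\theta$ and removing all literals false under $\theta$ from the remaining clauses. For a class $\mathcal F$ of CNF formulas, let $\mathrm{BDIMP}(\mathrm{CNF}\to\mathcal F)$ be the following parameterised problem. An instance consists of a finite set $\Phi$ of CNF formulas, a CNF formula $\psi$, and a finite set $B$ of variables that is a strong $\mathcal F$-backdoor, i.e. for every assignment $\theta\colon B\to\{0,1\}$ all formulas $\varphi[\theta]$ with $\varphi\in\Phi$ and also $\psi[\theta]$ belong to $\mathcal F$. The parameter is $k=|B|$. The question is whether $\Phi\models\psi$. Formally, the problem is the set of all pairs $(w,k)\in\Sigma^*\times\mathbb N$ such that $w$ is the code (over a fixed finite alphabet $\Sigma$)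 of some $(\Phi,\psi,B)$ with $B$ a strong $\mathcal F$-backdoor, $|B|=k$ and $\Phi\models\psi$. A parameterised problem $L\subseteq\Sigma^*\times\mathbb N$ is in $\mathrm{FPT}$ $(=\mathrm{para\text{-}P})$ if there are a finite alphabet $\Sigma'$, a computable function $f\colon\mathbb N\to\Sigma'^*$, and a problem $L'\subseteq\Sigma^*\times\Sigma'^*$ that is decidable in polynomial time, such that for all $(w,k)\in\Sigma^*\times\mathbb N$: $(w,k)\in L$ if and only if $(w,f(k))\in L'$. Theorem. For every $\mathcal F\in\{\mathrm{ID},\mathrm{Horn},\mathrm{Krom}\}$, $\mathrm{BDIMP}(\mathrm{CNF}\to\mathcal F)\in\mathrm{FPT}$. -/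

import Mathlib

namespace BackdoorImp

/-! ### Propositional logic -/

/-- Propositional variables are named by words over `{0,1}`, so there is an unbounded supply of
them and the name of a variable is its own binary code. -/
abbrev Var : Type := List Bool

/-- A literal `x` (`positive = true`) or `¬ x` (`positive = false`). -/
@[ext] structure Literal where
  var : Var
  positive : Bool
deriving DecidableEq

/-- A clause is a finite set of literals, read as their disjunction. -/
abbrev Clause : Type := Finset Literal

/-- A CNF formula is a finite set of clauses, read as their conjunction. -/
abbrev CNF : Type := Finset Clause

/-- The valuation `v` satisfies the CNF formula `φ`. -/
def Satisfies (v : Var → Bool) (φ : CNF) : Prop :=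
  ∀ C ∈ φ, ∃ l ∈ C, v l.var = l.positive

/-- `Φ ⊨ ψ`: every valuation that satisfies all formulas in `Φ` satisfies `ψ`. -/
def Entails (Φ : Finset CNF) (ψ : CNF) : Prop :=
  ∀ v : Var → Bool, (∀ φ ∈ Φ, Satisfies v φ) → Satisfies v ψ

/-- Truth assignments `θ : X → {0,1}` on a finite set `X` of variables. -/
abbrev Assignment (X : Finset Var) : Type := {x : Var // x ∈ X} → Bool

/-- `some b` if the variable of `l` lies in `X` and `θ(l) = b`; `none` if it is not in `X`. -/
def Assignment.literalValue {X : Finset Var} (θ : Assignment X) (l : Literal) : Option Bool :=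
  if h : l.var ∈ X then some (if l.positive then θ ⟨l.var, h⟩ else !θ ⟨l.var, h⟩) else none

/-- The reduct `φ[θ]`: remove all clauses that contain a literal true under `θ`, and from the
remaining clauses remove all literals false under `θ`. -/
def CNF.reduct (φ : CNF) {X : Finset Var} (θ : Assignment X) : CNF :=
  (φ.filter fun C => ∀ l ∈ C, θ.literalValue l ≠ some true).image
    fun C => C.filter fun l => θ.literalValue l ≠ some false

/-! ### Target classes -/

/-- Formulas all of whose clauses have at most one positive literal. -/
def Horn : Set CNF :=
  {φ | ∀ C ∈ φ, (C.filter fun l => l.positive = true).card ≤ 1}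

/-- Formulas all of whose clauses have at most two literals. -/
def Krom : Set CNF :=
  {φ | ∀ C ∈ φ, C.card ≤ 2}

/-- Formulas all of whose clauses are positive unit clauses, or empty (the class is closed under
passing to subclauses). -/
def ID : Set CNF :=
  {φ | ∀ C ∈ φ, C.card ≤ 1 ∧ ∀ l ∈ C, l.positive = true}

/-! ### Instances of the implication problem with a backdoor -/

/-- A finite set `Φ` of CNF formulas, a CNF formula `ψ`, and a finite set `B` of variables. -/
structure Inst where
  Φ : Finset CNF
  ψ : CNF
  B : Finset Var

/-- `B` is a strong `F`-backdoor of the instance: under every assignment to `B` the reducts of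
all premises and of the conclusion belong to `F`. -/
def Inst.IsStrongBackdoor (I : Inst) (F : Set CNF) : Prop :=
  ∀ θ : Assignment I.B, (∀ φ ∈ I.Φ, φ.reduct θ ∈ F) ∧ I.ψ.reduct θ ∈ F

/-! ### Words that encode instances -/

/-- The input alphabet. Every item of a listing is preceded by a marker symbol. -/
inductive Symbol
  | zero | one
  | pos | neg
  | clause
  | formula
  | goal
  | backdoor
  | name
deriving DecidableEq

instance : Fintype Symbol where
  elems := {.zero, .one, .pos, .neg, .clause, .formula, .goal, .backdoor, .name}
  complete := by rintro ⟨⟩ <;> decide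

/-- The name of a variable, written with the two bit symbols. -/
def encVar (x : Var) : List Symbol :=
  x.map fun b => if b then Symbol.one else Symbol.zero

def encLiteral (l : Literal) : List Symbol :=
  (if l.positive then Symbol.pos else Symbol.neg) :: encVar l.var

def encClause (c : List Literal) : List Symbol :=
  Symbol.clause :: c.flatMap encLiteral

def encCNF (φ : List (List Literal)) : List Symbol :=
  Symbol.formula :: φ.flatMap encClause

/-- The word that lists the premises, then the conclusion, then the backdoor variables. -/
def encInst (Φ : List (List (List Literal))) (ψ : List (List Literal)) (B : List Var) :
    List Symbol :=
  Φ.flatMap encCNF ++ Symbol.goal :: encCNF ψ ++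
    Symbol.backdoor :: B.flatMap fun x => Symbol.name :: encVar x

/-- The CNF formula listed by a list of lists of literals. -/
def toCNF (φ : List (List Literal)) : CNF :=
  (φ.map fun c => c.toFinset).toFinset

/-- The word `w` encodes the instance `I`: it lists the elements of the sets in `I`, in any
order, possibly with repetitions. -/
def Encodes (w : List Symbol) (I : Inst) : Prop :=
  ∃ (Φ : List (List (List Literal))) (ψ : List (List Literal)) (B : List Var),
    w = encInst Φ ψ B ∧ (Φ.map toCNF).toFinset = I.Φ ∧ toCNF ψ = I.ψ ∧ B.toFinset = I.B

/-! ### Parameterised complexity -/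

/-- A parameterised problem over the alphabet `Γ`: a subset of `Γ* × ℕ`. -/
abbrev ParamProblem (Γ : Type) : Type := Set (List Γ × ℕ)

/-- A pair of words as one word, over the disjoint union of the two alphabets. -/
def encPair {Γ Δ : Type} (p : List Γ × List Δ) : List (Γ ⊕ Δ) :=
  p.1.map Sum.inl ++ p.2.map Sum.inr

open Classical in
/-- The class `P`, for subsets of `Γ* × Δ*`: some multi-stack Turing machine, started on the
pair, halts within polynomially many steps and outputs the one-symbol answer. -/
def InP {Γ Δ : Type} (L : Set (List Γ × List Δ)) : Prop :=
  Nonempty (Turing.TM2ComputableInPolyTime encPair (fun b : Bool => [b])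
    (fun p : List Γ × List Δ => decide (p ∈ L)))

/-- The class `FPT`, that is, `para-P`: there are a finite alphabet (without loss of generality
`Fin n`), a computable function `f` from `ℕ` to words over it, and a problem `L'` in `P` such
that `(x, k) ∈ L` if and only if `(x, f k) ∈ L'`. -/
def IsFPT {Γ : Type} [Fintype Γ] (L : ParamProblem Γ) : Prop :=
  ∃ (n : ℕ) (f : ℕ → List (Fin n)) (L' : Set (List Γ × List (Fin n))),
    Computable f ∧ InP L' ∧ ∀ (x : List Γ) (k : ℕ), (x, k) ∈ L ↔ (x, f k) ∈ L'

/-- The CNF implication problem where a strong `F`-backdoor is given and the parameter is the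
size of the backdoor. -/
def BDIMP (F : Set CNF) : ParamProblem Symbol :=
  {p | ∃ I : Inst, Encodes p.1 I ∧ I.IsStrongBackdoor F ∧ I.B.card = p.2 ∧ Entails I.Φ I.ψ}

end BackdoorImp

/-!
Fix an assignment `θ` to the backdoor `B`. The premises together with the negation of a clause `D`
of the conclusion reduce under `θ` to a Horn or a Krom formula, and unit propagation decides whether
such a formula is satisfiable: for Horn formulas a single run suffices, and for Krom formulas it is
enough that for each variable one of its two values survives propagation, since the saturated sets
so obtained can be glued together one after the other. A run takes polynomial time, and there are
only `2 ^ |B|` assignments, so the advice for the parameter `k` can list all bit strings of length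
`k`, and what is left is a polynomial-time check of every listed assignment.

Polynomial time on multi-stack machines is reached through relations between the input word and
tuples of positions. The relations decided by loop programs, which move a fixed number of pointers
over the input and store tables indexed by tuples of positions, are closed under Boolean operations,
quantifiers over positions and derivability in a system of rules. Unit propagation is such a
derivability relation.
-/

namespace BackdoorImp

/-! ### Loop programs -/

/-- The contents of four stacks of bits. -/
abbrev Stacks : Type := Fin 4 → List Bool

/-- The memory of a program that reads an input word: the positions of the pointers, which are named
by `Z`, and four stacks of bits. A pointer behind the last letter has the length of the word as its
position. -/
@[ext] structure Memory (Z : Type) where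
  pos : Z → ℕ
  stk : Stacks

/-- All pointers are at positions of the word `w`. -/
def Memory.InRange {A Z : Type} (s : Memory Z) (w : List A) : Prop :=
  ∀ z, s.pos z ≤ w.length

/-- Elementary instructions for pointers named by `Z` and a read-only word over `A`. An instruction
has an effect on the memory and an outcome, which decides how the program goes on. -/
inductive Instr (A Z : Type) : Type
  | push (k : Fin 4) (b : Bool)
  | pop (k : Fin 4)
  | left (z : Z)
  | right (z : Z)
  | read (z : Z) (f : Option A → Bool)

namespace Instr

variable {A Z : Type}

/-- The truth value that an instruction reports: the bit on top for `pop`, success for a move. -/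
def outcome (w : List A) (s : Memory Z) : Instr A Z → Bool
  | push _ _ => true
  | pop k => (s.stk k).head? == some true
  | left z => decide (s.pos z ≠ 0)
  | right z => decide (s.pos z < w.length)
  | read z f => f w[s.pos z]?

/-- The memory after an instruction. Moves beyond an end of the word are ignored. -/
def effect [DecidableEq Z] (w : List A) (s : Memory Z) : Instr A Z → Memory Z
  | push k b => ⟨s.pos, Function.update s.stk k (b :: s.stk k)⟩
  | pop k => ⟨s.pos, Function.update s.stk k (s.stk k).tail⟩
  | left z => ⟨Function.update s.pos z (s.pos z - 1), s.stk⟩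
  | right z => ⟨Function.update s.pos z (min (s.pos z + 1) w.length), s.stk⟩
  | read _ _ => s

/-- Rename the pointer of an instruction. -/
def map {Z' : Type} (g : Z → Z') : Instr A Z → Instr A Z'
  | push k b => push k b
  | pop k => pop k
  | left z => left (g z)
  | right z => right (g z)
  | read z f => read (g z) f

/-- A strict upper bound on the index of the pointer that an instruction uses. -/
def width : Instr A ℕ → ℕ
  | push _ _ => 0
  | pop _ => 0
  | left i => i + 1
  | right i => i + 1
  | read i _ => i + 1

theorem inRange_effect [DecidableEq Z] {w : List A} {s : Memory Z} (hs : s.InRange w)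
    (c : Instr A Z) : (c.effect w s).InRange w := by
  intro z
  have := hs z
  cases c with
  | left y | right y =>
    simp only [effect, Function.update_apply]
    split_ifs with h <;> [subst h; skip] <;> omega
  | _ => exact this

end Instr

/-- Programs that read a word over `A` by means of pointers indexed by `ℕ`. The only form of
iteration is `loop`, which repeats its body `|w| + 1` times, so that every program runs in
polynomial time. -/
inductive Prog (A : Type) : Type
  | skip : Prog A
  | ite (c : Instr A ℕ) (p q : Prog A) : Prog A
  | seq (p q : Prog A) : Prog A
  | loop (p : Prog A) : Prog A

namespace Prog

variable {A : Type}

/-- The memory after the execution of a program on the word `w`. -/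
def run (w : List A) : Prog A → Memory ℕ → Memory ℕ
  | skip, s => s
  | ite c p q, s => if c.outcome w s then run w p (c.effect w s) else run w q (c.effect w s)
  | seq p q, s => run w q (run w p s)
  | loop p, s => (run w p)^[w.length + 1] s

theorem inRange_run (w : List A) (p : Prog A) {s : Memory ℕ} (hs : s.InRange w) :
    (run w p s).InRange w := by
  induction p generalizing s with
  | skip => exact hs
  | ite c p q hp hq =>
    rw [run]
    split_ifs
    · exact hp (c.inRange_effect hs)
    · exact hq (c.inRange_effect hs)
  | seq _ _ hp hq => exact hq (hp hs)
  | loop p hp => exact Function.Iterate.rec (Memory.InRange · w) hs (fun _ => hp) _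

/-- A strict upper bound on the indices of the pointers of a program and on the nesting depth of its
loops. -/
def width : Prog A → ℕ
  | skip => 0
  | ite c p q => max c.width (max (width p) (width q))
  | seq p q => max (width p) (width q)
  | loop p => width p + 1

/-- A bound on the number of machine steps of a program, as a polynomial in the length of the
word. -/
noncomputable def time : Prog A → Polynomial ℕ
  | skip => 1
  | ite _ p q => 1 + (time p + time q)
  | seq p q => time p + time q
  | loop p => (Polynomial.X + 1) * (time p + 1) + (Polynomial.X + 1)

end Prog

/-! ### Compilation to stack machines -/

/-- The stacks of a machine that simulates pointers named by `Z`: input, output, and, for every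
pointer, a zipper over a copy of the input word; the bit stacks are the stacks of the program. -/
inductive Reg (Z : Type) : Type
  | inp : Reg Z
  | out : Reg Z
  | before (z : Z) : Reg Z
  | after (z : Z) : Reg Z
  | bits (k : Fin 4) : Reg Z
deriving DecidableEq, Fintype

/-- The alphabets of the machine stacks. -/
abbrev RegAlphabet (A : Type) {Z : Type} : Reg Z → Type
  | .inp => A
  | .out => Bool
  | .before _ => A
  | .after _ => A
  | .bits _ => Bool

/-- The contents of all machine stacks. -/
abbrev RegFile (A Z : Type) : Type := ∀ r : Reg Z, List (RegAlphabet A r)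

/-- Machine statements. The control state consists of a scratch letter and a scratch bit. -/
abbrev MStmt (A Z Λ : Type) : Type :=
  Turing.TM2.Stmt (RegAlphabet A (Z := Z)) Λ (Option A × Bool)

/-- The machine stacks that represent a memory and the word `w`. -/
def conf {A Z : Type} (w : List A) (s : Memory Z) : RegFile A Z
  | .inp => ([] : List A)
  | .out => ([] : List Bool)
  | .before z => (w.take (s.pos z)).reverse
  | .after z => w.drop (s.pos z)
  | .bits k => s.stk k

section Reach

variable {A Z Λ : Type} [DecidableEq Z] {M : Λ → MStmt A Z Λ}

/-- The machine `M` gets from `a` to `b`, two pairs of a label and stack contents, within `t` steps,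
whatever its control state is. -/
def Reach (M : Λ → MStmt A Z Λ) (t : ℕ) (a b : Λ × RegFile A Z) : Prop :=
  ∀ v : Option A × Bool, ∃ v' : Option A × Bool, ∃ m ≤ t,
    (flip bind (Turing.TM2.step M))^[m] (some ⟨some a.1, v, a.2⟩) = some ⟨some b.1, v', b.2⟩

variable {a b c : Λ × RegFile A Z} {t t' : ℕ}

theorem Reach.mono (h : Reach M t a b) (ht : t ≤ t') : Reach M t' a b := fun v =>
  let ⟨v', m, hm, e⟩ := h v
  ⟨v', m, hm.trans ht, e⟩

theorem Reach.trans (h : Reach M t a b) (h' : Reach M t' b c) : Reach M (t + t') a c := by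
  intro v
  obtain ⟨v', m, hm, e⟩ := h v
  obtain ⟨v'', m', hm', e'⟩ := h' v'
  exact ⟨v'', m' + m, by omega, by rw [Function.iterate_add_apply, e, e']⟩

theorem Reach.single {l l' : Λ} {T T' : RegFile A Z}
    (h : ∀ v, ∃ v', Turing.TM2.stepAux (M l) v T = ⟨some l', v', T'⟩) :
    Reach M 1 (l, T) (l', T') := fun v =>
  let ⟨v', e⟩ := h v
  ⟨v', 1, le_rfl, congrArg some e⟩

end Reach

section Conf

variable {A Z : Type} [DecidableEq Z] {w : List A} {s : Memory Z}

theorem update_conf_bits (k : Fin 4) (x : List Bool) :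
    Function.update (conf w s) (.bits k) x = conf w ⟨s.pos, Function.update s.stk k x⟩ := by
  funext r
  cases r with
  | bits j => by_cases h : j = k <;> [subst h; skip] <;> simp_all [conf]
  | _ => simp [conf]

theorem update_conf_zipper (z : Z) (x : ℕ) :
    Function.update (Function.update (conf w s) (.before z) (w.take x).reverse)
      (.after z) (w.drop x) = conf w ⟨Function.update s.pos z x, s.stk⟩ := by
  funext r
  cases r with
  | before y | after y => by_cases h : y = z <;> [subst h; skip] <;> simp_all [conf]
  | _ => simp [conf]

end Conf

namespace Instr

variable {A Z Λ : Type} [Inhabited A]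

/-- The machine statement of an instruction, with a jump that depends on the outcome. -/
def stmt (yes no : Λ) : Instr A Z → MStmt A Z Λ
  | push k b => .push (.bits k) (fun _ => b) (.goto fun _ => yes)
  | pop k => .pop (.bits k) (fun v x => (v.1, x == some true)) <|
      .goto fun v => if v.2 then yes else no
  | left z => .pop (.before z) (fun v x => (x, v.2)) <|
      .branch (fun v => v.1.isSome)
        (.push (.after z) (fun v => v.1.getD default) (.goto fun _ => yes)) (.goto fun _ => no)
  | right z => .pop (.after z) (fun v x => (x, v.2)) <|
      .branch (fun v => v.1.isSome)
        (.push (.before z) (fun v => v.1.getD default) (.goto fun _ => yes)) (.goto fun _ => no)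
  | read z f => .peek (.after z) (fun v x => (v.1, f x)) <|
      .goto fun v => if v.2 then yes else no

variable [DecidableEq Z] {w : List A} {s : Memory Z}

theorem stepAux_stmt_left (yes no : Λ) (v : Option A × Bool) {z : Z} (hz : s.pos z ≤ w.length) :
    ∃ v', Turing.TM2.stepAux ((left z).stmt yes no) v (conf w s) =
      ⟨some (if s.pos z ≠ 0 then yes else no), v',
        conf w ⟨Function.update s.pos z (s.pos z - 1), s.stk⟩⟩ := by
  rcases hm : s.pos z with _ | m
  · have before_eq : conf w s (.before z) = ([] : List A) := by simp [conf, hm]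
    refine ⟨(none, v.2), ?_⟩
    simp only [stmt, Turing.TM2.stepAux, before_eq, List.head?_nil, Option.isSome_none, cond_false,
      List.tail_nil, ne_eq, not_true_eq_false, if_false]
    rw [← before_eq, Function.update_eq_self, Nat.zero_sub, ← hm, Function.update_eq_self]
  · have hlt : m < w.length := by omega
    have before_eq : conf w s (.before z) = w[m] :: (w.take m).reverse := by
      simp only [conf, hm, ← List.take_concat_get' w m hlt, List.reverse_append]
      rfl
    have after_eq : conf w s (.after z) = w.drop (m + 1) := by simp only [conf, hm]
    refine ⟨(some w[m], v.2), ?_⟩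
    simp only [stmt, Turing.TM2.stepAux, before_eq, List.head?_cons, Option.isSome_some, cond_true,
      List.tail_cons, Option.getD_some, ne_eq, Nat.succ_ne_zero, not_false_eq_true, if_true,
      Nat.add_sub_cancel, ← update_conf_zipper]
    rw [Function.update_of_ne (by simp), after_eq]
    congr 2
    exact (List.drop_eq_getElem_cons hlt).symm

theorem stepAux_stmt_right (yes no : Λ) (v : Option A × Bool) {z : Z} (hz : s.pos z ≤ w.length) :
    ∃ v', Turing.TM2.stepAux ((right z).stmt yes no) v (conf w s) =
      ⟨some (if s.pos z < w.length then yes else no), v',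
        conf w ⟨Function.update s.pos z (min (s.pos z + 1) w.length), s.stk⟩⟩ := by
  rcases hz.lt_or_eq with hlt | heq
  · have after_eq : conf w s (.after z) = w[s.pos z] :: w.drop (s.pos z + 1) :=
      List.drop_eq_getElem_cons hlt
    refine ⟨(some w[s.pos z], v.2), ?_⟩
    simp only [stmt, Turing.TM2.stepAux, after_eq, List.head?_cons, Option.isSome_some, cond_true,
      List.tail_cons, Option.getD_some, hlt, if_true, min_eq_left (Nat.succ_le_of_lt hlt),
      ← update_conf_zipper]
    rw [Function.update_of_ne (by simp), Function.update_comm (by simp)]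
    congr 2
    rw [← List.take_concat_get' w _ hlt, List.reverse_append]
    rfl
  · have after_eq : conf w s (.after z) = ([] : List A) := by simp [conf, heq]
    refine ⟨(none, v.2), ?_⟩
    simp only [stmt, Turing.TM2.stepAux, after_eq, List.head?_nil, Option.isSome_none, cond_false,
      List.tail_nil, heq, lt_irrefl, if_false, min_eq_right (Nat.le_succ _)]
    rw [← after_eq, Function.update_eq_self, ← heq, Function.update_eq_self]

theorem reach_stmt {M : Λ → MStmt A Z Λ} {l yes no : Λ} {c : Instr A Z} (hs : s.InRange w)
    (hl : M l = c.stmt yes no) :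
    Reach M 1 (l, conf w s) (if c.outcome w s then yes else no, conf w (c.effect w s)) := by
  refine Reach.single fun v => ?_
  rw [hl]
  cases c with
  | push k b => exact ⟨v, by simp [stmt, outcome, effect, ← update_conf_bits, conf]⟩
  | pop k =>
    exact ⟨(v.1, (s.stk k).head? == some true), by
      simp [stmt, outcome, effect, ← update_conf_bits, conf]⟩
  | left z =>
    simpa only [outcome, effect, decide_eq_true_eq] using stepAux_stmt_left yes no v (hs z)
  | right z =>
    simpa only [outcome, effect, decide_eq_true_eq] using stepAux_stmt_right yes no v (hs z)
  | read z f =>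
    exact ⟨(v.1, f w[s.pos z]?), by
      simp only [stmt, Turing.TM2.stepAux, conf, List.head?_drop, outcome, effect]
      rfl⟩

end Instr

namespace Prog

variable {A : Type}

/-- The labels of the compiled program. -/
def Label : Prog A → Type
  | skip => Unit
  | ite _ p q => Option (Label p ⊕ Label q)
  | seq p q => Label p ⊕ Label q
  | loop p => Bool ⊕ Label p

noncomputable instance instFintypeLabel : ∀ p : Prog A, Fintype (Label p)
  | skip => inferInstanceAs (Fintype Unit)
  | ite _ p q =>
    letI := instFintypeLabel p
    letI := instFintypeLabel q
    inferInstanceAs (Fintype (Option (Label p ⊕ Label q)))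
  | seq p q =>
    letI := instFintypeLabel p
    letI := instFintypeLabel q
    inferInstanceAs (Fintype (Label p ⊕ Label q))
  | loop p =>
    letI := instFintypeLabel p
    inferInstanceAs (Fintype (Bool ⊕ Label p))

/-- The label at which the compiled program starts. -/
def entry : (p : Prog A) → Label p
  | skip => ()
  | ite _ _ _ => none
  | seq p _ => Sum.inl (entry p)
  | loop p => Sum.inr (entry p)

/-- The names of the zippers of a compiled program: pointers on the left, loop counters on the
right. -/
abbrev Zipper (N : ℕ) : Type := Fin N ⊕ Fin N

/-- The compiled program, with labels embedded by `emb`, which leaves through the label `exit`. The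
counter of a loop goes down from `|w|` to `0` and is then set back to `|w|`. Counters of nested
loops differ because the body of a loop has a smaller width. -/
def code [Inhabited A] (N : ℕ) [NeZero N] {Λ : Type} :
    (p : Prog A) → (emb : Label p → Λ) → (exit : Λ) → Label p → MStmt A (Zipper N) Λ
  | skip, _, exit, _ => .goto fun _ => exit
  | ite c p q, emb, exit, x =>
    match x with
    | none => (c.map (Sum.inl ∘ Fin.ofNat N)).stmt
        (emb (some (Sum.inl (entry p)))) (emb (some (Sum.inr (entry q))))
    | some (Sum.inl x) => code N p (fun y => emb (some (Sum.inl y))) exit x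
    | some (Sum.inr x) => code N q (fun y => emb (some (Sum.inr y))) exit x
  | seq p q, emb, exit, x =>
    match x with
    | Sum.inl x => code N p (fun y => emb (Sum.inl y)) (emb (Sum.inr (entry q))) x
    | Sum.inr x => code N q (fun y => emb (Sum.inr y)) exit x
  | loop p, emb, exit, x =>
    match x with
    | Sum.inl false => (Instr.left (Sum.inr (Fin.ofNat N (width p)))).stmt
        (emb (Sum.inr (entry p))) (emb (Sum.inl true))
    | Sum.inl true => (Instr.right (Sum.inr (Fin.ofNat N (width p)))).stmt (emb (Sum.inl true)) exit
    | Sum.inr x => code N p (fun y => emb (Sum.inr y)) (emb (Sum.inl false)) x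

end Prog

section ReachCode

variable {A : Type} {w : List A}

section Counter

variable {Z Λ : Type} [DecidableEq Z] {M : Λ → MStmt A Z Λ} [Inhabited A]

theorem reach_rewind {rewind exit : Λ} {z : Z}
    (hrewind : M rewind = (Instr.right z).stmt rewind exit) (r : ℕ) {s : Memory Z}
    (hs : s.InRange w) (hr : s.pos z + r = w.length) :
    Reach M (r + 1) (rewind, conf w s)
      (exit, conf w ⟨Function.update s.pos z w.length, s.stk⟩) := by
  have move := Instr.reach_stmt hs hrewind
  induction r generalizing s with
  | zero => simpa [Instr.outcome, Instr.effect, ← hr] using move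
  | succ r ih =>
    have hs' := (Instr.right z).inRange_effect hs
    have hlt : s.pos z < w.length := by omega
    simp only [Instr.outcome, Instr.effect, decide_eq_true_eq, if_pos hlt,
      min_eq_left (Nat.succ_le_of_lt hlt)] at move hs'
    have rest := ih hs' (by simp only [Function.update_self]; omega) (Instr.reach_stmt hs' hrewind)
    rw [Function.update_idem] at rest
    exact (move.trans rest).mono (Nat.add_comm _ _).le

/-- Runs through the values `x, …, 0` of a loop counter `z`; `s i` is the memory apart from the
counter after `i` rounds. -/
theorem reach_loop {start again rewind exit : Λ} {z : Z}
    (hagain : M again = (Instr.left z).stmt start rewind)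
    (hrewind : M rewind = (Instr.right z).stmt rewind exit) {s : ℕ → Memory Z}
    (hs : ∀ i, (s i).InRange w) {t : ℕ}
    (body : ∀ i, ∀ x ≤ w.length, Reach M t
      (start, conf w ⟨Function.update (s i).pos z x, (s i).stk⟩)
      (again, conf w ⟨Function.update (s (i + 1)).pos z x, (s (i + 1)).stk⟩)) (x : ℕ)
    (hx : x ≤ w.length) (i : ℕ) :
    Reach M ((x + 1) * (t + 1) + (w.length + 1))
      (start, conf w ⟨Function.update (s i).pos z x, (s i).stk⟩)
      (exit, conf w ⟨Function.update (s (i + (x + 1))).pos z w.length, (s (i + (x + 1))).stk⟩) := by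
  have hs' (i x : ℕ) (hx : x ≤ w.length) :
      Memory.InRange ⟨Function.update (s i).pos z x, (s i).stk⟩ w := fun y => by
    by_cases h : y = z <;> [subst h; skip] <;> simp_all [hs i y]
  induction x generalizing i with
  | zero =>
    have back := Instr.reach_stmt (hs' (i + 1) 0 hx) hagain
    have rewound := reach_rewind hrewind w.length (hs' (i + 1) 0 hx) (by simp)
    simp only [Instr.outcome, Instr.effect, Function.update_self, Function.update_idem, ne_eq,
      not_true_eq_false, decide_false, Bool.false_eq_true, if_false, Nat.zero_sub] at back rewound
    exact (((body i 0 hx).trans back).trans rewound).mono (by omega)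
  | succ x ih =>
    have back := Instr.reach_stmt (hs' (i + 1) (x + 1) hx) hagain
    simp only [Instr.outcome, Instr.effect, Function.update_self, Function.update_idem, ne_eq,
      Nat.succ_ne_zero, not_false_eq_true, decide_true, if_true, Nat.add_sub_cancel] at back
    have rest := ih (by omega) (i + 1)
    rw [show i + 1 + (x + 1) = i + (x + 1 + 1) by omega] at rest
    exact (((body i _ hx).trans back).trans rest).mono (le_of_eq (by ring))

end Counter

variable {N : ℕ}

/-- The memory of the machine: the memory `s` of the program together with the loop counters `c`. -/
def withCounters (s : Memory ℕ) (c : Fin N → ℕ) : Memory (Prog.Zipper N) :=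
  ⟨Sum.elim (fun i => s.pos i) c, s.stk⟩

theorem inRange_withCounters {s : Memory ℕ} {c : Fin N → ℕ} (hs : s.InRange w)
    (hc : ∀ j, c j ≤ w.length) : (withCounters s c).InRange w := by
  rintro (i | j)
  · exact hs i
  · exact hc j

variable [NeZero N] {s : Memory ℕ} {c : Fin N → ℕ}

theorem update_withCounters_pos {i : ℕ} (hi : i < N) (x : ℕ) :
    Function.update (withCounters s c).pos (Sum.inl (Fin.ofNat N i)) x =
      (withCounters ⟨Function.update s.pos i x, s.stk⟩ c).pos := by
  funext z
  rcases z with j | j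
  · simp [withCounters, Function.update_apply, Fin.ext_iff, Nat.mod_eq_of_lt hi]
  · simp [withCounters]

theorem outcome_map_withCounters {e : Instr A ℕ} (he : e.width ≤ N) :
    (e.map (Sum.inl ∘ Fin.ofNat N)).outcome w (withCounters s c) = e.outcome w s := by
  cases e with
  | push | pop => rfl
  | left i | right i | read i f =>
    simp [Instr.map, Instr.outcome, withCounters, Nat.mod_eq_of_lt (Nat.lt_of_succ_le he)]

theorem effect_map_withCounters {e : Instr A ℕ} (he : e.width ≤ N) :
    (e.map (Sum.inl ∘ Fin.ofNat N)).effect w (withCounters s c) =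
      withCounters (e.effect w s) c := by
  cases e with
  | push | pop | read => rfl
  | left i | right i =>
    have hi : i < N := Nat.lt_of_succ_le he
    simp only [Instr.map, Instr.effect, Function.comp_apply, update_withCounters_pos hi]
    simp [withCounters, Nat.mod_eq_of_lt hi]

theorem Prog.reach_code_loop [Inhabited A] {p : Prog A} (hp : p.loop.width ≤ N) {Λ : Type}
    {M : Λ → MStmt A (Zipper N) Λ} {emb : Label p.loop → Λ} {exit : Λ}
    (hM : ∀ x, M (emb x) = code N p.loop emb exit x)
    (hbody : ∀ {s : Memory ℕ}, s.InRange w → ∀ {c : Fin N → ℕ}, (∀ j, c j ≤ w.length) →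
      (∀ j : Fin N, j < p.width → c j = w.length) →
      Reach M ((time p).eval w.length) (emb (Sum.inr (entry p)), conf w (withCounters s c))
        (emb (Sum.inl false), conf w (withCounters (run w p s) c)))
    {s : Memory ℕ} (hs : s.InRange w) {c : Fin N → ℕ} (hc : ∀ j, c j ≤ w.length)
    (hcp : ∀ j : Fin N, j < p.loop.width → c j = w.length) :
    Reach M ((time p.loop).eval w.length) (emb (entry p.loop), conf w (withCounters s c))
      (exit, conf w (withCounters (run w p.loop s) c)) := by
  have hlt : width p < N := hp
  set j₀ := Fin.ofNat N (width p) with hj₀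
  have hj₀_val : (j₀ : ℕ) = width p := Nat.mod_eq_of_lt hlt
  have hs' (i : ℕ) : ((run w p)^[i] s).InRange w :=
    Function.Iterate.rec (Memory.InRange · w) hs (fun _ => inRange_run w p) i
  have counter_eq (s : Memory ℕ) (x : ℕ) :
      ⟨Function.update (withCounters s c).pos (Sum.inr j₀) x, (withCounters s c).stk⟩ =
        withCounters s (Function.update c j₀ x) := by
    simp only [withCounters, Sum.update_elim_inr]
  have body (i x : ℕ) (hx : x ≤ w.length) := hbody (hs' i)
    (c := Function.update c j₀ x)
    (fun j => by by_cases h : j = j₀ <;> [subst h; skip] <;> simp_all)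
    (fun j hj => by
      rw [Function.update_of_ne (by rintro rfl; omega)]
      exact hcp j (hj.trans (Nat.lt_succ_self _)))
  have looped := reach_loop (hM (Sum.inl false)) (hM (Sum.inl true))
    (s := fun i => withCounters ((run w p)^[i] s) c)
    (fun i => inRange_withCounters (hs' i) hc)
    (fun i x hx => by
      rw [← hj₀, counter_eq, counter_eq, Function.iterate_succ_apply']
      exact body i x hx) w.length le_rfl 0
  rw [← hj₀, counter_eq, counter_eq,
    ← hcp j₀ (by rw [hj₀_val]; exact Nat.lt_succ_self _), Function.update_eq_self] at looped
  rw [hcp j₀ (by rw [hj₀_val]; exact Nat.lt_succ_self _), Nat.zero_add] at looped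
  simpa [time, run, entry] using looped

theorem Prog.reach_code [Inhabited A] (p : Prog A) (hp : p.width ≤ N) {Λ : Type}
    {M : Λ → MStmt A (Zipper N) Λ} {emb : Label p → Λ} {exit : Λ}
    (hM : ∀ x, M (emb x) = code N p emb exit x) {s : Memory ℕ} (hs : s.InRange w) {c : Fin N → ℕ}
    (hc : ∀ j, c j ≤ w.length) (hcp : ∀ j : Fin N, j < p.width → c j = w.length) :
    Reach M ((time p).eval w.length) (emb (entry p), conf w (withCounters s c))
      (exit, conf w (withCounters (run w p s) c)) := by
  induction p generalizing exit s c with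
  | skip =>
    simp only [time, Polynomial.eval_one]
    exact Reach.single fun v => ⟨v, by rw [hM]; rfl⟩
  | ite e p q ihp ihq =>
    simp only [width, max_le_iff, lt_max_iff] at hp hcp
    have branch := Instr.reach_stmt (inRange_withCounters hs hc) (hM none)
    rw [outcome_map_withCounters hp.1, effect_map_withCounters hp.1] at branch
    simp only [run, time, Polynomial.eval_add, Polynomial.eval_one]
    split_ifs at branch ⊢
    · exact (branch.trans (ihp hp.2.1 (fun x => hM (some (Sum.inl x))) (e.inRange_effect hs) hc
        fun j hj => hcp j (.inr (.inl hj)))).mono (by omega)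
    · exact (branch.trans (ihq hp.2.2 (fun x => hM (some (Sum.inr x))) (e.inRange_effect hs) hc
        fun j hj => hcp j (.inr (.inr hj)))).mono (by omega)
  | seq p q ihp ihq =>
    simp only [width, max_le_iff, lt_max_iff] at hp hcp
    simp only [time, Polynomial.eval_add]
    exact (ihp hp.1 (fun x => hM (Sum.inl x)) hs hc fun j hj => hcp j (.inl hj)).trans
      (ihq hp.2 (fun x => hM (Sum.inr x)) (inRange_run w p hs) hc fun j hj => hcp j (.inr hj))
  | loop p ih =>
    exact reach_code_loop hp hM (ih (Nat.le_of_succ_le hp) fun x => hM (Sum.inr x)) hs hc hcp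

end ReachCode

section Machine

variable {A Z Λ : Type}

/-- Push the scratch letter on the given zippers. -/
def pushAll [Inhabited A] (q : MStmt A Z Λ) : List Z → MStmt A Z Λ
  | [] => q
  | z :: zs => .push (.before z) (fun v => v.1.getD default) (pushAll q zs)

/-- Pop all given stacks. -/
def popAll (q : MStmt A Z Λ) : List (Reg Z) → MStmt A Z Λ
  | [] => q
  | r :: rs => .pop r (fun v _ => v) (popAll q rs)

/-- The stacks after the letter `a` has been pushed on the given zippers. -/
def RegFile.pushed [DecidableEq Z] (T : RegFile A Z) (a : A) (zs : List Z) : RegFile A Z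
  | .before z => if z ∈ zs then a :: T (.before z) else T (.before z)
  | r => T r

/-- The stacks while the input is copied: `u` has been read, `x` is left. -/
def copyConf (u x : List A) : RegFile A Z
  | .inp => x
  | .out => ([] : List Bool)
  | .before _ => u.reverse
  | .after _ => ([] : List A)
  | .bits _ => ([] : List Bool)

theorem copyConf_nil_eq_conf (w : List A) :
    copyConf w [] = conf w (⟨fun _ => w.length, fun _ => []⟩ : Memory Z) := by
  funext r
  cases r <;> simp [copyConf, conf]

variable [DecidableEq Z]

theorem stepAux_pushAll [Inhabited A] (q : MStmt A Z Λ) (v : Option A × Bool) {zs : List Z}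
    (hzs : zs.Nodup) (T : RegFile A Z) :
    Turing.TM2.stepAux (pushAll q zs) v T =
      Turing.TM2.stepAux q v (T.pushed (v.1.getD default) zs) := by
  induction zs generalizing T with
  | nil =>
    congr 1
    funext r
    cases r <;> simp [RegFile.pushed]
  | cons z zs ih =>
    rw [List.nodup_cons] at hzs
    rw [pushAll, Turing.TM2.stepAux, ih hzs.2]
    congr 1
    funext r
    cases r with
    | before y =>
      by_cases h : y = z
      · subst h
        simp [RegFile.pushed, hzs.1]
      · simp [RegFile.pushed, h]
    | _ => simp [RegFile.pushed]

theorem stepAux_popAll (q : MStmt A Z Λ) (v : Option A × Bool) {rs : List (Reg Z)}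
    (hrs : rs.Nodup) (T : RegFile A Z) :
    Turing.TM2.stepAux (popAll q rs) v T =
      Turing.TM2.stepAux q v fun r => if r ∈ rs then (T r).tail else T r := by
  induction rs generalizing T with
  | nil => simp [popAll]
  | cons r rs ih =>
    rw [List.nodup_cons] at hrs
    rw [popAll, Turing.TM2.stepAux, ih hrs.2]
    congr 1
    funext y
    by_cases h : y = r
    · subst h
      simp [hrs.1]
    · simp [h]

/-- The labels of the machine of a program with labels `Λ`. The answer is kept in the label while
the stacks are cleared. -/
inductive Phase (Λ : Type) : Type
  | copy
  | body (x : Λ)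
  | answer
  | clear (b : Bool)
deriving Fintype

variable [Inhabited A] {N : ℕ} [NeZero N]

/-- The machine of a program: it copies the input to all zippers, runs the program, and clears all
stacks before it outputs the bit that the program left on its first stack. -/
noncomputable def machineCode (N : ℕ) [NeZero N] (p : Prog A) :
    Phase p.Label → MStmt A (Prog.Zipper N) (Phase p.Label)
  | .copy => .pop .inp (fun v x => (x, v.2)) <|
      .branch (fun v => v.1.isSome)
        (pushAll (.goto fun _ => .copy) (Finset.univ : Finset (Prog.Zipper N)).toList)
        (.goto fun _ => .body p.entry)
  | .body x => p.code N .body .answer x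
  | .answer => .pop (.bits 0) (fun v x => (v.1, x == some true)) (.goto fun v => .clear v.2)
  | .clear b => .peek (.before (Sum.inr 0)) (fun v x => (x, v.2)) <|
      .branch (fun v => v.1.isSome)
        (popAll (.goto fun _ => .clear b) (Finset.univ : Finset (Reg (Prog.Zipper N))).toList)
        (.push .out (fun _ => b) <| .load (fun _ => (none, false)) .halt)

/-- The bundled machine of a program. -/
noncomputable def machine [Fintype A] (N : ℕ) [NeZero N] (p : Prog A) : Turing.FinTM2 where
  K := Reg (Prog.Zipper N)
  k₀ := .inp
  k₁ := .out
  Γ := RegAlphabet A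
  Λ := Phase p.Label
  main := .copy
  σ := Option A × Bool
  initialState := (none, false)
  Γk₀Fin := inferInstanceAs (Fintype A)
  m := machineCode N p

theorem reach_copy (p : Prog A) (u x : List A) :
    Reach (machineCode N p) (x.length + 1) (.copy, copyConf u x)
      (.body p.entry, copyConf (u ++ x) []) := by
  induction x generalizing u with
  | nil =>
    refine Reach.single fun v => ⟨(none, v.2), ?_⟩
    simp only [machineCode, Turing.TM2.stepAux, copyConf, List.head?_nil, Option.isSome_none,
      cond_false, List.tail_nil, List.append_nil]
    exact congrArg _ (Function.update_eq_self Reg.inp (copyConf u []))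
  | cons a x ih =>
    have move : Reach (machineCode N p) 1 (.copy, copyConf u (a :: x))
        (.copy, copyConf (u ++ [a]) x) := by
      refine Reach.single fun v => ⟨(some a, v.2), ?_⟩
      simp only [machineCode, Turing.TM2.stepAux, copyConf, List.head?_cons, Option.isSome_some,
        cond_true, List.tail_cons, stepAux_pushAll _ _ (Finset.nodup_toList _)]
      congr 1
      funext r
      cases r <;> simp [RegFile.pushed, copyConf]
    have rest := ih (u ++ [a])
    rw [List.append_assoc, List.singleton_append] at rest
    exact (move.trans rest).mono (Nat.add_comm _ _).le

theorem reach_answer (p : Prog A) {w : List A} {s : Memory (Prog.Zipper N)} {b : Bool}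
    (hs : s.stk = Function.update (fun _ => []) 0 [b]) :
    Reach (machineCode N p) 1 (.answer, conf w s) (.clear b, conf w ⟨s.pos, fun _ => []⟩) := by
  refine Reach.single fun v => ⟨(v.1, b), ?_⟩
  simp only [machineCode, Turing.TM2.stepAux, update_conf_bits, hs]
  simp [conf, hs]

theorem halts_clear (p : Prog A) (b : Bool) (n : ℕ) (v : Option A × Bool)
    (T : RegFile A (Prog.Zipper N)) (hn : (T (.before (Sum.inr 0))).length = n)
    (hT : ∀ r, (T r).length ≤ n) :
    (flip bind (Turing.TM2.step (machineCode N p)))^[n + 1] (some ⟨some (.clear b), v, T⟩) =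
      some ⟨none, (none, false), Function.update (fun _ => []) .out [b]⟩ := by
  induction n generalizing v T with
  | zero =>
    obtain rfl : T = fun _ => [] :=
      funext fun r => List.eq_nil_of_length_eq_zero (Nat.le_zero.1 (hT r))
    rfl
  | succ n ih =>
    have nonempty : (T (.before (Sum.inr 0))).head?.isSome = true := by
      rw [List.isSome_head?, ← List.length_pos_iff]
      omega
    have move : Turing.TM2.step (machineCode N p) ⟨some (.clear b), v, T⟩ =
        some ⟨some (.clear b), ((T (.before (Sum.inr 0))).head?, v.2), fun r => (T r).tail⟩ := by
      simp [Turing.TM2.step, machineCode, Turing.TM2.stepAux, nonempty,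
        stepAux_popAll _ _ (Finset.nodup_toList _)]
    rw [Function.iterate_succ_apply]
    exact (congrArg _ move).trans (ih _ _ (by rw [List.length_tail, hn]; rfl) fun r => by
      have := hT r
      rw [List.length_tail]
      omega)

/- One zipper more than the program needs, so that there is a counter `0` to be tested for emptiness
while the stacks are cleared. -/
theorem exists_iterate_machine (p : Prog A) (w : List A) {b : Bool}
    (hp : (p.run w ⟨fun _ => w.length, fun _ => []⟩).stk = Function.update (fun _ => []) 0 [b]) :
    ∃ m ≤ (w.length + 1) + (p.time.eval w.length + (1 + (w.length + 1))),
      (flip bind (Turing.TM2.step (machineCode (p.width + 1) p)))^[m]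
        (some ⟨some .copy, (none, false), copyConf [] w⟩) =
      some ⟨none, (none, false), Function.update (fun _ => []) .out [b]⟩ := by
  set s₁ := p.run w ⟨fun _ => w.length, fun _ => []⟩
  let full : Fin (p.width + 1) → ℕ := fun _ => w.length
  have copied := reach_copy (N := p.width + 1) p [] w
  have start_eq : copyConf ([] ++ w) [] =
      conf w (withCounters ⟨fun _ => w.length, fun _ => []⟩ full) := by
    rw [List.nil_append, copyConf_nil_eq_conf]
    congr 2
    funext z
    cases z <;> rfl
  have body := p.reach_code (Nat.le_succ _) (M := machineCode (p.width + 1) p) (emb := .body)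
    (exit := .answer) (fun _ => rfl) (s := ⟨fun _ => w.length, fun _ => []⟩)
    (fun _ => le_rfl) (c := full) (fun _ => le_rfl) fun _ _ => rfl
  rw [start_eq] at copied
  obtain ⟨v, m, hm, e⟩ := (copied.trans (body.trans
    (reach_answer p (s := withCounters s₁ full) hp))) (none, false)
  have cleared := halts_clear p b w.length v (conf w ⟨(withCounters s₁ full).pos, fun _ => []⟩)
    (by simp [conf, withCounters, full]) fun r => by cases r <;> simp [conf]
  exact ⟨w.length + 1 + m, by omega, by rw [Function.iterate_add_apply, e, cleared]⟩

theorem initList_machine [Fintype A] (p : Prog A) (w : List A) :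
    Turing.initList (machine N p) w = ⟨some .copy, (none, false), copyConf [] w⟩ := by
  unfold Turing.initList
  congr 1
  funext r
  cases r with
  | inp => simp [copyConf, machine]; rfl
  | _ => simp [copyConf, machine]

theorem haltList_machine [Fintype A] (p : Prog A) (v : List Bool) :
    Turing.haltList (machine N p) v =
      ⟨none, (none, false), Function.update (fun _ => []) .out v⟩ := by
  unfold Turing.haltList
  congr 1
  funext r
  cases r <;> rfl

theorem inP_of_run {Γ Δ : Type} [Finite Γ] [Finite Δ] [Inhabited Γ]
    {L : Set (List Γ × List Δ)} (p : Prog (Γ ⊕ Δ))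
    (hp : ∀ x : List Γ × List Δ, ∃ b, (b = true ↔ x ∈ L) ∧
      (p.run (encPair x) ⟨fun _ => (encPair x).length, fun _ => []⟩).stk =
        Function.update (fun _ => []) 0 [b]) : InP L := by
  classical
  have := Fintype.ofFinite Γ
  have := Fintype.ofFinite Δ
  have : Inhabited (Γ ⊕ Δ) := ⟨Sum.inl default⟩
  refine ⟨{
    tm := machine (p.width + 1) p
    inputAlphabet := Equiv.refl _
    outputAlphabet := Equiv.refl _
    time := (Polynomial.X + 1) + (p.time + (1 + (Polynomial.X + 1)))
    outputsFun := fun x => Classical.choice ?_ }⟩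
  obtain ⟨b, hb, hstk⟩ := hp x
  obtain ⟨m, hm, e⟩ := exists_iterate_machine p (encPair x) hstk
  have hdecide : (@decide (x ∈ L) (Classical.propDecidable _)) = b := by
    rw [Bool.eq_iff_iff, hb, decide_eq_true_iff]
  have init_eq := (congrArg (Turing.initList (machine (p.width + 1) p)) (List.map_id _)).trans
    (initList_machine p (encPair x))
  refine ⟨⟨⟨m, ?_⟩, hm.trans (le_of_eq (by simp))⟩⟩
  rw [hdecide]
  exact (congrArg (fun c => (flip bind (Turing.TM2.step (machineCode (p.width + 1) p)))^[m]
    (some c)) init_eq).trans (e.trans (congrArg some (haltList_machine p [b]).symm))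

end Machine

/-! ### Relations definable by programs -/

/-- Tuples of positions, stored in consecutive pointers: the type `C` consists of the tuples that
are stored in the pointers `0, …, size - 1`. -/
class PosTuple (C : Type) where
  size : ℕ
  get : (ℕ → ℕ) → C
  get_congr : ∀ {h h' : ℕ → ℕ}, (∀ i < size, h i = h' i) → get h = get h'

instance : PosTuple Unit where
  size := 0
  get _ := ()
  get_congr _ := rfl

instance : PosTuple ℕ where
  size := 1
  get h := h 0
  get_congr h := h 0 Nat.one_pos

instance {C T : Type} [PosTuple C] [PosTuple T] : PosTuple (C × T) where
  size := PosTuple.size C + PosTuple.size T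
  get h := (PosTuple.get h, PosTuple.get fun i => h (PosTuple.size C + i))
  get_congr h := Prod.ext (PosTuple.get_congr fun i hi => h i (by omega))
    (PosTuple.get_congr fun i hi => h _ (by omega))

/-- Maps that select consecutive components of a tuple. -/
def IsProj {C D : Type} [PosTuple C] [PosTuple D] (f : C → D) : Prop :=
  ∃ k, k + PosTuple.size D ≤ PosTuple.size C ∧
    ∀ h : ℕ → ℕ, f (PosTuple.get h) = PosTuple.get fun i => h (k + i)

namespace IsProj

variable {C D E : Type} [PosTuple C] [PosTuple D] [PosTuple E]

protected theorem id : IsProj fun c : C => c :=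
  ⟨0, by simp, fun h => by simp⟩

theorem fst {f : C → D × E} (hf : IsProj f) : IsProj fun c => (f c).1 := by
  obtain ⟨k, hk, h⟩ := hf
  have size_eq : PosTuple.size (D × E) = PosTuple.size D + PosTuple.size E := rfl
  exact ⟨k, by omega, fun g => congrArg Prod.fst (h g)⟩

theorem snd {f : C → D × E} (hf : IsProj f) : IsProj fun c => (f c).2 := by
  obtain ⟨k, hk, h⟩ := hf
  have size_eq : PosTuple.size (D × E) = PosTuple.size D + PosTuple.size E := rfl
  refine ⟨k + PosTuple.size D, by omega, fun g => ?_⟩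
  refine (congrArg Prod.snd (h g)).trans ?_
  simp only [PosTuple.get, add_assoc]

theorem exists_pointer {f : C → ℕ} (hf : IsProj f) :
    ∃ k < PosTuple.size C, ∀ h : ℕ → ℕ, f (PosTuple.get h) = h k := by
  obtain ⟨k, hk, h⟩ := hf
  exact ⟨k, hk, h⟩

end IsProj

namespace Prog

variable {A : Type} {w : List A}

/-- The program that consists of one instruction. -/
abbrev exec (c : Instr A ℕ) : Prog A := ite c skip skip

theorem run_exec (c : Instr A ℕ) (s : Memory ℕ) : run w (exec c) s = c.effect w s := by
  simp [run]

theorem run_loop_left (i : ℕ) {s : Memory ℕ} (hs : s.InRange w) :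
    run w (loop (exec (.left i))) s = ⟨Function.update s.pos i 0, s.stk⟩ := by
  have iterate_left (t : ℕ) : (run w (exec (.left i)))^[t] s =
      ⟨Function.update s.pos i (s.pos i - t), s.stk⟩ := by
    induction t with
    | zero => simp
    | succ t ih => simp [Function.iterate_succ_apply', ih, run_exec, Instr.effect, Nat.sub_sub]
  rw [run, iterate_left, Nat.sub_eq_zero_of_le ((hs i).trans (Nat.le_succ _))]

end Prog

section Computes

variable {A : Type}

/-- Some program transforms the stacks according to `F`, depending on the word and a tuple of
pointer positions, which it leaves unchanged. -/
def Computes (C : Type) [PosTuple C] (F : List A → C → Stacks → Stacks) : Prop :=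
  ∃ p : Prog A, ∀ (w : List A) (s : Memory ℕ), s.InRange w →
    (p.run w s).stk = F w (PosTuple.get s.pos) s.stk ∧
      ∀ i < PosTuple.size C, (p.run w s).pos i = s.pos i

variable {C T U : Type} [PosTuple C] [PosTuple T] [PosTuple U] {F G : List A → C → Stacks → Stacks}

namespace Computes

theorem congr (hF : Computes C F) (h : ∀ w c S, F w c S = G w c S) : Computes C G :=
  (funext fun w => funext fun c => funext (h w c) : F = G) ▸ hF

theorem skip : Computes (A := A) C fun _ _ S => S :=
  ⟨.skip, fun _ _ _ => ⟨rfl, fun _ _ => rfl⟩⟩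

theorem push (k : Fin 4) (b : Bool) :
    Computes (A := A) C fun _ _ S => Function.update S k (b :: S k) :=
  ⟨.exec (.push k b), fun _ _ _ => ⟨rfl, fun _ _ => rfl⟩⟩

theorem seq (hF : Computes C F) (hG : Computes C G) :
    Computes C fun w c S => G w c (F w c S) := by
  obtain ⟨p, hp⟩ := hF
  obtain ⟨q, hq⟩ := hG
  refine ⟨.seq p q, fun w s hs => ?_⟩
  obtain ⟨stk_p, pos_p⟩ := hp w s hs
  obtain ⟨stk_q, pos_q⟩ := hq w _ (p.inRange_run w hs)
  exact ⟨by rw [Prog.run, stk_q, stk_p, PosTuple.get_congr pos_p],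
    fun i hi => (pos_q i hi).trans (pos_p i hi)⟩

theorem pop (k : Fin 4) (hF : Computes C F) (hG : Computes C G) :
    Computes C fun w c S => if (S k).head? = some true then F w c (Function.update S k (S k).tail)
      else G w c (Function.update S k (S k).tail) := by
  obtain ⟨p, hp⟩ := hF
  obtain ⟨q, hq⟩ := hG
  refine ⟨.ite (.pop k) p q, fun w s hs => ?_⟩
  simp only [Prog.run, Instr.outcome, beq_iff_eq]
  split_ifs
  · exact hp w ⟨s.pos, _⟩ hs
  · exact hq w ⟨s.pos, _⟩ hs

theorem read {t : C → ℕ} (ht : IsProj t) (f : Option A → Bool) (hF : Computes C F)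
    (hG : Computes C G) :
    Computes C fun w c S => if f w[t c]? = true then F w c S else G w c S := by
  obtain ⟨k, -, h⟩ := ht.exists_pointer
  obtain ⟨p, hp⟩ := hF
  obtain ⟨q, hq⟩ := hG
  refine ⟨.ite (.read k f) p q, fun w s hs => ?_⟩
  simp only [Prog.run, Instr.outcome, Instr.effect, h]
  by_cases hf : f w[s.pos k]? = true
  · simpa only [hf, if_true] using hp w s hs
  · simpa only [hf, Bool.false_eq_true, if_false] using hq w s hs

theorem forNat {F : List A → C × ℕ → Stacks → Stacks} (hF : Computes (C × ℕ) F) :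
    Computes C fun w c S => (List.range (w.length + 1)).foldl (fun S x => F w (c, x) S) S := by
  obtain ⟨p, hp⟩ := hF
  have size_eq : PosTuple.size (C × ℕ) = PosTuple.size C + 1 := rfl
  set i := PosTuple.size C
  refine ⟨.seq (.loop (.exec (.left i))) (.loop (.seq p (.exec (.right i)))), fun w s hs => ?_⟩
  rw [Prog.run, Prog.run_loop_left i hs, Prog.run]
  set s₀ : Memory ℕ := ⟨Function.update s.pos i 0, s.stk⟩
  have hs₀ : s₀.InRange w := fun j => by
    by_cases h : j = i <;> simp [s₀, h, hs j]
  let after (t : ℕ) : Memory ℕ := (Prog.run w (.seq p (.exec (.right i))))^[t] s₀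
  have after_succ (t : ℕ) : after (t + 1) = (Instr.right i).effect w (p.run w (after t)) := by
    simp only [after, Function.iterate_succ_apply', Prog.run, ite_self]
  have inRange (t : ℕ) : (after t).InRange w :=
    Function.Iterate.rec (Memory.InRange · w) hs₀ (fun _ => Prog.inRange_run w _) t
  have pos_eq (t : ℕ) : (after t).pos i = min t w.length ∧ ∀ j < i, (after t).pos j = s.pos j := by
    induction t with
    | zero =>
      exact ⟨by simp [after, s₀], fun j hj => Function.update_of_ne hj.ne _ _⟩
    | succ t ih =>
      have keep := (hp w _ (inRange t)).2
      rw [after_succ]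
      refine ⟨?_, fun j hj => ?_⟩
      · simp only [Instr.effect, Function.update_self]
        rw [keep i (by omega), ih.1]
        omega
      · simp only [Instr.effect]
        rw [Function.update_of_ne hj.ne, keep j (by omega), ih.2 j hj]
  have stk_eq (t : ℕ) (ht : t ≤ w.length + 1) : (after t).stk =
      (List.range t).foldl (fun S x => F w (PosTuple.get s.pos, x) S) s.stk := by
    induction t with
    | zero => rfl
    | succ t ih =>
      have get_eq : PosTuple.get (C := C × ℕ) (after t).pos = (PosTuple.get s.pos, t) :=
        Prod.ext (PosTuple.get_congr (pos_eq t).2)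
          ((pos_eq t).1.trans (min_eq_left (by omega)))
      rw [after_succ, Instr.effect, (hp w _ (inRange t)).1, ih (by omega), get_eq, List.range_succ,
        List.foldl_concat]
  exact ⟨stk_eq _ le_rfl, (pos_eq _).2⟩

theorem assoc {F : List A → C × (T × U) → Stacks → Stacks} (hF : Computes (C × (T × U)) F) :
    Computes ((C × T) × U) fun w x => F w (x.1.1, (x.1.2, x.2)) := by
  obtain ⟨p, hp⟩ := hF
  refine ⟨p, fun w s hs => ?_⟩
  have size_eq : PosTuple.size (C × (T × U)) =
    PosTuple.size C + (PosTuple.size T + PosTuple.size U) := rfl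
  have size_eq' : PosTuple.size ((C × T) × U) =
    PosTuple.size C + PosTuple.size T + PosTuple.size U := rfl
  obtain ⟨stk_eq, pos_eq⟩ := hp w s hs
  refine ⟨stk_eq.trans ?_, fun i hi => pos_eq i (by omega)⟩
  simp only [PosTuple.get, add_assoc, PosTuple.size]

end Computes

/-- Types of tuples whose bounded members can be enumerated by nested loops. -/
class Enum (T : Type) [PosTuple T] where
  enum : ℕ → List T
  computes_for : ∀ {A C : Type} [PosTuple C] {F : List A → C × T → Stacks → Stacks},
    Computes (C × T) F →
      Computes C fun w c S => (enum w.length).foldl (fun S x => F w (c, x) S) S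

instance : Enum ℕ where
  enum n := List.range (n + 1)
  computes_for := Computes.forNat

instance [Enum T] [Enum U] : Enum (T × U) where
  enum n := (Enum.enum n).flatMap fun t => (Enum.enum n).map fun u => (t, u)
  computes_for hF :=
    (Enum.computes_for (T := T) (Enum.computes_for (T := U) hF.assoc)).congr fun w c S => by
      simp only [List.foldl_flatMap, List.foldl_map]

theorem mem_enum_nat {n x : ℕ} : x ∈ Enum.enum (T := ℕ) n ↔ x ≤ n := by
  simp [Enum.enum]

theorem mem_enum_prod [Enum T] [Enum U] {n : ℕ} {x : T × U} :
    x ∈ Enum.enum n ↔ x.1 ∈ Enum.enum n ∧ x.2 ∈ Enum.enum n := by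
  obtain ⟨t, u⟩ := x
  simp [Enum.enum]

/-- Put a bit on the first stack. -/
abbrev pushBit (S : Stacks) (b : Bool) : Stacks := Function.update S 0 (b :: S 0)

/-- The truth value of a proposition. -/
noncomputable def truth (p : Prop) : Bool := @decide p (Classical.propDecidable p)

@[simp] theorem truth_eq_true_iff {p : Prop} : truth p = true ↔ p := by simp [truth]

@[simp] theorem truth_eq_false_iff {p : Prop} : truth p = false ↔ ¬p := by simp [truth]

@[simp] theorem truth_true : truth True = true := by simp [truth]

@[simp] theorem truth_false : truth False = false := by simp [truth]

@[simp] theorem truth_eq_true (b : Bool) : truth (b = true) = b :=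
  Bool.eq_iff_iff.2 truth_eq_true_iff

@[simp] theorem truth_not (p : Prop) : truth (¬p) = !truth p := by simp [truth]

@[simp] theorem truth_and (p q : Prop) : truth (p ∧ q) = (truth p && truth q) :=
  Bool.eq_iff_iff.2 (by simp)

@[simp] theorem truth_or (p q : Prop) : truth (p ∨ q) = (truth p || truth q) :=
  Bool.eq_iff_iff.2 (by simp)

/-- Relations between a word and a tuple of positions that are decided by programs. -/
def Definable (C : Type) [PosTuple C] (R : List A → C → Prop) : Prop :=
  Computes C fun w c S => pushBit S (truth (R w c))

variable {R Q : List A → C → Prop}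

theorem foldl_or {X Y : Type} (φ : Bool → Y) {f : Y → X → Y} {p : X → Prop}
    (hf : ∀ a x, f (φ a) x = φ (a || truth (p x))) (E : List X) (a : Bool) :
    E.foldl f (φ a) = φ (a || truth (∃ x ∈ E, p x)) := by
  induction E generalizing a with
  | nil => simp
  | cons x E ih => rw [List.foldl_cons, hf, ih, Bool.or_assoc]; simp

theorem exists_computes_or : ∃ F, Computes (A := A) C F ∧
    ∀ w c S a b, F w c (pushBit (pushBit S a) b) = pushBit S (a || b) := by
  refine ⟨_, Computes.pop 0 ((Computes.pop 0 .skip .skip).seq (Computes.push 0 true)) .skip,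
    fun _ _ S a b => ?_⟩
  cases b <;> simp

namespace Definable

theorem congr (hR : Definable C R) (h : ∀ w c, Q w c ↔ R w c) : Definable C Q :=
  (funext fun w => funext fun c => propext (h w c) : Q = R) ▸ hR

theorem const (b : Prop) : Definable (A := A) C fun _ _ => b :=
  Computes.push 0 _

theorem read {t : C → ℕ} (ht : IsProj t) (f : Option A → Bool) :
    Definable C fun w c => f w[t c]? = true :=
  (Computes.read ht f (Computes.push 0 true) (Computes.push 0 false)).congr fun w c S => by
    cases h : f w[t c]? <;> simp [pushBit, h]

protected theorem not (hR : Definable C R) : Definable C fun w c => ¬R w c :=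
  (hR.seq (Computes.pop 0 (Computes.push 0 false) (Computes.push 0 true))).congr fun w c S => by
    cases h : truth (R w c) <;> simp [h]

protected theorem and (hR : Definable C R) (hQ : Definable C Q) :
    Definable C fun w c => R w c ∧ Q w c :=
  (hR.seq (Computes.pop 0 hQ (Computes.push 0 false))).congr fun w c S => by
    cases h : truth (R w c) <;> simp [h]

protected theorem or (hR : Definable C R) (hQ : Definable C Q) :
    Definable C fun w c => R w c ∨ Q w c :=
  (hR.not.and hQ.not).not.congr fun w c => by tauto

theorem imp (hR : Definable C R) (hQ : Definable C Q) : Definable C fun w c => R w c → Q w c :=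
  (hR.and hQ.not).not.congr fun w c => by tauto

protected theorem iff (hR : Definable C R) (hQ : Definable C Q) :
    Definable C fun w c => (R w c ↔ Q w c) :=
  ((hR.imp hQ).and (hQ.imp hR)).congr fun w c => by tauto

theorem exists_enum [Enum T] {R : List A → C → T → Prop}
    (hR : Definable (C × T) fun w x => R w x.1 x.2) :
    Definable C fun w c => ∃ x ∈ Enum.enum w.length, R w c x := by
  obtain ⟨F, hF, eF⟩ := exists_computes_or (A := A) (C := C × T)
  refine ((Computes.push 0 false).seq (Enum.computes_for (hR.seq hF))).congr fun w c S => ?_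
  exact foldl_or (pushBit S) (fun a x => eF w (c, x) S a _) _ false

theorem ex {R : List A → C → ℕ → Prop} (hR : Definable (C × ℕ) fun w x => R w x.1 x.2) :
    Definable C fun w c => ∃ x ≤ w.length, R w c x :=
  (exists_enum hR).congr fun w c => by simp only [mem_enum_nat]

theorem all {R : List A → C → ℕ → Prop} (hR : Definable (C × ℕ) fun w x => R w x.1 x.2) :
    Definable C fun w c => ∀ x ≤ w.length, R w c x :=
  (ex (R := fun w c x => ¬R w c x) hR.not).not.congr fun w c => by push Not; rfl

end Definable

end Computes

/-! ### Comparison of positions -/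

section Comparison

variable {A : Type} {w : List A} {i j : ℕ}

/-- Move two pointers to the left together if possible, and record success on the second stack. -/
def bothLeft (A : Type) (i j : ℕ) : Prog A :=
  .ite (.left i)
    (.ite (.left j) (.exec (.push 1 true)) (.seq (.exec (.right i)) (.exec (.push 1 false))))
    (.exec (.push 1 false))

/-- Undo a recorded move of two pointers. -/
def bothRight (A : Type) (i j : ℕ) : Prog A :=
  .ite (.pop 1) (.seq (.exec (.right i)) (.exec (.right j))) .skip

theorem run_bothLeft_of_eq_zero (hij : i ≠ j) {s : Memory ℕ} (hs : s.InRange w)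
    (h : s.pos i = 0 ∨ s.pos j = 0) :
    (bothLeft A i j).run w s = ⟨s.pos, Function.update s.stk 1 (false :: s.stk 1)⟩ := by
  have hi := hs i
  by_cases hi₀ : s.pos i = 0
  · have update_eq : Function.update s.pos i 0 = s.pos := by rw [← hi₀, Function.update_eq_self]
    simp [bothLeft, Prog.run, Instr.outcome, Instr.effect, hi₀, update_eq]
  · have hj₀ : s.pos j = 0 := h.resolve_left hi₀
    have update_eq : Function.update s.pos j 0 = s.pos := by rw [← hj₀, Function.update_eq_self]
    have back : min (s.pos i - 1 + 1) w.length = s.pos i := by omega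
    simp [bothLeft, Prog.run, Instr.outcome, Instr.effect, hi₀, hj₀, hij.symm, back,
      Function.update_comm hij, update_eq]

theorem run_bothLeft_of_ne_zero (hij : i ≠ j) {s : Memory ℕ} (hi : s.pos i ≠ 0)
    (hj : s.pos j ≠ 0) :
    (bothLeft A i j).run w s =
      ⟨Function.update (Function.update s.pos i (s.pos i - 1)) j (s.pos j - 1),
        Function.update s.stk 1 (true :: s.stk 1)⟩ := by
  simp [bothLeft, Prog.run, Instr.outcome, Instr.effect, hi, hj, hij.symm]

theorem run_bothRight_bothLeft (hij : i ≠ j) {s : Memory ℕ} (hs : s.InRange w) :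
    (bothRight A i j).run w ((bothLeft A i j).run w s) = s := by
  have hi := hs i
  have hj := hs j
  by_cases h : s.pos i = 0 ∨ s.pos j = 0
  · rw [run_bothLeft_of_eq_zero hij hs h]
    simp [bothRight, Prog.run, Instr.outcome, Instr.effect]
  · push Not at h
    have back_i : min (s.pos i - 1 + 1) w.length = s.pos i := by omega
    have back_j : min (s.pos j - 1 + 1) w.length = s.pos j := by omega
    rw [run_bothLeft_of_ne_zero hij h.1 h.2]
    simp [bothRight, Prog.run, Instr.outcome, Instr.effect, hij.symm, back_i, back_j,
      Function.update_comm hij]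

theorem iterate_bothRight_iterate_bothLeft (hij : i ≠ j) (n : ℕ) {s : Memory ℕ}
    (hs : s.InRange w) :
    ((bothRight A i j).run w)^[n] (((bothLeft A i j).run w)^[n] s) = s := by
  induction n generalizing s with
  | zero => rfl
  | succ n ih =>
    rw [Function.iterate_succ_apply', Function.iterate_succ_apply, ih (Prog.inRange_run w _ hs),
      run_bothRight_bothLeft hij hs]

theorem pos_iterate_bothLeft (hij : i ≠ j) (n : ℕ) {s : Memory ℕ} (hs : s.InRange w) :
    (((bothLeft A i j).run w)^[n] s).pos i = s.pos i - min n (min (s.pos i) (s.pos j)) := by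
  induction n generalizing s with
  | zero => simp
  | succ n ih =>
    rw [Function.iterate_succ_apply, ih (Prog.inRange_run w _ hs)]
    by_cases h : s.pos i = 0 ∨ s.pos j = 0
    · rw [run_bothLeft_of_eq_zero hij hs h]
      dsimp only
      omega
    · push Not at h
      rw [run_bothLeft_of_ne_zero hij h.1 h.2]
      simp only [Function.update_self, Function.update_of_ne hij]
      omega

/-- Put a bit on the first stack of a memory. -/
abbrev pushAnswer (b : Bool) (s : Memory ℕ) : Memory ℕ := ⟨s.pos, pushBit s.stk b⟩

theorem semiconj_pushAnswer_bothRight (b : Bool) :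
    Function.Semiconj (pushAnswer b) ((bothRight A i j).run w) ((bothRight A i j).run w) := by
  intro s
  have run_bothRight (s : Memory ℕ) : (bothRight A i j).run w s =
      if (Instr.pop 1).outcome w s then
        (Instr.right j).effect w ((Instr.right i).effect w ((Instr.pop 1).effect w s))
      else (Instr.pop 1).effect w s := by
    simp only [bothRight, Prog.run, ite_self]
  rw [run_bothRight, run_bothRight]
  cases h : (s.stk 1).head? == some true <;>
    simp [Instr.outcome, Instr.effect, h, pushBit,
      Function.update_comm (show (0 : Fin 4) ≠ 1 by decide)]

theorem exists_run_le (hij : i ≠ j) : ∃ p : Prog A, ∀ (w : List A) (s : Memory ℕ), s.InRange w →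
    p.run w s = pushAnswer (truth (s.pos i ≤ s.pos j)) s := by
  let answer : Prog A := .ite (.left i) (.seq (.exec (.right i)) (.exec (.push 0 false)))
    (.exec (.push 0 true))
  refine ⟨.seq (.loop (bothLeft A i j)) (.seq answer (.loop (bothRight A i j))), fun w s hs => ?_⟩
  have run_answer {s : Memory ℕ} (hs : s.InRange w) :
      answer.run w s = pushAnswer (truth (s.pos i = 0)) s := by
    have hi := hs i
    by_cases h : s.pos i = 0
    · have update_eq : Function.update s.pos i 0 = s.pos := by rw [← h, Function.update_eq_self]
      simp [answer, Prog.run, Instr.outcome, Instr.effect, h, update_eq]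
    · have back : min (s.pos i - 1 + 1) w.length = s.pos i := by omega
      simp [answer, Prog.run, Instr.outcome, Instr.effect, h, back]
  have inRange : (((bothLeft A i j).run w)^[w.length + 1] s).InRange w :=
    Prog.inRange_run w (.loop (bothLeft A i j)) hs
  have pos_eq_zero_iff :
      (((bothLeft A i j).run w)^[w.length + 1] s).pos i = 0 ↔ s.pos i ≤ s.pos j := by
    have hi := hs i
    rw [pos_iterate_bothLeft hij _ hs]
    omega
  simp only [Prog.run]
  rw [run_answer inRange, pos_eq_zero_iff,
    ← (semiconj_pushAnswer_bothRight _).iterate_right (w.length + 1),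
    iterate_bothRight_iterate_bothLeft hij _ hs]

namespace Definable

variable {C : Type} [PosTuple C] {t u : C → ℕ}

theorem le (ht : IsProj t) (hu : IsProj u) : Definable (A := A) C fun _ c => t c ≤ u c := by
  obtain ⟨i, -, hi⟩ := ht.exists_pointer
  obtain ⟨j, -, hj⟩ := hu.exists_pointer
  by_cases hij : i = j
  · exact ⟨.exec (.push 0 true), fun w s _ => ⟨by simp [Prog.run_exec, Instr.effect, hi, hj, hij],
      fun _ _ => rfl⟩⟩
  · obtain ⟨p, hp⟩ := exists_run_le (A := A) hij
    refine ⟨p, fun w s hs => ?_⟩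
    rw [hp w s hs]
    exact ⟨by simp only [hi, hj], fun _ _ => rfl⟩

theorem lt (ht : IsProj t) (hu : IsProj u) : Definable (A := A) C fun _ c => t c < u c :=
  (le hu ht).not.congr fun _ _ => not_le.symm

theorem eq (ht : IsProj t) (hu : IsProj u) : Definable (A := A) C fun _ c => t c = u c :=
  ((le ht hu).and (le hu ht)).congr fun _ _ => le_antisymm_iff

end Definable

end Comparison

/-! ### Least fixed points -/

section Derivable

variable {T : Type} {E : List T} {G : T → T → T → Prop}

/-- The least fixed point of a positive `∃∀`-formula over the elements of `E`: a tuple `u` is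
derivable if for some `v` all `z` with `G u v z` are derivable. -/
inductive Derivable (E : List T) (G : T → T → T → Prop) : T → Prop
  | intro (u v : T) : v ∈ E → (∀ z ∈ E, G u v z → Derivable E G z) → Derivable E G u

/-- One round of the computation of the least fixed point. -/
def derivStep (E : List T) (G : T → T → T → Prop) (X : T → Prop) (u : T) : Prop :=
  ∃ v ∈ E, ∀ z ∈ E, G u v z → X z

theorem monotone_derivStep : Monotone (derivStep E G) :=
  fun _ _ hXY _ ⟨v, hv, h⟩ => ⟨v, hv, fun z hz hG => hXY z (h z hz hG)⟩

theorem monotone_iterate_derivStep : Monotone fun n => (derivStep E G)^[n] fun _ => False :=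
  monotone_derivStep.monotone_iterate_of_le_map fun _ => False.elim

theorem derivable_of_iterate_derivStep (n : ℕ) {u : T}
    (h : (derivStep E G)^[n] (fun _ => False) u) : Derivable E G u := by
  induction n generalizing u with
  | zero => exact h.elim
  | succ n ih =>
    rw [Function.iterate_succ_apply'] at h
    obtain ⟨v, hv, h⟩ := h
    exact .intro u v hv fun z hz hG => ih (h z hz hG)

theorem exists_le_length_stable {X : ℕ → T → Prop} (hX : Monotone X) (E : List T) :
    ∃ n ≤ E.length, ∀ z ∈ E, X (n + 1) z → X n z := by
  classical
  by_contra! grows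
  have le_card (n : ℕ) (hn : n ≤ E.length + 1) : n ≤ (E.toFinset.filter (X n)).card := by
    induction n with
    | zero => exact Nat.zero_le _
    | succ n ih =>
      obtain ⟨z, hz, new, old⟩ := grows n (by omega)
      refine (ih (by omega)).trans_lt (Finset.card_lt_card ?_)
      refine (Finset.ssubset_iff_of_subset ?_).2 ⟨z, by simp [hz, new], by simp [old]⟩
      exact Finset.monotone_filter_right _ fun u _ hu => hX n.le_succ u hu
  have card_le := (Finset.card_filter_le E.toFinset (X (E.length + 1))).trans E.toFinset_card_le
  exact absurd ((le_card _ le_rfl).trans card_le) (by omega)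

theorem iterate_derivStep_length_iff {u : T} (hu : u ∈ E) :
    (derivStep E G)^[E.length] (fun _ => False) u ↔ Derivable E G u := by
  refine ⟨derivable_of_iterate_derivStep _, fun h => ?_⟩
  obtain ⟨n, hn, stable⟩ := exists_le_length_stable (monotone_iterate_derivStep (G := G)) E
  refine monotone_iterate_derivStep hn u ?_
  induction h with
  | intro u v hv _ ih =>
    refine stable u hu ?_
    rw [Function.iterate_succ_apply']
    exact ⟨v, hv, fun z hz hG => ih z hz hG hz stable⟩

end Derivable

section Tables

/-- The characteristic bits of a predicate on a list, which programs store on a stack. -/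
noncomputable abbrev truthTable {T : Type} (E : List T) (χ : T → Prop) : List Bool :=
  E.map fun z => truth (χ z)

@[simp] theorem update_vec_zero (a b c d x : List Bool) :
    Function.update (![a, b, c, d] : Stacks) 0 x = ![x, b, c, d] := by
  funext k
  fin_cases k <;> rfl

@[simp] theorem update_vec_one (a b c d x : List Bool) :
    Function.update (![a, b, c, d] : Stacks) 1 x = ![a, x, c, d] := by
  funext k
  fin_cases k <;> rfl

@[simp] theorem update_vec_two (a b c d x : List Bool) :
    Function.update (![a, b, c, d] : Stacks) 2 x = ![a, b, x, d] := by
  funext k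
  fin_cases k <;> rfl

@[simp] theorem update_vec_three (a b c d x : List Bool) :
    Function.update (![a, b, c, d] : Stacks) 3 x = ![a, b, c, x] := by
  funext k
  fin_cases k <;> rfl

theorem stacks_eta (S : Stacks) : ![S 0, S 1, S 2, S 3] = S := by
  funext k
  fin_cases k <;> rfl

section Fold

variable {X Y : Type} {f : Y → X → Y}

theorem foldl_push (φ : List Bool → Y) {χ : X → Bool} (hf : ∀ l x, f (φ l) x = φ (χ x :: l))
    (E : List X) (l : List Bool) : E.foldl f (φ l) = φ ((E.map χ).reverse ++ l) := by
  induction E generalizing l with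
  | nil => rfl
  | cons x E ih => simp [hf, ih]

theorem foldl_drop (φ : List Bool → Y) (hf : ∀ b l x, f (φ (b :: l)) x = φ l) (E : List X)
    (χ : X → Bool) (l : List Bool) : E.foldl f (φ (E.map χ ++ l)) = φ l := by
  induction E with
  | nil => rfl
  | cons x E ih => simp [hf, ih]

theorem foldl_move (φ : List Bool → List Bool → Y)
    (hf : ∀ b l m x, f (φ (b :: l) m) x = φ l (b :: m)) (E : List X) {t : List Bool}
    (ht : t.length = E.length) (l m : List Bool) :
    E.foldl f (φ (t ++ l) m) = φ l (t.reverse ++ m) := by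
  induction E generalizing t m with
  | nil => simp [List.eq_nil_of_length_eq_zero ht]
  | cons x E ih =>
    obtain ⟨b, t, rfl⟩ := List.exists_cons_of_length_eq_add_one ht
    rw [List.foldl_cons, List.cons_append, hf, ih (by simpa using ht)]
    simp

theorem foldl_iterate {Z : Type} (φ : Z → Y) {g : Z → Z} (hf : ∀ a x, f (φ a) x = φ (g a))
    (E : List X) (a : Z) : E.foldl f (φ a) = φ (g^[E.length] a) := by
  rw [List.foldl_hom φ (g₁ := fun a _ => g a) fun a x => hf a x, List.foldl_const]

theorem foldl_scan (φ : Bool → List Bool → List Bool → Y) {g : X → Bool → Bool}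
    (hf : ∀ a b l m x, f (φ a (b :: l) m) x = φ (a && g x b) l (b :: m)) (E : List X)
    (χ : X → Bool) (a : Bool) (l m : List Bool) :
    E.foldl f (φ a (E.map χ ++ l) m) =
      φ (a && truth (∀ x ∈ E, g x (χ x) = true)) l ((E.map χ).reverse ++ m) := by
  induction E generalizing a m with
  | nil => simp
  | cons x E ih =>
    rw [List.foldl_cons, List.map_cons, List.cons_append, hf, ih, Bool.and_assoc]
    simp only [List.forall_mem_cons, truth_and, truth_eq_true, List.reverse_cons, List.append_assoc,
      List.singleton_append]

end Fold

variable {A C T : Type} [PosTuple C] [PosTuple T]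

namespace Computes

theorem drop (k : Fin 4) :
    Computes (A := A) C fun _ _ S => Function.update S k (S k).tail :=
  (Computes.pop k .skip .skip).congr fun _ _ _ => ite_self _

/-- If stack `k` is empty, then `false` is pushed. -/
theorem move (k l : Fin 4) :
    Computes (A := A) C fun _ _ S => Function.update (Function.update S k (S k).tail) l
      (((S k).head? == some true) :: Function.update S k (S k).tail l) :=
  (Computes.pop k (.push l true) (.push l false)).congr fun _ _ S => by
    cases h : (S k).head? == some true <;> simp_all

end Computes

variable {R : List A → C → T → Prop}

theorem exists_computes_scan (g : Bool → Bool → Bool)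
    (hR : Definable (C × T) fun w x => R w x.1 x.2) :
    ∃ F, Computes (A := A) (C × T) F ∧ ∀ w x (a b : Bool) (s₀ s₁ s₂ s₃ : List Bool),
      F w x ![a :: s₀, b :: s₁, s₂, s₃] =
        ![(a && g (truth (R w x.1 x.2)) b) :: s₀, s₁, b :: s₂, s₃] := by
  have leaf (r b a : Bool) :=
    (Computes.push (A := A) (C := C × T) 2 b).seq (Computes.push 0 (a && g r b))
  have branch (r : Bool) := Computes.pop 1
    (Computes.pop 0 (leaf r true true) (leaf r true false))
    (Computes.pop 0 (leaf r false true) (leaf r false false))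
  refine ⟨_, hR.seq (Computes.pop 0 (branch true) (branch false)), fun w x a b s₀ s₁ s₂ s₃ => ?_⟩
  cases truth (R w x.1 x.2) <;> cases a <;> cases b <;> simp

variable [Enum T]

theorem exists_computes_forall (g : Bool → Bool → Bool)
    (hR : Definable (C × T) fun w x => R w x.1 x.2) :
    ∃ F, Computes (A := A) C F ∧ ∀ w c (χ : T → Prop) (s₀ s₁ s₂ s₃ : List Bool),
      F w c ![s₀, truthTable (Enum.enum w.length) χ ++ s₁, s₂, s₃] =
        ![truth (∀ z ∈ Enum.enum w.length, g (truth (R w c z)) (truth (χ z)) = true) :: s₀,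
          truthTable (Enum.enum w.length) χ ++ s₁, s₂, s₃] := by
  obtain ⟨F, hF, eF⟩ := exists_computes_scan g hR
  refine ⟨_, ((Computes.push 0 true).seq (Enum.computes_for (T := T) hF)).seq
    (Enum.computes_for (T := T) (Computes.move 2 1)), fun w c χ s₀ s₁ s₂ s₃ => ?_⟩
  have scan := foldl_scan (f := fun S z => F w (c, z) S) (g := fun z => g (truth (R w c z)))
    (fun a l m => ![a :: s₀, l, m, s₃]) (fun a b l m z => eF w (c, z) a b s₀ l m s₃)
    (Enum.enum w.length) fun z => truth (χ z)
  simp only [Matrix.cons_val_zero, update_vec_zero, scan, Bool.true_and]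
  refine (foldl_move (fun l m => ![_, m, l, s₃]) (fun b l m _ => ?_) _ (by simp) s₂ s₁).trans ?_
  · simp
  · simp

variable {G : List A → C → T → T → T → Prop}

theorem exists_computes_exists_forall {G : List A → C → T → T → Prop}
    (hG : Definable ((C × T) × T) fun w x => G w x.1.1 x.1.2 x.2) :
    ∃ F, Computes (A := A) C F ∧ ∀ w c (χ : T → Prop) (s₀ s₁ s₂ s₃ : List Bool),
      F w c ![s₀, truthTable (Enum.enum w.length) χ ++ s₁, s₂, s₃] =
        ![s₀, truthTable (Enum.enum w.length) χ ++ s₁, s₂,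
          truth (∃ v ∈ Enum.enum w.length, ∀ z ∈ Enum.enum w.length, G w c v z → χ z) :: s₃] := by
  obtain ⟨F, hF, eF⟩ := exists_computes_forall (fun r b => !r || b)
    (C := C × T) (R := fun w x z => G w x.1 x.2 z) hG
  obtain ⟨O, hO, eO⟩ := exists_computes_or (A := A) (C := C × T)
  refine ⟨_, ((Computes.push 0 false).seq (Enum.computes_for (T := T) (hF.seq hO))).seq
    (Computes.move 0 3), fun w c χ s₀ s₁ s₂ s₃ => ?_⟩
  set table := truthTable (Enum.enum w.length) χ
  have any := foldl_or (fun a => ![a :: s₀, table ++ s₁, s₂, s₃])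
    (f := fun S v => O w (c, v) (F w (c, v) S))
    (p := fun v => ∀ z ∈ Enum.enum w.length, G w c v z → χ z) (fun a v => by
      have or_eq := eO w (c, v) ![s₀, table ++ s₁, s₂, s₃] a
      simp only [pushBit, Matrix.cons_val_zero, update_vec_zero] at or_eq
      simp [eF, or_eq, table, imp_iff_not_or])
    (Enum.enum w.length) false
  simp only [Matrix.cons_val_zero, update_vec_zero, any, Bool.false_or]
  simp

theorem exists_computes_round
    (hG : Definable (((C × T) × T) × T) fun w x => G w x.1.1.1 x.1.1.2 x.1.2 x.2) :
    ∃ F, Computes (A := A) C F ∧ ∀ w c (χ : T → Prop) (s₀ s₁ s₂ s₃ : List Bool),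
      F w c ![s₀, truthTable (Enum.enum w.length) χ ++ s₁, s₂, s₃] =
        ![s₀, truthTable (Enum.enum w.length)
          (derivStep (Enum.enum w.length) (G w c) χ) ++ s₁, s₂, s₃] := by
  obtain ⟨F, hF, eF⟩ := exists_computes_exists_forall (C := C × T)
    (G := fun w x v z => G w x.1 x.2 v z) hG
  refine ⟨_, ((Enum.computes_for (T := T) hF).seq
    (Enum.computes_for (T := T) (Computes.drop 1))).seq
    (Enum.computes_for (T := T) (Computes.move 3 1)), fun w c χ s₀ s₁ s₂ s₃ => ?_⟩
  have next := foldl_push (fun l => ![s₀, truthTable (Enum.enum w.length) χ ++ s₁,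
    s₂, l]) (f := fun S u => F w (c, u) S) (fun l u => eF w (c, u) χ s₀ s₁ s₂ l)
    (Enum.enum w.length) s₃
  rw [next, foldl_drop (fun l => ![s₀, l, s₂, _]) (by simp) _ _ s₁]
  refine (foldl_move (fun l m => ![s₀, m, s₂, l]) (by simp) _ (by simp) s₃ s₁).trans ?_
  simp [derivStep]

/-- The additional component of the tuple in `hG` is the counter of the rounds. -/
theorem exists_computes_derivable
    (hG : Definable ((((C × T) × T) × T) × T) fun w x => G w x.1.1.1.1 x.1.1.2 x.1.2 x.2) :
    ∃ F, Computes (A := A) C F ∧ ∀ w c (s₀ s₁ s₂ s₃ : List Bool),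
      F w c ![s₀, s₁, s₂, s₃] =
        ![s₀, truthTable (Enum.enum w.length) (Derivable (Enum.enum w.length) (G w c)) ++ s₁, s₂,
          s₃] := by
  obtain ⟨F, hF, eF⟩ := exists_computes_round (C := C × T) (G := fun w x => G w x.1) hG
  refine ⟨_, (Enum.computes_for (T := T) (Computes.push 1 false)).seq
    (Enum.computes_for (T := T) hF), fun w c s₀ s₁ s₂ s₃ => ?_⟩
  have init := foldl_push (fun l => (![s₀, l, s₂, s₃] : Stacks))
   
    (f := fun (S : Stacks) (_ : T) => Function.update S 1 (false :: S 1))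
    (χ := fun _ => truth False) (fun l _ => by simp) (Enum.enum w.length) s₁
  have rounds := foldl_iterate
    (fun χ : T → Prop => ![s₀, truthTable (Enum.enum w.length) χ ++ s₁, s₂, s₃])
    (f := fun S x => F w (c, x) S) (g := derivStep (Enum.enum w.length) (G w c))
    (fun χ x => eF w (c, x) χ s₀ s₁ s₂ s₃) (Enum.enum (T := T) w.length) fun _ => False
  have reverse_eq : (truthTable (T := T) (Enum.enum w.length) fun _ => False).reverse =
      truthTable (T := T) (Enum.enum w.length) fun _ => False := by
    simp [truthTable]
  rw [init, reverse_eq, rounds]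
  congr 3
  exact List.map_congr_left fun u hu => by rw [iterate_derivStep_length_iff hu]

theorem Definable.exists_derivable {Q : List A → C → T → Prop}
    (hG : Definable ((((C × T) × T) × T) × T) fun w x => G w x.1.1.1.1 x.1.1.2 x.1.2 x.2)
    (hQ : Definable (C × T) fun w x => Q w x.1 x.2) :
    Definable C fun w c => ∃ u ∈ Enum.enum w.length, Q w c u ∧
      Derivable (Enum.enum w.length) (G w c) u := by
  obtain ⟨F, hF, eF⟩ := exists_computes_derivable hG
  obtain ⟨P, hP, eP⟩ := exists_computes_forall (fun r b => !(r && b)) hQ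
  have computes := ((hF.seq hP).seq (Enum.computes_for (T := T) (Computes.drop 1))).seq
    (Computes.pop 0 (Computes.push 0 false) (Computes.push 0 true))
  refine computes.congr fun w c S => ?_
  rw [← stacks_eta S]
  generalize S 0 = s₀, S 1 = s₁, S 2 = s₂, S 3 = s₃
  have query : truth (∃ u ∈ Enum.enum w.length, Q w c u ∧
      Derivable (Enum.enum w.length) (G w c) u) = !truth (∀ u ∈ Enum.enum w.length,
        (!(truth (Q w c u) && truth (Derivable (Enum.enum w.length) (G w c) u))) = true) := by
    rw [← truth_not]
    simp
  rw [eF, eP, foldl_drop (fun l => ![_, l, s₂, s₃]) (by simp) _ _ s₁, query]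
  cases truth (∀ u ∈ Enum.enum (T := T) w.length, _) <;> simp [pushBit]

end Tables

theorem inP_of_definable {Γ Δ : Type} [Finite Γ] [Finite Δ] [Inhabited Γ]
    {R : List (Γ ⊕ Δ) → Unit → Prop} (hR : Definable Unit R) :
    InP {p : List Γ × List Δ | R (encPair p) ()} := by
  obtain ⟨p, hp⟩ := hR
  exact inP_of_run p fun x => ⟨truth (R (encPair x) ()), truth_eq_true_iff,
    (hp (encPair x) _ fun _ => le_rfl).1⟩

/-! ### Reachability -/

/-- Tuples from which a tuple with `P` is reachable along `S` through members of `E`. -/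
inductive Reaches {T : Type} (E : List T) (S : T → T → Prop) (P : T → Prop) : T → Prop
  | target (u : T) : P u → Reaches E S P u
  | step (u v : T) : v ∈ E → S u v → Reaches E S P v → Reaches E S P u

theorem derivable_iff_reaches {T : Type} {E : List T} {S : T → T → Prop} {P : T → Prop} {u : T}
    (hu : u ∈ E) :
    Derivable E (fun u v z => ¬P u ∧ (S u v → z = v)) u ↔ Reaches E S P u := by
  refine ⟨fun h => ?_, fun h => ?_⟩
  · induction h with
    | intro u v hv _ ih =>
      by_cases target : P u
      · exact .target u target
      by_cases edge : S u v
      · exact .step u v hv edge (ih v hv ⟨target, fun _ => rfl⟩ hv)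
      · exact ih u hu ⟨target, fun h => (edge h).elim⟩ hu
  · induction h with
    | target u target => exact .intro u u hu fun z _ hz => (hz.1 target).elim
    | step u v hv edge _ ih => exact .intro u v hv fun z _ hG => hG.2 edge ▸ ih hv

theorem Definable.exists_reaches {A C T : Type} [PosTuple C] [PosTuple T] [Enum T]
    {S : List A → C → T → T → Prop} {P Q : List A → C → T → Prop}
    (hT : Definable (A := A) ((((C × T) × T) × T) × T) fun _ x => x.2 = x.1.2)
    (hS : Definable ((((C × T) × T) × T) × T) fun w x => S w x.1.1.1.1 x.1.1.2 x.1.2)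
    (hP : Definable ((((C × T) × T) × T) × T) fun w x => P w x.1.1.1.1 x.1.1.2)
    (hQ : Definable (C × T) fun w x => Q w x.1 x.2) :
    Definable C fun w c => ∃ u ∈ Enum.enum w.length, Q w c u ∧
      Reaches (Enum.enum w.length) (S w c) (P w c) u :=
  (exists_derivable (G := fun w c u v z => ¬P w c u ∧ (S w c u v → z = v))
    (hP.not.and (hS.imp hT)) hQ).congr fun _ _ => exists_congr fun _ =>
      and_congr_right fun hu => and_congr_right fun _ => (derivable_iff_reaches hu).symm

/-! ### Unit propagation -/

/-- The complementary literal. -/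
def Literal.compl (l : Literal) : Literal := ⟨l.var, !l.positive⟩

@[simp] theorem Literal.compl_var (l : Literal) : l.compl.var = l.var := rfl

@[simp] theorem Literal.compl_positive (l : Literal) : l.compl.positive = !l.positive := rfl

@[simp] theorem Literal.compl_compl (l : Literal) : l.compl.compl = l := by
  ext <;> simp [Literal.compl]

/-- The literal is true under the valuation. -/
def Literal.Holds (v : Var → Bool) (l : Literal) : Prop := v l.var = l.positive

theorem Literal.holds_compl {v : Var → Bool} {l : Literal} : l.compl.Holds v ↔ ¬l.Holds v :=
  Bool.eq_not

/-- The literals that unit propagation derives from the clauses in `Cs` and the literals in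
`base`. -/
inductive UnitDerivable (Cs : Set Clause) (base : Literal → Prop) : Literal → Prop
  | base (l : Literal) : base l → UnitDerivable Cs base l
  | unit (C : Clause) (l : Literal) : C ∈ Cs → l ∈ C →
      (∀ l' ∈ C, l' ≠ l → UnitDerivable Cs base l'.compl) → UnitDerivable Cs base l

/-- Unit propagation derives two complementary literals, or one of the clauses is empty. -/
def Conflict (Cs : Set Clause) (base : Literal → Prop) : Prop :=
  (∃ l, UnitDerivable Cs base l ∧ UnitDerivable Cs base l.compl) ∨ ∅ ∈ Cs

/-- A consistent set of literals that is closed under unit propagation and refutes no clause. -/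
structure Saturated (Cs : Set Clause) (M : Literal → Prop) : Prop where
  consistent : ∀ l, M l → ¬M l.compl
  exists_not_compl : ∀ C ∈ Cs, ∃ l ∈ C, ¬M l.compl
  unit : ∀ C ∈ Cs, ∀ l ∈ C, (∀ l' ∈ C, l' ≠ l → M l'.compl) → M l

/-- A literal of `τ` occurs in `C`, or at most one positive literal of `C` is not false. -/
def HornClause (τ : Literal → Prop) (C : Clause) : Prop :=
  (∃ l ∈ C, τ l) ∨ ∀ l ∈ C, ∀ l' ∈ C, ¬τ l.compl → ¬τ l'.compl → l.positive = true →
    l'.positive = true → l = l'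

/-- A literal of `τ` occurs in `C`, or at most two literals of `C` are not false. -/
def KromClause (τ : Literal → Prop) (C : Clause) : Prop :=
  (∃ l ∈ C, τ l) ∨ ∀ l ∈ C, ∀ l' ∈ C, ∀ l'' ∈ C, ¬τ l.compl → ¬τ l'.compl → ¬τ l''.compl →
    l = l' ∨ l = l'' ∨ l' = l''

/-- A literal of `τ` occurs in `C`, or at most one literal of `C` is not false, and it is
positive. -/
def IDClause (τ : Literal → Prop) (C : Clause) : Prop :=
  (∃ l ∈ C, τ l) ∨ ∀ l ∈ C, ∀ l' ∈ C, ¬τ l.compl → ¬τ l'.compl → l = l' ∧ l.positive = true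

theorem IDClause.hornClause {τ : Literal → Prop} {C : Clause} (h : IDClause τ C) :
    HornClause τ C :=
  h.imp_right fun h l hl l' hl' free free' _ _ => (h l hl l' hl' free free').1

theorem HornClause.mono {τ τ' : Literal → Prop} (h : ∀ l, τ l → τ' l) {C : Clause}
    (hC : HornClause τ C) : HornClause τ' C :=
  hC.imp (fun ⟨l, hl, hτ⟩ => ⟨l, hl, h l hτ⟩) fun hC l hl l' hl' free free' =>
    hC l hl l' hl' (mt (h _) free) (mt (h _) free')

theorem KromClause.mono {τ τ' : Literal → Prop} (h : ∀ l, τ l → τ' l) {C : Clause}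
    (hC : KromClause τ C) : KromClause τ' C :=
  hC.imp (fun ⟨l, hl, hτ⟩ => ⟨l, hl, h l hτ⟩)
    fun hC l hl l' hl' l'' hl'' free free' free'' =>
      hC l hl l' hl' l'' hl'' (mt (h _) free) (mt (h _) free') (mt (h _) free'')

section UnitPropagation

variable {Cs : Set Clause} {base base' : Literal → Prop}

theorem UnitDerivable.mono (h : ∀ l, base l → base' l) {l : Literal}
    (hl : UnitDerivable Cs base l) : UnitDerivable Cs base' l := by
  induction hl with
  | base l hl => exact .base l (h l hl)
  | unit C l hC hl _ ih => exact .unit C l hC hl ih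

theorem Conflict.mono (h : ∀ l, base l → base' l) (hc : Conflict Cs base) : Conflict Cs base' :=
  hc.imp_left fun ⟨l, hl, hl'⟩ => ⟨l, hl.mono h, hl'.mono h⟩

theorem UnitDerivable.holds {v : Var → Bool} (hv : ∀ C ∈ Cs, ∃ l ∈ C, l.Holds v)
    (hb : ∀ l, base l → l.Holds v) {l : Literal} (hl : UnitDerivable Cs base l) : l.Holds v := by
  induction hl with
  | base l hl => exact hb l hl
  | unit C l hC _ _ ih =>
    obtain ⟨l', hl', holds⟩ := hv C hC
    by_cases eq : l' = l
    · exact eq ▸ holds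
    · exact (Literal.holds_compl.1 (ih l' hl' eq) holds).elim

theorem not_conflict_of_holds {v : Var → Bool} (hv : ∀ C ∈ Cs, ∃ l ∈ C, l.Holds v)
    (hb : ∀ l, base l → l.Holds v) : ¬Conflict Cs base := by
  rintro (⟨l, hl, hl'⟩ | empty)
  · exact Literal.holds_compl.1 (hl'.holds hv hb) (hl.holds hv hb)
  · obtain ⟨l, hl, -⟩ := hv _ empty
    exact Finset.notMem_empty l hl

theorem saturated_unitDerivable (hc : ¬Conflict Cs base) :
    Saturated Cs (UnitDerivable Cs base) where
  consistent l hl hl' := hc (.inl ⟨l, hl, hl'⟩)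
  exists_not_compl C hC := by
    by_contra! refuted
    rcases C.eq_empty_or_nonempty with rfl | ⟨l, hl⟩
    · exact hc (.inr hC)
    · exact hc (.inl ⟨l, .unit C l hC hl fun l' hl' _ => refuted l' hl', refuted l hl⟩)
  unit C hC l hl := .unit C l hC hl

/-- Making true exactly the derivable variables satisfies a Horn clause: otherwise all its
literals but a positive one are refuted, which is then derivable. -/
theorem exists_holds_of_horn (hH : ∀ C ∈ Cs, HornClause base C) (hc : ¬Conflict Cs base) :
    ∃ v : Var → Bool, (∀ C ∈ Cs, ∃ l ∈ C, l.Holds v) ∧ ∀ l, base l → l.Holds v := by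
  classical
  have sat := saturated_unitDerivable hc
  set M := UnitDerivable Cs base
  set v : Var → Bool := fun x => decide (M ⟨x, true⟩)
  have holds_pos (x : Var) : (⟨x, true⟩ : Literal).Holds v ↔ M ⟨x, true⟩ := decide_eq_true_iff
  have holds_neg (x : Var) : (⟨x, false⟩ : Literal).Holds v ↔ ¬M ⟨x, true⟩ :=
    decide_eq_false_iff_not
  have holds : ∀ l, M l → l.Holds v := by
    rintro ⟨x, _ | _⟩ hl
    · exact (holds_neg x).2 (sat.consistent _ · hl)
    · exact (holds_pos x).2 hl
  refine ⟨v, fun C hC => ?_, fun l hl => holds l (.base l hl)⟩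
  rcases hH C hC with ⟨l, hl, hb⟩ | unique
  · exact ⟨l, hl, holds l (.base l hb)⟩
  by_contra! fails
  have neg_refuted : ∀ l ∈ C, l.positive = false → M l.compl := by
    rintro ⟨x, _⟩ hl rfl
    exact not_not.1 (mt (holds_neg x).2 (fails _ hl))
  obtain ⟨l, hl, free⟩ := sat.exists_not_compl C hC
  have hpos : l.positive = true := Bool.not_eq_false _ |>.mp (mt (neg_refuted l hl) free)
  refine fails l hl (holds l (sat.unit C hC l hl fun l' hl' ne => ?_))
  by_contra free'
  have hpos' : l'.positive = true := Bool.not_eq_false _ |>.mp (mt (neg_refuted l' hl') free')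
  exact ne (unique l' hl' l hl (mt (.base _) free') (mt (.base _) free) hpos' hpos)

open Classical in
/-- The valuation that agrees, on each variable, with the first of the sets `M 0, M 1, …` that
contains a literal of this variable. -/
noncomputable def priorityValuation (M : ℕ → Literal → Prop) (x : Var) : Bool :=
  decide (∃ n, M n ⟨x, true⟩ ∧ ∀ m < n, ¬M m ⟨x, false⟩)

theorem holds_priorityValuation {M : ℕ → Literal → Prop} {n : ℕ} {l : Literal}
    (consistent : M n l → ¬M n l.compl) (hl : M n l) (first : ∀ m < n, ¬M m l.compl) :
    l.Holds (priorityValuation M) := by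
  classical
  obtain ⟨x, _ | _⟩ := l
  · refine decide_eq_false fun ⟨k, hk, first'⟩ => ?_
    rcases lt_trichotomy n k with lt | rfl | lt
    · exact first' n lt hl
    · exact consistent hl hk
    · exact first k lt hk
  · exact decide_eq_true ⟨n, hl, first⟩

/-- The first of the sets `M n` that assigns an undetermined literal of a Krom clause makes one of
them true. -/
theorem exists_holds_of_saturated {M : ℕ → Literal → Prop} (sat : ∀ n, Saturated Cs (M n))
    (hbase : ∀ n l, base l → M n l) (cover : ∀ C ∈ Cs, ∀ l ∈ C, ∃ n, M n l ∨ M n l.compl)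
    (hK : ∀ C ∈ Cs, KromClause base C) :
    ∃ v : Var → Bool, (∀ C ∈ Cs, ∃ l ∈ C, l.Holds v) ∧ ∀ l, base l → l.Holds v := by
  have holds_base : ∀ l, base l → l.Holds (priorityValuation M) := fun l hl =>
    holds_priorityValuation ((sat 0).consistent l) (hbase 0 l hl) fun m hm =>
      (Nat.not_lt_zero m hm).elim
  refine ⟨_, fun C hC => ?_, holds_base⟩
  rcases hK C hC with ⟨l, hl, hb⟩ | two
  · exact ⟨l, hl, holds_base l hb⟩
  have assigned : ∃ n, ∃ l ∈ C, ¬base l.compl ∧ (M n l ∨ M n l.compl) := by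
    obtain ⟨l, hl, free⟩ := (sat 0).exists_not_compl C hC
    obtain ⟨n, hn⟩ := cover C hC l hl
    exact ⟨n, l, hl, mt (hbase 0 _) free, hn⟩
  classical
  set n := Nat.find assigned
  have assigned_true : ∃ l ∈ C, ¬base l.compl ∧ M n l := by
    obtain ⟨l, hl, free, hM | hM⟩ := Nat.find_spec assigned
    · exact ⟨l, hl, free, hM⟩
    obtain ⟨l', hl', open'⟩ := (sat n).exists_not_compl C hC
    have free' := mt (hbase n _) open'
    refine ⟨l', hl', free', (sat n).unit C hC l' hl' fun k hk ne => ?_⟩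
    by_cases hb : base k.compl
    · exact hbase n _ hb
    rcases two l' hl' l hl k hk free' free hb with rfl | rfl | rfl
    · exact (open' hM).elim
    · exact (ne rfl).elim
    · exact hM
  obtain ⟨l, hl, free, hM⟩ := assigned_true
  exact ⟨l, hl, holds_priorityValuation ((sat n).consistent l) hM fun m hm h =>
    Nat.find_min assigned hm ⟨l, hl, free, .inr h⟩⟩

theorem exists_holds_of_krom (hK : ∀ C ∈ Cs, KromClause base C) (hc : ¬Conflict Cs base)
    (hx : ∀ C ∈ Cs, ∀ l ∈ C, ∃ s, ¬Conflict Cs fun l' => base l' ∨ l' = ⟨l.var, s⟩) :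
    ∃ v : Var → Bool, (∀ C ∈ Cs, ∃ l ∈ C, l.Holds v) ∧ ∀ l, base l → l.Holds v := by
  have exists_saturated (n : ℕ) : ∃ M, Saturated Cs M ∧ (∀ l, base l → M l) ∧
      ∀ C ∈ Cs, ∀ l ∈ C, Encodable.encode l.var = n → M l ∨ M l.compl := by
    by_cases occurs : ∃ C ∈ Cs, ∃ l ∈ C, Encodable.encode l.var = n
    · obtain ⟨C, hC, l, hl, rfl⟩ := occurs
      obtain ⟨s, hs⟩ := hx C hC l hl
      refine ⟨_, saturated_unitDerivable hs, fun k hk => .base k (.inl hk), ?_⟩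
      rintro - - ⟨y, t⟩ - eq
      obtain rfl : y = l.var := Encodable.encode_injective eq
      rcases Bool.eq_or_eq_not t s with rfl | rfl
      · exact .inl (.base _ (.inr rfl))
      · exact .inr (.base _ (.inr (by simp [Literal.compl])))
    · push Not at occurs
      exact ⟨_, saturated_unitDerivable hc, .base, fun C hC l hl eq => (occurs C hC l hl eq).elim⟩
  choose M sat hbase cover using exists_saturated
  exact exists_holds_of_saturated sat hbase (fun C hC l hl => ⟨_, cover _ C hC l hl rfl⟩) hK

end UnitPropagation

/-! ### Reducts -/

section Reduct

variable {X : Finset Var} (θ : Assignment X)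

/-- The literals that are true under a partial assignment. -/
def Assignment.Sets (l : Literal) : Prop := θ.literalValue l = some true

theorem Assignment.sets_iff {l : Literal} :
    θ.Sets l ↔ ∃ h : l.var ∈ X, θ ⟨l.var, h⟩ = l.positive := by
  unfold Assignment.Sets Assignment.literalValue
  split_ifs <;> simp_all

theorem Assignment.sets_compl_iff (l : Literal) :
    θ.Sets l.compl ↔ θ.literalValue l = some false := by
  unfold Assignment.Sets Assignment.literalValue
  simp only [Literal.compl_var, Literal.compl_positive]
  split_ifs with h <;> simp_all

open Classical in
theorem forall_mem_reduct_iff {φ : CNF} {P : Clause → Prop} :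
    (∀ D ∈ φ.reduct θ, P D) ↔
      ∀ C ∈ φ, (∃ l ∈ C, θ.Sets l) ∨ P (C.filter fun l => ¬θ.Sets l.compl) := by
  simp only [CNF.reduct, Finset.forall_mem_image, Finset.mem_filter, and_imp, ne_eq,
    or_iff_not_imp_left, not_exists, not_and, ← Assignment.sets_compl_iff]
  exact forall₂_congr fun C _ => imp_congr_right fun _ => by congr!

theorem reduct_mem_horn_iff {φ : CNF} : φ.reduct θ ∈ Horn ↔ ∀ C ∈ φ, HornClause θ.Sets C := by
  classical
  refine (forall_mem_reduct_iff θ).trans (forall₂_congr fun C _ => or_congr_right ?_)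
  simp only [Finset.card_le_one, Finset.mem_filter]
  exact ⟨fun h l hl l' hl' free free' hpos hpos' => h l ⟨⟨hl, free⟩, hpos⟩ l' ⟨⟨hl', free'⟩, hpos'⟩,
    fun h l hl l' hl' => h l hl.1.1 l' hl'.1.1 hl.1.2 hl'.1.2 hl.2 hl'.2⟩

theorem reduct_mem_krom_iff {φ : CNF} : φ.reduct θ ∈ Krom ↔ ∀ C ∈ φ, KromClause θ.Sets C := by
  classical
  refine (forall_mem_reduct_iff θ).trans (forall₂_congr fun C _ => or_congr_right ?_)
  simp only [← not_lt, Finset.two_lt_card, Finset.mem_filter]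
  grind

theorem reduct_mem_id_iff {φ : CNF} : φ.reduct θ ∈ ID ↔ ∀ C ∈ φ, IDClause θ.Sets C := by
  classical
  refine (forall_mem_reduct_iff θ).trans (forall₂_congr fun C _ => or_congr_right ?_)
  simp only [Finset.card_le_one, Finset.mem_filter]
  exact ⟨fun h l hl l' hl' free free' => ⟨h.1 l ⟨hl, free⟩ l' ⟨hl', free'⟩, h.2 l ⟨hl, free⟩⟩,
    fun h => ⟨fun l hl l' hl' => (h l hl.1 l' hl'.1 hl.2 hl'.2).1,
      fun l hl => (h l hl.1 l hl.1 hl.2 hl.2).2⟩⟩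

end Reduct

/-- The literals from which unit propagation starts when it tries to derive the clause `D` under
the partial assignment that makes `τ` true, in the case where the literal `a` is true. -/
def refutationBase (τ : Literal → Prop) (D : Clause) (a l : Literal) : Prop :=
  τ l ∨ l.compl ∈ D ∨ l = a

section Entailment

variable {Cs : Set Clause}

theorem exists_holds_of_forall_not_conflict {base : Literal → Prop} {V : Set Var}
    (hne : V.Nonempty) (hV : ∀ C ∈ Cs, ∀ l ∈ C, l.var ∈ V)
    (hCs : (∀ C ∈ Cs, HornClause base C) ∨ ∀ C ∈ Cs, KromClause base C)
    (hx : ∀ x ∈ V, ∃ s, ¬Conflict Cs fun l => base l ∨ l = ⟨x, s⟩) :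
    ∃ v : Var → Bool, (∀ C ∈ Cs, ∃ l ∈ C, l.Holds v) ∧ ∀ l, base l → l.Holds v := by
  have hc : ¬Conflict Cs base := by
    obtain ⟨x, hxV⟩ := hne
    obtain ⟨s, hs⟩ := hx x hxV
    exact mt (.mono fun l => .inl) hs
  rcases hCs with hH | hK
  · exact exists_holds_of_horn hH hc
  · exact exists_holds_of_krom hK hc fun C hC l hl => hx _ (hV C hC l hl)

/-- If unit propagation fails in one of the two cases for every variable, then its results extend
to a countermodel. -/
theorem entails_iff_conflict {Ds : Set Clause} {B : Finset Var} {V : Set Var}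
    (hne : V.Nonempty) (hV : ∀ C ∈ Cs, ∀ l ∈ C, l.var ∈ V)
    (hB : ∀ θ : Assignment B, (∀ C ∈ Cs, HornClause θ.Sets C) ∨ ∀ C ∈ Cs, KromClause θ.Sets C) :
    (∀ v : Var → Bool, (∀ C ∈ Cs, ∃ l ∈ C, l.Holds v) → ∀ D ∈ Ds, ∃ l ∈ D, l.Holds v) ↔
      ∀ θ : Assignment B, ∀ D ∈ Ds, ∃ x ∈ V, ∀ s, Conflict Cs (refutationBase θ.Sets D ⟨x, s⟩) := by
  constructor
  · intro entails θ D hD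
    by_contra! no_conflict
    have classes := (hB θ).imp (fun h C hC => (h C hC).mono fun l => Or.inl (b := l.compl ∈ D))
      fun h C hC => (h C hC).mono fun l => Or.inl (b := l.compl ∈ D)
    obtain ⟨v, hv, hvb⟩ := exists_holds_of_forall_not_conflict hne hV classes
      (by simpa only [or_assoc] using! no_conflict)
    obtain ⟨l, hl, holds⟩ := entails v hv D hD
    exact Literal.holds_compl.1 (hvb l.compl (.inr (by simpa using hl))) holds
  · intro conflict v hv D hD
    by_contra! refuted
    obtain ⟨x, -, hx⟩ := conflict (fun y => v y) D hD
    refine not_conflict_of_holds hv (fun l hl => ?_) (hx (v x))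
    rcases hl with hl | hl | rfl
    · exact ((Assignment.sets_iff _).1 hl).2
    · exact not_not.1 (mt Literal.holds_compl.2 (refuted _ hl))
    · rfl

end Entailment

/-! ### Reading words -/

/-- The alphabet of pairs of an input word and an advice word. -/
abbrev Letter : Type := Symbol ⊕ Fin 3

instance : Inhabited Symbol := ⟨.zero⟩

/-- The letter of a bit of a name. -/
def bitLetter (b : Bool) : Letter := .inl (if b then .one else .zero)

/-- The letter that starts a literal. -/
def signLetter (b : Bool) : Letter := .inl (if b then .pos else .neg)

/-- The name at the beginning of a word. -/
def nameOf : List Letter → Var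
  | .inl .zero :: t => false :: nameOf t
  | .inl .one :: t => true :: nameOf t
  | _ => []

/-- The literals at the beginning of a word, up to the first letter that does not belong to a
literal. -/
def litsOf : List Letter → List Literal
  | .inl .zero :: t => litsOf t
  | .inl .one :: t => litsOf t
  | .inl .pos :: t => ⟨nameOf t, true⟩ :: litsOf t
  | .inl .neg :: t => ⟨nameOf t, false⟩ :: litsOf t
  | _ => []

/-- The name that starts at a position. -/
def nameAt (w : List Letter) (i : ℕ) : Var := nameOf (w.drop i)

/-- The clause whose marker is at a position. -/
def clauseAt (w : List Letter) (c : ℕ) : Clause := (litsOf (w.drop (c + 1))).toFinset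

/-- The letter read at a position, if any, is a bit of a name. -/
def IsBit (a : Option Letter) : Prop := ∃ b, a = some (bitLetter b)

/-- The letter read at a position, if any, starts a literal. -/
def IsSign (a : Option Letter) : Prop := ∃ b, a = some (signLetter b)

theorem nameOf_cons_bitLetter (b : Bool) (t : List Letter) :
    nameOf (bitLetter b :: t) = b :: nameOf t := by
  cases b <;> rfl

theorem nameOf_eq_nil {t : List Letter} (h : ¬IsBit t.head?) : nameOf t = [] := by
  match t with
  | [] => rfl
  | .inr _ :: _ => rfl
  | .inl a :: t =>
    cases a with
    | zero => exact (h ⟨false, rfl⟩).elim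
    | one => exact (h ⟨true, rfl⟩).elim
    | _ => rfl

theorem litsOf_cons_bitLetter (b : Bool) (t : List Letter) :
    litsOf (bitLetter b :: t) = litsOf t := by
  cases b <;> rfl

theorem litsOf_cons_signLetter (b : Bool) (t : List Letter) :
    litsOf (signLetter b :: t) = ⟨nameOf t, b⟩ :: litsOf t := by
  cases b <;> rfl

theorem litsOf_eq_nil {t : List Letter} (h : ¬IsBit t.head?) (h' : ¬IsSign t.head?) :
    litsOf t = [] := by
  match t with
  | [] => rfl
  | .inr _ :: _ => rfl
  | .inl a :: t =>
    cases a with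
    | zero => exact (h ⟨false, rfl⟩).elim
    | one => exact (h ⟨true, rfl⟩).elim
    | pos => exact (h' ⟨true, rfl⟩).elim
    | neg => exact (h' ⟨false, rfl⟩).elim
    | _ => rfl

theorem bitLetter_ne_signLetter (b b' : Bool) : bitLetter b ≠ signLetter b' := by
  cases b <;> cases b' <;> decide

theorem signLetter_injective : Function.Injective signLetter := by
  unfold Function.Injective
  decide

theorem mem_litsOf_iff {t : List Letter} {l : Literal} : l ∈ litsOf t ↔
    ∃ i, t[i]? = some (signLetter l.positive) ∧ (∀ j < i, IsBit t[j]? ∨ IsSign t[j]?) ∧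
      nameOf (t.drop (i + 1)) = l.var := by
  induction t with
  | nil => simp [litsOf]
  | cons a t ih =>
    rw [← Nat.or_exists_add_one]
    simp only [List.getElem?_cons_zero, List.getElem?_cons_succ, List.drop_succ_cons,
      List.drop_zero, Nat.forall_lt_succ_left, Nat.not_lt_zero, false_imp_iff, implies_true,
      true_and, and_assoc, and_left_comm (b := IsBit (some a) ∨ IsSign (some a)), exists_and_left,
      ← ih, Option.some_inj]
    by_cases hb : IsBit (some a)
    · obtain ⟨b, hb⟩ := hb
      obtain rfl : a = bitLetter b := Option.some_injective _ hb
      simp [litsOf_cons_bitLetter, bitLetter_ne_signLetter, IsBit]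
    by_cases hs : IsSign (some a)
    · obtain ⟨b, hs⟩ := hs
      obtain rfl : a = signLetter b := Option.some_injective _ hs
      simp [litsOf_cons_signLetter, signLetter_injective.eq_iff, IsSign, Literal.ext_iff, and_comm,
        eq_comm]
    · have ne : a ≠ signLetter l.positive := fun eq => hs ⟨_, congrArg some eq⟩
      simp [litsOf_eq_nil (t := a :: t) hb hs, ne, hb, hs]

section Positions

variable {w : List Letter} {i j : ℕ}

theorem nameAt_of_bit {b : Bool} (h : w[i]? = some (bitLetter b)) :
    nameAt w i = b :: nameAt w (i + 1) := by
  obtain ⟨hi, eq⟩ := List.getElem?_eq_some_iff.1 h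
  rw [nameAt, List.drop_eq_getElem_cons hi, eq, nameOf_cons_bitLetter, nameAt]

theorem nameAt_of_not_bit (h : ¬IsBit w[i]?) : nameAt w i = [] :=
  nameOf_eq_nil (by rwa [List.head?_drop])

theorem nameAt_eq_nil_iff : nameAt w i = [] ↔ ¬IsBit w[i]? :=
  ⟨fun h ⟨_, hb⟩ => List.cons_ne_nil _ _ ((nameAt_of_bit hb).symm.trans h), nameAt_of_not_bit⟩

theorem nameAt_eq_cons_iff {b : Bool} {x : Var} :
    nameAt w i = b :: x ↔ w[i]? = some (bitLetter b) ∧ nameAt w (i + 1) = x := by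
  refine ⟨fun h => ?_, fun ⟨hb, hx⟩ => hx ▸ nameAt_of_bit hb⟩
  by_cases hb : IsBit w[i]?
  · obtain ⟨b', hb'⟩ := hb
    obtain ⟨rfl, hx⟩ := List.cons_eq_cons.1 ((nameAt_of_bit hb').symm.trans h)
    exact ⟨hb', hx⟩
  · exact (List.cons_ne_nil _ _ (h.symm.trans (nameAt_of_not_bit hb))).elim

theorem lt_length_of_getElem?_eq_some {α : Type} {l : List α} {a : α} (h : l[i]? = some a) :
    i < l.length :=
  (List.getElem?_eq_some_iff.1 h).1

/-- The literal whose sign is at position `i` belongs to the clause with marker at `c`. -/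
def LitIn (w : List Letter) (c i : ℕ) : Prop :=
  c < i ∧ ∀ j ≤ w.length, c < j → j < i → IsBit w[j]? ∨ IsSign w[j]?

theorem mem_clauseAt_iff {c : ℕ} {l : Literal} : l ∈ clauseAt w c ↔
    ∃ i < w.length, LitIn w c i ∧ w[i]? = some (signLetter l.positive) ∧
      nameAt w (i + 1) = l.var := by
  rw [clauseAt, List.mem_toFinset, mem_litsOf_iff]
  simp only [List.getElem?_drop, List.drop_drop]
  constructor
  · rintro ⟨i, sign, before, name⟩
    refine ⟨c + 1 + i, lt_length_of_getElem?_eq_some sign, ⟨by lia, fun j _ hcj hji => ?_⟩, sign,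
      name⟩
    obtain ⟨k, rfl⟩ := Nat.exists_eq_add_of_le (Nat.succ_le_of_lt hcj)
    exact before k (by lia)
  · rintro ⟨i, hi, ⟨hci, before⟩, sign, name⟩
    obtain ⟨k, rfl⟩ := Nat.exists_eq_add_of_le (Nat.succ_le_of_lt hci)
    exact ⟨k, sign, fun j hj => before _ (by lia) (by lia) (by lia), name⟩

/-- Both positions of a pair advance over equal bits. -/
def SameBit (w : List Letter) (u v : ℕ × ℕ) : Prop :=
  (∃ b, w[u.1]? = some (bitLetter b) ∧ w[u.2]? = some (bitLetter b)) ∧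
    v.1 = u.1 + 1 ∧ v.2 = u.2 + 1

/-- Both positions of a pair are at the end of a name. -/
def NamesEnd (w : List Letter) (u : ℕ × ℕ) : Prop := ¬IsBit w[u.1]? ∧ ¬IsBit w[u.2]?

theorem nameAt_eq_of_reaches {E : List (ℕ × ℕ)} {u : ℕ × ℕ}
    (h : Reaches E (SameBit w) (NamesEnd w) u) : nameAt w u.1 = nameAt w u.2 := by
  induction h with
  | target u h => rw [nameAt_of_not_bit h.1, nameAt_of_not_bit h.2]
  | step u v _ huv _ ih =>
    obtain ⟨⟨b, bit, bit'⟩, eq, eq'⟩ := huv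
    rw [nameAt_of_bit bit, nameAt_of_bit bit', ← eq, ← eq', ih]

theorem reaches_of_nameAt_eq (h : nameAt w i = nameAt w j) :
    Reaches (Enum.enum w.length) (SameBit w) (NamesEnd w) (i, j) := by
  generalize hx : nameAt w j = x at h
  induction x generalizing i j with
  | nil => exact .target _ ⟨nameAt_eq_nil_iff.1 h, nameAt_eq_nil_iff.1 hx⟩
  | cons b x ih =>
    obtain ⟨bit, name⟩ := nameAt_eq_cons_iff.1 h
    obtain ⟨bit', name'⟩ := nameAt_eq_cons_iff.1 hx
    exact .step _ (i + 1, j + 1) (mem_enum_prod.2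
      ⟨mem_enum_nat.2 (lt_length_of_getElem?_eq_some bit),
        mem_enum_nat.2 (lt_length_of_getElem?_eq_some bit')⟩)
      ⟨⟨b, bit, bit'⟩, rfl, rfl⟩ (ih name' name)

end Positions

/-! ### Definability of basic relations -/

section Definability

variable {A C D : Type} [PosTuple C] [PosTuple D]

namespace IsProj

theorem last : IsProj fun x : C × D => x.2 := IsProj.id.snd

theorem lift {E : Type} [PosTuple E] {f : D → E} (hf : IsProj f) :
    IsProj fun x : D × C => f x.1 := by
  obtain ⟨k, hk, h⟩ := hf
  obtain ⟨m, hm, h'⟩ := (IsProj.id (C := D × C)).fst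
  refine ⟨m + k, by lia, fun x => ?_⟩
  refine (congrArg f (h' x)).trans ((h _).trans ?_)
  simp only [add_assoc]

end IsProj

open IsProj

variable {t u : C → ℕ}

namespace Definable

theorem congr_of_le {R Q : List A → C → Prop} (ht : IsProj t) (hu : IsProj u)
    (hR : Definable C R) (h : ∀ w c, t c ≤ w.length → u c ≤ w.length → (Q w c ↔ R w c)) :
    Definable C Q := by
  obtain ⟨i, -, hi⟩ := ht.exists_pointer
  obtain ⟨j, -, hj⟩ := hu.exists_pointer
  obtain ⟨p, hp⟩ := hR
  refine ⟨p, fun w s hs => ?_⟩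
  have iff : Q w (PosTuple.get s.pos) ↔ R w (PosTuple.get s.pos) :=
    h _ _ (hi s.pos ▸ hs i) (hj s.pos ▸ hs j)
  simpa only [iff] using hp w s hs

theorem succ_eq (ht : IsProj t) (hu : IsProj u) :
    Definable (A := A) C fun _ c => u c = t c + 1 := by
  refine congr_of_le ht hu ((Definable.lt ht hu).and (all (R := fun _ c x => x ≤ t c ∨ u c ≤ x)
    ((Definable.le last ht.lift).or (Definable.le hu.lift last)))) fun w c _ _ => ?_
  refine ⟨fun h => ⟨by lia, fun x _ => by lia⟩, fun ⟨_, between⟩ => ?_⟩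
  have := between (t c + 1) (by lia)
  lia

theorem eq_zero (ht : IsProj t) : Definable (A := A) C fun _ c => t c = 0 :=
  (all (R := fun _ c x => t c ≤ x) (Definable.le ht.lift last)).congr fun _ _ =>
    ⟨fun h x _ => h ▸ Nat.zero_le x, fun h => Nat.le_zero.1 (h 0 (Nat.zero_le _))⟩

theorem letter_eq (ht : IsProj t) (a : Option A) : Definable C fun w c => w[t c]? = a := by
  classical
  exact (Definable.read ht fun b => decide (b = a)).congr fun _ _ => decide_eq_true_iff.symm

theorem exists_bool {R : List A → C → Bool → Prop} (h : ∀ b, Definable C fun w c => R w c b) :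
    Definable C fun w c => ∃ b, R w c b :=
  ((h true).or (h false)).congr fun _ _ => Bool.exists_bool.trans or_comm

theorem forall_finite {T : Type} [Finite T] {R : List A → C → T → Prop}
    (h : ∀ x, Definable C fun w c => R w c x) : Definable C fun w c => ∀ x, R w c x := by
  classical
  have := Fintype.ofFinite T
  suffices ∀ s : Finset T, Definable C fun w c => ∀ x ∈ s, R w c x from
    (this .univ).congr fun _ _ => by simp only [Finset.mem_univ, true_imp_iff]
  intro s
  induction s using Finset.induction with
  | empty => exact (const True).congr fun _ _ => by simp
  | insert x s _ ih => exact ((h x).and ih).congr fun _ _ => Finset.forall_mem_insert _ _ _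

theorem pair_eq {t u : C → ℕ × ℕ} (ht : IsProj t) (hu : IsProj u) :
    Definable (A := A) C fun _ c => t c = u c :=
  ((Definable.eq ht.fst hu.fst).and (Definable.eq ht.snd hu.snd)).congr fun _ _ => Prod.ext_iff

theorem isBit (ht : IsProj t) : Definable C fun w c => IsBit w[t c]? :=
  exists_bool fun _ => letter_eq ht _

theorem isSign (ht : IsProj t) : Definable C fun w c => IsSign w[t c]? :=
  exists_bool fun _ => letter_eq ht _

theorem sameBit {t u : C → ℕ × ℕ} (ht : IsProj t) (hu : IsProj u) :
    Definable C fun w c => SameBit w (t c) (u c) :=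
  (exists_bool fun _ => (letter_eq ht.fst _).and (letter_eq ht.snd _)).and
    ((succ_eq ht.fst hu.fst).and (succ_eq ht.snd hu.snd))

theorem nameAt_eq (ht : IsProj t) (hu : IsProj u) :
    Definable C fun w c => nameAt w (t c) = nameAt w (u c) := by
  refine congr_of_le ht hu (exists_reaches (T := ℕ × ℕ) (S := fun w _ => SameBit w)
    (P := fun w _ => NamesEnd w) (Q := fun _ c x => x.1 = t c ∧ x.2 = u c)
    (pair_eq last last.lift) (sameBit last.lift.lift last.lift)
    ((isBit last.lift.lift.fst).not.and (isBit last.lift.lift.snd).not)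
    ((Definable.eq last.fst ht.lift).and (Definable.eq last.snd hu.lift))) fun w c ht hu => ?_
  refine ⟨fun h => ⟨(t c, u c), mem_enum_prod.2 ⟨mem_enum_nat.2 ht, mem_enum_nat.2 hu⟩,
    ⟨rfl, rfl⟩, reaches_of_nameAt_eq h⟩, ?_⟩
  rintro ⟨⟨_, _⟩, -, ⟨rfl, rfl⟩, h⟩
  exact nameAt_eq_of_reaches h

theorem name_succ {R : List Letter → C → Var → Prop} (ht : IsProj t)
    (hR : Definable (C × ℕ) fun w x => R w x.1 (nameAt w x.2)) :
    Definable C fun w c => R w c (nameAt w (t c + 1)) := by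
  -- After the end of the word, every position names the empty name.
  refine (ex (R := fun w c j => (j = t c + 1 ∨ w[t c]? = none ∧ w[j]? = none) ∧
    R w c (nameAt w j)) (((succ_eq ht.lift last).or
      ((letter_eq ht.lift _).and (letter_eq last _))).and hR)).congr fun w c => ?_
  simp only [List.getElem?_eq_none_iff]
  have nameAt_of_le {i : ℕ} (hi : w.length ≤ i) : nameAt w i = [] := by
    rw [nameAt, List.drop_of_length_le hi]; rfl
  rcases lt_or_ge (t c) w.length with lt | le
  · exact ⟨fun h => ⟨_, lt, .inl rfl, h⟩, fun ⟨j, _, eq, h⟩ => by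
      obtain rfl := eq.resolve_right fun h => h.1.not_gt lt
      exact h⟩
  · rw [nameAt_of_le (le.trans (Nat.le_succ _))]
    refine ⟨fun h => ⟨_, le_rfl, .inr ⟨le, le_rfl⟩, nameAt_of_le le_rfl ▸ h⟩, ?_⟩
    rintro ⟨j, _, eq, h⟩
    rwa [nameAt_of_le (by lia)] at h

theorem literal_eq (ht : IsProj t) (hu : IsProj u) (s s' : Bool) :
    Definable C fun w c => (⟨nameAt w (t c), s⟩ : Literal) = ⟨nameAt w (u c), s'⟩ :=
  ((nameAt_eq ht hu).and (const (s = s'))).congr fun _ _ => Literal.ext_iff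

theorem litIn (ht : IsProj t) (hu : IsProj u) : Definable C fun w c => LitIn w (t c) (u c) :=
  (Definable.lt ht hu).and
    (all (R := fun w c j => t c < j → j < u c → IsBit w[j]? ∨ IsSign w[j]?)
      ((Definable.lt ht.lift last).imp
        ((Definable.lt last hu.lift).imp ((isBit last).or (isSign last)))))

theorem exists_mem_clauseAt {P : List Letter → C → Literal → Prop} (ht : IsProj t)
    (hP : ∀ s, Definable (C × ℕ) fun w x => P w x.1 ⟨nameAt w x.2, s⟩) :
    Definable C fun w c => ∃ l ∈ clauseAt w (t c), P w c l := by
  refine (exists_bool fun s => ex (R := fun w c j => (∃ i ≤ w.length,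
    j = i + 1 ∧ LitIn w (t c) i ∧ w[i]? = some (signLetter s)) ∧ P w c ⟨nameAt w j, s⟩)
    ((ex (R := fun w (x : C × ℕ) i => x.2 = i + 1 ∧ LitIn w (t x.1) i ∧
      w[i]? = some (signLetter s)) ((succ_eq last last.lift).and
        ((litIn ht.lift.lift last).and (letter_eq last _)))).and (hP s))).congr fun w c => ?_
  simp only [mem_clauseAt_iff]
  constructor
  · rintro ⟨⟨x, s⟩, ⟨i, hi, literal, sign, rfl⟩, hP⟩
    exact ⟨s, i + 1, hi, ⟨i, hi.le, rfl, literal, sign⟩, hP⟩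
  · rintro ⟨s, _, -, ⟨i, -, rfl, literal, sign⟩, hP⟩
    exact ⟨_, ⟨i, lt_length_of_getElem?_eq_some sign, literal, sign, rfl⟩, hP⟩

theorem forall_mem_clauseAt {P : List Letter → C → Literal → Prop} (ht : IsProj t)
    (hP : ∀ s, Definable (C × ℕ) fun w x => P w x.1 ⟨nameAt w x.2, s⟩) :
    Definable C fun w c => ∀ l ∈ clauseAt w (t c), P w c l :=
  (exists_mem_clauseAt (P := fun w c l => ¬P w c l) ht fun s => (hP s).not).not.congr
    fun _ _ => by push Not; rfl

end Definable

end Definability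

/-! ### The assignment given by a block of the advice -/

/-- The letter of a bit of the advice. -/
def adviceLetter (b : Bool) : Letter := .inr (if b then 1 else 0)

/-- The letter read at a position, if any, is a bit of the advice. -/
def IsAdvice (a : Option Letter) : Prop := ∃ b, a = some (adviceLetter b)

/-- The items of a word that follow the occurrences of a marker, where `f` reads one item. -/
def listed {β : Type} (m : Letter) (f : List Letter → β) : List Letter → List β
  | [] => []
  | a :: t => if a = m then f t :: listed m f t else listed m f t

/-- The names listed in a word. -/
def namesOf (t : List Letter) : List Var := listed (.inl .name) nameOf t

/-- The bits of the advice at the beginning of a word. The advice is a sequence of blocks of bits,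
each of which is preceded by the marker `2`. -/
def adviceOf : List Letter → List Bool
  | .inr i :: t => if i = 2 then [] else decide (i = 1) :: adviceOf t
  | _ => []

/-- The literal is true under the assignment that gives the values `β` to the listed variables `B`,
where only the last occurrence of a variable counts. -/
def ListsTrue (B : List Var) (β : List Bool) (l : Literal) : Prop :=
  (l.var, l.positive) ∈ B.dedup.zip β

/-- The literal is true under the assignment to the listed names given by the block of the advice
with marker at `p`. -/
def TrueAt (w : List Letter) (p : ℕ) : Literal → Prop :=
  ListsTrue (namesOf w) (adviceOf (w.drop (p + 1)))

/-- A name that is not listed again later. -/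
def LastName (w : List Letter) (b : ℕ) : Prop :=
  w[b]? = some (.inl .name) ∧ nameAt w (b + 1) ∉ namesOf (w.drop (b + 1))

/-- One step of a parallel walk through the listed names and a block of the advice. -/
def WalkStep (w : List Letter) (u v : ℕ × ℕ) : Prop :=
  v.1 = u.1 + 1 ∧ ((LastName w u.1 ∧ IsAdvice w[u.2]? ∧ v.2 = u.2 + 1) ∨
    (¬LastName w u.1 ∧ v.2 = u.2))

theorem adviceLetter_injective : Function.Injective adviceLetter := by
  unfold Function.Injective
  decide

section Listed

variable {β : Type} {m : Letter} {f : List Letter → β}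

theorem mem_listed_iff {t : List Letter} {x : β} :
    x ∈ listed m f t ↔ ∃ i : ℕ, t[i]? = some m ∧ f (t.drop (i + 1)) = x := by
  induction t with
  | nil => simp [listed]
  | cons a t ih =>
    rw [← Nat.or_exists_add_one]
    simp only [List.getElem?_cons_zero, List.getElem?_cons_succ, List.drop_succ_cons,
      List.drop_zero, Option.some_inj, ← ih, listed]
    split_ifs with h <;> simp [h, eq_comm]

end Listed

theorem namesOf_cons (a : Letter) (t : List Letter) : namesOf (a :: t) =
    if a = .inl .name then nameOf t :: namesOf t else namesOf t := rfl

theorem adviceOf_cons_adviceLetter (b : Bool) (t : List Letter) :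
    adviceOf (adviceLetter b :: t) = b :: adviceOf t := by
  cases b <;> rfl

theorem adviceOf_eq_nil {t : List Letter} (h : ¬IsAdvice t.head?) : adviceOf t = [] := by
  match t with
  | [] => rfl
  | .inl _ :: _ => rfl
  | .inr 0 :: t => exact (h ⟨false, rfl⟩).elim
  | .inr 1 :: t => exact (h ⟨true, rfl⟩).elim
  | .inr 2 :: t => rfl

section Walk

variable {w : List Letter} {b q : ℕ}

theorem LastName.lt_length (h : LastName w b) : b < w.length :=
  lt_length_of_getElem?_eq_some h.1

theorem LastName.dedup_namesOf (h : LastName w b) : (namesOf (w.drop b)).dedup =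
    nameAt w (b + 1) :: (namesOf (w.drop (b + 1))).dedup := by
  obtain ⟨hb, eq⟩ := List.getElem?_eq_some_iff.1 h.1
  rw [List.drop_eq_getElem_cons hb, namesOf_cons, if_pos eq]
  exact List.dedup_cons_of_notMem h.2

theorem dedup_namesOf_of_not_lastName (h : ¬LastName w b) :
    (namesOf (w.drop b)).dedup = (namesOf (w.drop (b + 1))).dedup := by
  by_cases hb : b < w.length
  · rw [List.drop_eq_getElem_cons hb, namesOf_cons]
    split_ifs with eq
    · refine List.dedup_cons_of_mem (by_contra fun notMem => h ⟨?_, notMem⟩)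
      rw [List.getElem?_eq_getElem hb, eq]
    · rfl
  · rw [List.drop_of_length_le (by lia), List.drop_of_length_le (by lia)]

theorem adviceOf_of_advice {a : Bool} (h : w[q]? = some (adviceLetter a)) :
    adviceOf (w.drop q) = a :: adviceOf (w.drop (q + 1)) := by
  obtain ⟨hq, eq⟩ := List.getElem?_eq_some_iff.1 h
  rw [List.drop_eq_getElem_cons hq, eq, adviceOf_cons_adviceLetter]

theorem adviceOf_of_not_advice (h : ¬IsAdvice w[q]?) : adviceOf (w.drop q) = [] :=
  adviceOf_eq_nil (by rwa [List.head?_drop])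

theorem adviceOf_drop_eq_nil_iff : adviceOf (w.drop q) = [] ↔ ¬IsAdvice w[q]? :=
  ⟨fun h ⟨_, ha⟩ => List.cons_ne_nil _ _ ((adviceOf_of_advice ha).symm.trans h),
    adviceOf_of_not_advice⟩

section Reaches

variable {P : ℕ × ℕ → Prop}

theorem Reaches.cases_iff {T : Type} {E : List T} {S : T → T → Prop} {P : T → Prop} {u : T} :
    Reaches E S P u ↔ P u ∨ ∃ v ∈ E, S u v ∧ Reaches E S P v := by
  constructor
  · rintro (⟨_, h⟩ | ⟨_, v, hv, huv, h⟩)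
    · exact .inl h
    · exact .inr ⟨v, hv, huv, h⟩
  · rintro (h | ⟨v, hv, huv, h⟩)
    · exact .target _ h
    · exact .step _ v hv huv h

theorem reaches_walk_length_iff :
    Reaches (Enum.enum w.length) (WalkStep w) P (w.length, q) ↔ P (w.length, q) := by
  rw [Reaches.cases_iff, or_iff_left]
  rintro ⟨v, hv, ⟨eq, -⟩, -⟩
  have := mem_enum_nat.1 (mem_enum_prod.1 hv).1
  lia

theorem LastName.reaches_walk_iff_of_not_isAdvice (hb : LastName w b) (hq : ¬IsAdvice w[q]?) :
    Reaches (Enum.enum w.length) (WalkStep w) P (b, q) ↔ P (b, q) := by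
  rw [Reaches.cases_iff, or_iff_left]
  rintro ⟨v, -, ⟨-, ⟨-, advice, -⟩ | ⟨not_last, -⟩⟩, -⟩
  · exact hq advice
  · exact not_last hb

theorem LastName.reaches_walk_iff_of_isAdvice (hb : LastName w b) (hq : IsAdvice w[q]?) :
    Reaches (Enum.enum w.length) (WalkStep w) P (b, q) ↔
      P (b, q) ∨ Reaches (Enum.enum w.length) (WalkStep w) P (b + 1, q + 1) := by
  rw [Reaches.cases_iff]
  refine or_congr_right ⟨?_, fun h => ?_⟩
  · rintro ⟨⟨_, _⟩, -, ⟨rfl, ⟨-, -, rfl⟩ | ⟨not_last, -⟩⟩, h⟩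
    · exact h
    · exact (not_last hb).elim
  · obtain ⟨_, bit⟩ := id hq
    exact ⟨(b + 1, q + 1), mem_enum_prod.2 ⟨mem_enum_nat.2 hb.lt_length,
      mem_enum_nat.2 (lt_length_of_getElem?_eq_some bit)⟩, ⟨rfl, .inl ⟨hb, hq, rfl⟩⟩, h⟩

theorem reaches_walk_iff_of_not_lastName (hb : ¬LastName w b) (hb' : b < w.length)
    (hq : q ≤ w.length) : Reaches (Enum.enum w.length) (WalkStep w) P (b, q) ↔
      P (b, q) ∨ Reaches (Enum.enum w.length) (WalkStep w) P (b + 1, q) := by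
  rw [Reaches.cases_iff]
  refine or_congr_right ⟨?_, fun h => ?_⟩
  · rintro ⟨⟨_, q'⟩, -, ⟨rfl, ⟨last, -⟩ | ⟨-, eq⟩⟩, h⟩
    · exact (hb last).elim
    · obtain rfl : q' = q := eq
      exact h
  · exact ⟨(b + 1, q), mem_enum_prod.2 ⟨mem_enum_nat.2 hb', mem_enum_nat.2 hq⟩,
      ⟨rfl, .inr ⟨hb, rfl⟩⟩, h⟩

theorem reaches_walk_iff {Q : List Var → List Bool → Prop}
    (final : ∀ q, P (w.length, q) ↔ Q [] (adviceOf (w.drop q)))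
    (skip : ∀ b < w.length, ∀ q, ¬LastName w b → ¬P (b, q))
    (exhausted : ∀ b q, LastName w b → ¬IsAdvice w[q]? →
      (P (b, q) ↔ Q (nameAt w (b + 1) :: (namesOf (w.drop (b + 1))).dedup) []))
    (step : ∀ b q a, LastName w b → w[q]? = some (adviceLetter a) →
      ((P (b, q) ∨ Q (namesOf (w.drop (b + 1))).dedup (adviceOf (w.drop (q + 1)))) ↔
        Q (nameAt w (b + 1) :: (namesOf (w.drop (b + 1))).dedup)
          (a :: adviceOf (w.drop (q + 1)))))
    (hb : b ≤ w.length) (hq : q ≤ w.length) :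
    Reaches (Enum.enum w.length) (WalkStep w) P (b, q) ↔
      Q (namesOf (w.drop b)).dedup (adviceOf (w.drop q)) := by
  induction hb using Nat.decreasingInduction generalizing q with
  | self => rw [reaches_walk_length_iff, List.drop_length, final]; rfl
  | of_succ b hb ih =>
    by_cases last : LastName w b
    · rw [last.dedup_namesOf]
      by_cases advice : IsAdvice w[q]?
      · obtain ⟨a, bit⟩ := id advice
        rw [last.reaches_walk_iff_of_isAdvice advice, ih (lt_length_of_getElem?_eq_some bit),
          adviceOf_of_advice bit, step b q a last bit]
      · rw [last.reaches_walk_iff_of_not_isAdvice advice, adviceOf_of_not_advice advice,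
          exhausted b q last advice]
    · rw [reaches_walk_iff_of_not_lastName last hb hq, dedup_namesOf_of_not_lastName last,
        or_iff_right (skip b hb q last), ih hq]

end Reaches

theorem reaches_walk_mem_zip_iff {l : Literal} (hb : b ≤ w.length) (hq : q ≤ w.length) :
    Reaches (Enum.enum w.length) (WalkStep w) (fun u => LastName w u.1 ∧
      nameAt w (u.1 + 1) = l.var ∧ w[u.2]? = some (adviceLetter l.positive)) (b, q) ↔
      (l.var, l.positive) ∈ (namesOf (w.drop b)).dedup.zip (adviceOf (w.drop q)) := by
  refine reaches_walk_iff (Q := fun B β => (l.var, l.positive) ∈ B.zip β) (fun q => ?_)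
    (fun b _ q not_last h => not_last h.1) (fun b q _ not_advice => ?_)
    (fun b q a last bit => ?_) hb hq
  · exact iff_of_false (fun h => h.1.lt_length.false) List.not_mem_nil
  · rw [List.zip_nil_right]
    exact iff_of_false (fun h => not_advice ⟨_, h.2.2⟩) List.not_mem_nil
  · rw [List.zip_cons_cons, List.mem_cons, Prod.mk.injEq, bit, Option.some_inj,
      adviceLetter_injective.eq_iff]
    simp only [last, true_and, eq_comm]

theorem reaches_walk_length_eq_iff (hb : b ≤ w.length) (hq : q ≤ w.length) :
    Reaches (Enum.enum w.length) (WalkStep w) (fun u => w[u.1]? = none ∧ ¬IsAdvice w[u.2]?)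
      (b, q) ↔ (namesOf (w.drop b)).dedup.length = (adviceOf (w.drop q)).length := by
  have ne_none {b : ℕ} (h : b < w.length) : w[b]? ≠ none := by
    rwa [Ne, List.getElem?_eq_none_iff, not_le]
  refine reaches_walk_iff (Q := fun B β => B.length = β.length) (fun q => ?_)
    (fun b hb q _ h => ne_none hb h.1) (fun b q last _ => ?_) (fun b q a last _ => ?_) hb hq
  · rw [List.length_nil, eq_comm (a := 0), List.length_eq_zero_iff, adviceOf_drop_eq_nil_iff]
    exact and_iff_right (List.getElem?_length w)
  · exact iff_of_false (fun h => ne_none last.lt_length h.1) (Nat.succ_ne_zero _)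
  · rw [or_iff_right fun h => ne_none last.lt_length h.1, List.length_cons, List.length_cons,
      Nat.add_right_cancel_iff]

end Walk

theorem mem_namesOf_drop_iff {w : List Letter} {b : ℕ} {x : Var} : x ∈ namesOf (w.drop b) ↔
    ∃ b' ≤ w.length, b ≤ b' ∧ w[b']? = some (.inl .name) ∧ nameAt w (b' + 1) = x := by
  rw [namesOf, mem_listed_iff]
  simp only [List.getElem?_drop, List.drop_drop]
  constructor
  · rintro ⟨i, marker, name⟩
    exact ⟨b + i, (lt_length_of_getElem?_eq_some marker).le, Nat.le_add_right _ _, marker, name⟩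
  · rintro ⟨b', -, hb, marker, name⟩
    obtain ⟨i, rfl⟩ := Nat.exists_eq_add_of_le hb
    exact ⟨i, marker, name⟩

section Definability

open IsProj

variable {C : Type} [PosTuple C] {t u : C → ℕ}

namespace Definable

theorem lastName (ht : IsProj t) : Definable C fun w c => LastName w (t c) :=
  (name_succ (R := fun w c x => w[t c]? = some (.inl .name) ∧ ¬∃ b ≤ w.length, t c < b ∧
    w[b]? = some (.inl .name) ∧ nameAt w (b + 1) = x) ht
    ((letter_eq ht.lift _).and (ex (R := fun w (x : C × ℕ) b => t x.1 < b ∧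
      w[b]? = some (.inl .name) ∧ nameAt w (b + 1) = nameAt w x.2)
      ((Definable.lt ht.lift.lift last).and ((letter_eq last _).and
        (name_succ (R := fun w (x : (C × ℕ) × ℕ) y => y = nameAt w x.1.2) last
          (nameAt_eq last last.lift.lift))))).not)).congr
    fun _ _ => by rw [LastName, mem_namesOf_drop_iff]; rfl

theorem isAdvice (ht : IsProj t) : Definable C fun w c => IsAdvice w[t c]? :=
  exists_bool fun _ => letter_eq ht _

theorem walkStep {t u : C → ℕ × ℕ} (ht : IsProj t) (hu : IsProj u) :
    Definable C fun w c => WalkStep w (t c) (u c) :=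
  (succ_eq ht.fst hu.fst).and
    (((lastName ht.fst).and ((isAdvice ht.snd).and (succ_eq ht.snd hu.snd))).or
      ((lastName ht.fst).not.and (Definable.eq hu.snd ht.snd)))

theorem reaches_walk {P : List Letter → C → ℕ × ℕ → Prop} (ht : IsProj t)
    (hP : Definable ((((C × (ℕ × ℕ)) × (ℕ × ℕ)) × (ℕ × ℕ)) × (ℕ × ℕ)) fun w x =>
      P w x.1.1.1.1 x.1.1.2) :
    Definable C fun w c => t c < w.length ∧
      Reaches (Enum.enum w.length) (WalkStep w) (P w c) (0, t c + 1) := by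
  refine (exists_reaches (T := ℕ × ℕ) (S := fun w _ => WalkStep w) (P := P)
    (Q := fun _ c x => x.1 = 0 ∧ x.2 = t c + 1) (pair_eq last last.lift)
    (walkStep last.lift.lift last.lift) hP
    ((eq_zero last.fst).and (succ_eq ht.lift last.snd))).congr fun w c => ⟨?_, ?_⟩
  · rintro ⟨lt, h⟩
    exact ⟨(0, t c + 1), mem_enum_prod.2 ⟨mem_enum_nat.2 (Nat.zero_le _), mem_enum_nat.2 lt⟩,
      ⟨rfl, rfl⟩, h⟩
  · rintro ⟨⟨_, _⟩, le, ⟨rfl, rfl⟩, h⟩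
    exact ⟨mem_enum_nat.1 (mem_enum_prod.1 le).2, h⟩

theorem trueAt (ht : IsProj t) (hu : IsProj u) (s : Bool) :
    Definable C fun w c => TrueAt w (t c) ⟨nameAt w (u c), s⟩ := by
  refine (reaches_walk (P := fun w c x => LastName w x.1 ∧
    nameAt w (x.1 + 1) = nameAt w (u c) ∧ w[x.2]? = some (adviceLetter s)) ht
    ((lastName last.lift.lift.fst).and ((name_succ
      (R := fun w (x : (((C × (ℕ × ℕ)) × (ℕ × ℕ)) × (ℕ × ℕ)) × (ℕ × ℕ)) y =>
        y = nameAt w (u x.1.1.1.1)) last.lift.lift.fst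
      (nameAt_eq last hu.lift.lift.lift.lift.lift)).and
        (letter_eq last.lift.lift.snd _)))).congr fun w c => ?_
  by_cases h : t c < w.length
  · have := reaches_walk_mem_zip_iff (w := w) (l := ⟨nameAt w (u c), s⟩) (Nat.zero_le _)
      (Nat.succ_le_of_lt h)
    rw [and_iff_right h, this, List.drop_zero, TrueAt, ListsTrue]
  · refine iff_of_false ?_ fun h' => h h'.1
    rw [TrueAt, ListsTrue, List.drop_of_length_le (by lia), adviceOf_eq_nil (t := []) nofun,
      List.zip_nil_right]
    exact List.not_mem_nil

theorem length_block_eq (ht : IsProj t) : Definable C fun w c => t c < w.length ∧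
    (namesOf w).dedup.length = (adviceOf (w.drop (t c + 1))).length :=
  (reaches_walk (P := fun w _ x => w[x.1]? = none ∧ ¬IsAdvice w[x.2]?) ht
    ((letter_eq last.lift.lift.fst _).and (isAdvice last.lift.lift.snd).not)).congr fun w c =>
      and_congr_right fun h => by
        rw [reaches_walk_length_eq_iff (Nat.zero_le _) h, List.drop_zero]

end Definable

end Definability

/-! ### Acceptance is definable -/

/-- The position is before the marker of the conclusion. -/
def BeforeGoal (w : List Letter) (c : ℕ) : Prop := ∀ j < c, w[j]? ≠ some (.inl .goal)

/-- The position holds the marker of a clause of a premise. -/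
def IsPremise (w : List Letter) (c : ℕ) : Prop :=
  w[c]? = some (.inl .clause) ∧ BeforeGoal w c

/-- The position holds the marker of a clause of the conclusion. -/
def IsConclusion (w : List Letter) (c : ℕ) : Prop :=
  w[c]? = some (.inl .clause) ∧ ¬BeforeGoal w c

/-- The clauses of the premises. -/
def premises (w : List Letter) : Set Clause := {C | ∃ c, IsPremise w c ∧ clauseAt w c = C}

/-- The literal coded by a pair of positions: the first one points to its name, and the second one
is `0` if the literal is positive. -/
def litOf (w : List Letter) (u : ℕ × ℕ) : Literal := ⟨nameAt w u.1, decide (u.2 = 0)⟩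

/-- `z` codes the complement of a literal that has to be refuted before `u` follows from the clause
at `v`. -/
def Needs (w : List Letter) (base : Literal → Prop) (u v z : ℕ × ℕ) : Prop :=
  ¬base (litOf w u) ∧ (IsPremise w v.1 ∧ litOf w u ∈ clauseAt w v.1 →
    ∃ l ∈ clauseAt w v.1, l ≠ litOf w u ∧ litOf w z = l.compl)

/-- For every assignment listed in the advice, all clauses of the word satisfy `K`, and unit
propagation refutes the negation of every clause of the conclusion once both values of some further
variable are tried. -/
def Accepts (K : (Literal → Prop) → Clause → Prop) (w : List Letter) : Prop :=
  ∀ p, w[p]? = some (.inr 2) →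
    (namesOf w).dedup.length = (adviceOf (w.drop (p + 1))).length ∧
    (∀ c, w[c]? = some (.inl .clause) → K (TrueAt w p) (clauseAt w c)) ∧
    ∀ d, IsConclusion w d → ∃ a ≤ w.length, ∀ s, Conflict (premises w)
      (refutationBase (TrueAt w p) (clauseAt w d) ⟨nameAt w a, s⟩)

section Semantics

variable {w : List Letter} {base : Literal → Prop} {l : Literal}

theorem exists_litOf_eq (hw : 0 < w.length) {i : ℕ} (hi : i ≤ w.length)
    (h : nameAt w i = l.var) : ∃ u ∈ Enum.enum (T := ℕ × ℕ) w.length, litOf w u = l := by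
  refine ⟨(i, if l.positive then 0 else 1), mem_enum_prod.2 ⟨mem_enum_nat.2 hi, mem_enum_nat.2 ?_⟩,
    Literal.ext h ?_⟩
  · dsimp only
    split <;> lia
  · cases h' : l.positive <;> simp [litOf]

theorem exists_nameAt_of_mem_clauseAt {c : ℕ} (h : l ∈ clauseAt w c) :
    ∃ i ≤ w.length, nameAt w i = l.var := by
  obtain ⟨i, hi, -, -, name⟩ := mem_clauseAt_iff.1 h
  exact ⟨i + 1, hi, name⟩

theorem unitDerivable_of_derivable (hw : 0 < w.length) {u : ℕ × ℕ}
    (hu : u ∈ Enum.enum w.length) (h : Derivable (Enum.enum w.length) (Needs w base) u) :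
    UnitDerivable (premises w) base (litOf w u) := by
  induction h with
  | intro u v _ _ ih =>
    by_cases hb : base (litOf w u)
    · exact .base _ hb
    by_cases hC : IsPremise w v.1 ∧ litOf w u ∈ clauseAt w v.1
    · refine .unit _ _ ⟨_, hC.1, rfl⟩ hC.2 fun l hl hne => ?_
      obtain ⟨i, hi, name⟩ := exists_nameAt_of_mem_clauseAt hl
      obtain ⟨z, hz, eq⟩ := exists_litOf_eq (l := l.compl) hw hi name
      rw [← eq]
      exact ih z hz ⟨hb, fun _ => ⟨l, hl, hne, eq⟩⟩ hz
    · exact ih u hu ⟨hb, fun h => (hC h).elim⟩ hu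

theorem derivable_of_unitDerivable {u : ℕ × ℕ} (hu : u ∈ Enum.enum w.length)
    (h : UnitDerivable (premises w) base (litOf w u)) :
    Derivable (Enum.enum w.length) (Needs w base) u := by
  generalize hl : litOf w u = l at h
  induction h generalizing u with
  | base l hb => exact .intro u u hu fun z _ hz => (hz.1 (hl ▸ hb)).elim
  | unit C l hC hlC _ ih =>
    obtain ⟨c, hc, rfl⟩ := hC
    refine .intro u (c, 0) (mem_enum_prod.2 ⟨mem_enum_nat.2 (lt_length_of_getElem?_eq_some hc.1).le,
      mem_enum_nat.2 (Nat.zero_le _)⟩) fun z hz ⟨_, needs⟩ => ?_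
    obtain ⟨l', hl', hne, eq⟩ := needs ⟨hc, hl ▸ hlC⟩
    exact ih l' hl' (hl ▸ hne) hz eq

theorem unitDerivable_iff_of_length_eq_zero (hw : w.length = 0) :
    UnitDerivable (premises w) base l ↔ base l := by
  refine ⟨?_, .base l⟩
  rintro (⟨_, hb⟩ | ⟨_, _, ⟨c, hc, -⟩, -⟩)
  · exact hb
  · exact absurd (lt_length_of_getElem?_eq_some hc.1) (by lia)

theorem conflict_iff (hb : ∀ l, base l → ∃ i ≤ w.length, nameAt w i = l.var) :
    Conflict (premises w) base ↔ (∃ i ≤ w.length, UnitDerivable (premises w) base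
      ⟨nameAt w i, true⟩ ∧ UnitDerivable (premises w) base ⟨nameAt w i, false⟩) ∨
      ∃ c ≤ w.length, IsPremise w c ∧ clauseAt w c = ∅ := by
  refine or_congr ⟨?_, fun ⟨i, _, h⟩ => ⟨_, h⟩⟩ (exists_congr fun c =>
    ⟨fun h => ⟨(lt_length_of_getElem?_eq_some h.1.1).le, h⟩, fun h => h.2⟩)
  rintro ⟨⟨x, s⟩, derivable, derivable'⟩
  obtain ⟨i, hi, rfl⟩ : ∃ i ≤ w.length, nameAt w i = x := by
    rcases id derivable with ⟨_, h⟩ | ⟨C, _, ⟨c, -, rfl⟩, h, -⟩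
    · exact hb _ h
    · exact exists_nameAt_of_mem_clauseAt h
  cases s
  · exact ⟨i, hi, derivable', derivable⟩
  · exact ⟨i, hi, derivable, derivable'⟩

theorem exists_nameAt_of_mem_namesOf {x : Var} (h : x ∈ namesOf w) :
    ∃ i ≤ w.length, nameAt w i = x := by
  obtain ⟨i, -, -, marker, name⟩ := mem_namesOf_drop_iff (b := 0).1 h
  exact ⟨i + 1, lt_length_of_getElem?_eq_some marker, name⟩

theorem exists_nameAt_of_refutationBase {p d a : ℕ} {s : Bool} (ha : a ≤ w.length)
    (h : refutationBase (TrueAt w p) (clauseAt w d) ⟨nameAt w a, s⟩ l) :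
    ∃ i ≤ w.length, nameAt w i = l.var := by
  rcases h with true_at | mem | rfl
  · exact exists_nameAt_of_mem_namesOf (List.mem_dedup.1 (List.of_mem_zip true_at).1)
  · exact exists_nameAt_of_mem_clauseAt (l := l.compl) mem
  · exact ⟨a, ha, rfl⟩

end Semantics

/-- Relations between words, tuples and literals that are definable whenever the literal is given
by its sign and the position of its name. -/
def DefinableLiteral (C : Type) [PosTuple C] (P : List Letter → C → Literal → Prop) : Prop :=
  ∀ {D : Type} [PosTuple D] {t : D → C} {u : D → ℕ}, IsProj t → IsProj u → ∀ s,
    Definable D fun w x => P w (t x) ⟨nameAt w (u x), s⟩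

/-- Conditions on a clause under an assignment that are definable whenever the clause and the block
of the assignment are given by the positions of their markers. -/
def DefinableClause (K : (Literal → Prop) → Clause → Prop) : Prop :=
  ∀ {D : Type} [PosTuple D] {p c : D → ℕ}, IsProj p → IsProj c →
    Definable D fun w x => K (TrueAt w (p x)) (clauseAt w (c x))

section Definability

open IsProj

variable {C D : Type} [PosTuple C] [PosTuple D] {t u : C → ℕ}

namespace Definable

theorem length_pos {A : Type} : Definable (A := A) C fun w _ => 0 < w.length :=
  (ex (R := fun w _ i => ¬w[i]? = none) (letter_eq last _).not).congr fun w _ => by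
    simp only [List.getElem?_eq_none_iff, not_le]
    exact ⟨fun h => ⟨0, Nat.zero_le _, h⟩, fun ⟨i, _, h⟩ => by lia⟩

theorem forall_letter_eq {A : Type} {R : List A → C → ℕ → Prop} (a : A)
    (hR : Definable (C × ℕ) fun w x => R w x.1 x.2) :
    Definable C fun w c => ∀ i, w[i]? = some a → R w c i :=
  (all (R := fun w c i => w[i]? = some a → R w c i) ((letter_eq last _).imp hR)).congr
    fun _ _ => ⟨fun h i _ => h i, fun h i eq => h i (lt_length_of_getElem?_eq_some eq).le eq⟩

theorem beforeGoal (ht : IsProj t) : Definable C fun w c => BeforeGoal w (t c) :=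
  (forall_letter_eq (R := fun _ c j => ¬j < t c) (.inl .goal)
    (Definable.lt last ht.lift).not).congr fun _ _ =>
      forall_congr' fun _ => ⟨fun h eq lt => h lt eq, fun h lt eq => h eq lt⟩

theorem isPremise (ht : IsProj t) : Definable C fun w c => IsPremise w (t c) :=
  (letter_eq ht _).and (beforeGoal ht)

theorem litOf {R : List Letter → C → Literal → Prop} {u : C → ℕ × ℕ} (hu : IsProj u)
    (h : ∀ s, Definable C fun w c => R w c ⟨nameAt w (u c).1, s⟩) :
    Definable C fun w c => R w c (litOf w (u c)) :=
  (((eq_zero hu.snd).and (h true)).or ((eq_zero hu.snd).not.and (h false))).congr fun w c => by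
    by_cases eq : (u c).2 = 0 <;> simp [BackdoorImp.litOf, eq]

theorem mem_clauseAt (ht : IsProj t) (hu : IsProj u) (s : Bool) :
    Definable C fun w c => (⟨nameAt w (u c), s⟩ : Literal) ∈ clauseAt w (t c) :=
  (exists_mem_clauseAt (P := fun w c l => l = ⟨nameAt w (u c), s⟩) ht fun s' =>
    literal_eq last hu.lift s' s).congr fun _ _ => exists_eq_right.symm

theorem clauseAt_eq_empty (ht : IsProj t) : Definable C fun w c => clauseAt w (t c) = ∅ :=
  (forall_mem_clauseAt (P := fun _ _ _ => False) ht fun _ => const _).congr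
    fun _ _ => Finset.eq_empty_iff_forall_notMem

section Propagation

variable {base : List Letter → C → Literal → Prop} {f : D → C}

theorem needs (hb : DefinableLiteral C base) {u v z : D → ℕ × ℕ} (hf : IsProj f) (hu : IsProj u)
    (hv : IsProj v) (hz : IsProj z) :
    Definable D fun w x => Needs w (base w (f x)) (u x) (v x) (z x) := by
  refine (litOf (R := fun w x l => base w (f x) l) hu fun s => hb hf hu.fst s).not.and
    (((isPremise hv.fst).and (litOf (R := fun w x l => l ∈ clauseAt w (v x).1) hu
      fun s => mem_clauseAt hv.fst hu.fst s)).imp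
    (exists_mem_clauseAt (P := fun w x l => l ≠ BackdoorImp.litOf w (u x) ∧
      BackdoorImp.litOf w (z x) = l.compl) hv.fst fun s => ?_))
  exact (litOf (R := fun w (x : D × ℕ) l => (⟨nameAt w x.2, s⟩ : Literal) = l) hu.lift
      fun s' => literal_eq last hu.lift.fst s s').not.and
    (litOf (R := fun w (x : D × ℕ) l => l = ⟨nameAt w x.2, !s⟩) hz.lift
      fun s' => literal_eq hz.lift.fst last s' (!s))

theorem unitDerivable (hb : DefinableLiteral C base) (hf : IsProj f) {t : D → ℕ} (ht : IsProj t)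
    (s : Bool) : Definable D fun w x =>
      UnitDerivable (premises w) (base w (f x)) ⟨nameAt w (t x), s⟩ := by
  -- Signs are coded by positions, hence two positions are needed to run the propagation.
  refine congr_of_le ht ht ((length_pos.and (exists_derivable (T := ℕ × ℕ)
    (G := fun w x => Needs w (base w (f x)))
    (Q := fun _ x u => u.1 = t x ∧ (decide (u.2 = 0) = s))
    (needs hb hf.lift.lift.lift.lift last.lift.lift last.lift last)
    ((Definable.eq last.fst ht.lift).and (((eq_zero last.snd).iff (const (s = true))).congr
      fun _ _ => by rw [Bool.eq_iff_iff, decide_eq_true_iff])))).or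
    (length_pos.not.and (hb hf ht s))) fun w x hx _ => ?_
  rcases w.length.eq_zero_or_pos with hw | hw
  · simp only [hw, lt_irrefl, false_and, false_or, not_false_eq_true, true_and,
      unitDerivable_iff_of_length_eq_zero hw]
  simp only [hw, true_and, not_true_eq_false, false_and, or_false]
  constructor
  · intro h
    refine ⟨(t x, if s then 0 else 1), ?mem, ⟨rfl, ?sign⟩, derivable_of_unitDerivable ?mem ?_⟩
    · refine mem_enum_prod.2 ⟨mem_enum_nat.2 hx, mem_enum_nat.2 ?_⟩
      dsimp only
      split <;> lia
    · cases s <;> rfl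
    · cases s <;> exact h
  · rintro ⟨⟨_, _⟩, mem, ⟨rfl, rfl⟩, h⟩
    exact unitDerivable_of_derivable hw mem h

theorem conflict (hb : DefinableLiteral C base)
    (hname : ∀ w c, t c ≤ w.length → ∀ l, base w c l → ∃ i ≤ w.length, nameAt w i = l.var)
    (ht : IsProj t) : Definable C fun w c => Conflict (premises w) (base w c) :=
  congr_of_le ht ht ((ex (R := fun w c i => UnitDerivable (premises w) (base w c)
      ⟨nameAt w i, true⟩ ∧ UnitDerivable (premises w) (base w c) ⟨nameAt w i, false⟩)
      ((unitDerivable hb IsProj.id.fst last true).and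
        (unitDerivable hb IsProj.id.fst last false))).or
    (ex (R := fun w _ c => IsPremise w c ∧ clauseAt w c = ∅)
      ((isPremise last).and (clauseAt_eq_empty last)))) fun w c hc _ => conflict_iff (hname w c hc)

end Propagation

theorem accepts {K : (Literal → Prop) → Clause → Prop} (hK : DefinableClause K) :
    Definable C fun w _ => Accepts K w := by
  have refuted : Definable (((C × ℕ) × ℕ) × ℕ) fun w x => ∀ s, Conflict (premises w)
      (refutationBase (TrueAt w x.1.1.2) (clauseAt w x.1.2) ⟨nameAt w x.2, s⟩) :=
    forall_finite fun s => conflict (t := fun x => x.2)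
      (fun ht hu s' => (trueAt ht.fst.fst.snd hu s').or
        ((mem_clauseAt ht.fst.snd hu (!s')).or (literal_eq hu ht.snd s' s)))
      (fun _ _ hx _ => exists_nameAt_of_refutationBase hx) last
  refine (forall_letter_eq (R := fun w _ p => (p < w.length ∧
      (namesOf w).dedup.length = (adviceOf (w.drop (p + 1))).length) ∧
    (∀ c, w[c]? = some (.inl .clause) → K (TrueAt w p) (clauseAt w c)) ∧
    ∀ d, w[d]? = some (.inl .clause) → ¬BeforeGoal w d → ∃ a ≤ w.length, ∀ s,
      Conflict (premises w) (refutationBase (TrueAt w p) (clauseAt w d) ⟨nameAt w a, s⟩))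
    (.inr 2) ((length_block_eq last).and (Definable.and
      (forall_letter_eq (R := fun w (x : C × ℕ) c => K (TrueAt w x.2) (clauseAt w c)) _
        (hK last.lift last))
      (forall_letter_eq (R := fun w (x : C × ℕ) d => ¬BeforeGoal w d → ∃ a ≤ w.length, ∀ s,
          Conflict (premises w) (refutationBase (TrueAt w x.2) (clauseAt w d) ⟨nameAt w a, s⟩)) _
        ((beforeGoal last).not.imp (ex (R := fun w (x : (C × ℕ) × ℕ) a => ∀ s,
          Conflict (premises w)
            (refutationBase (TrueAt w x.1.2) (clauseAt w x.2) ⟨nameAt w a, s⟩))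
          refuted)))))).congr fun w _ => forall₂_congr fun p hp => ?_
  simp only [IsConclusion, and_imp, lt_length_of_getElem?_eq_some hp, true_and]

end Definable

section Classes

theorem exists_trueAt_definable {p c : D → ℕ} (hp : IsProj p) (hc : IsProj c) :
    Definable D fun w x => ∃ l ∈ clauseAt w (c x), TrueAt w (p x) l :=
  .exists_mem_clauseAt (P := fun w x l => TrueAt w (p x) l) hc fun s =>
    .trueAt hp.lift last s

theorem definableClause_horn : DefinableClause HornClause := fun {D} _ {p c} hp hc =>
  (exists_trueAt_definable hp hc).or (.forall_mem_clauseAt (P := fun w x l =>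
    ∀ l' ∈ clauseAt w (c x), ¬TrueAt w (p x) l.compl → ¬TrueAt w (p x) l'.compl →
      l.positive = true → l'.positive = true → l = l') hc fun s =>
    .forall_mem_clauseAt (P := fun w (x : D × ℕ) l' => ¬TrueAt w (p x.1) ⟨nameAt w x.2, !s⟩ →
      ¬TrueAt w (p x.1) l'.compl → s = true → l'.positive = true → ⟨nameAt w x.2, s⟩ = l')
      hc.lift fun s' => by
        have free := (Definable.trueAt (C := (D × ℕ) × ℕ) hp.lift.lift last.lift (!s)).not
        have free' := (Definable.trueAt (C := (D × ℕ) × ℕ) hp.lift.lift last (!s')).not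
        exact free.imp (free'.imp ((Definable.const _).imp ((Definable.const (s' = true)).imp
          (.literal_eq last.lift last s s')))))

theorem definableClause_id : DefinableClause IDClause := fun {D} _ {p c} hp hc =>
  (exists_trueAt_definable hp hc).or (.forall_mem_clauseAt (P := fun w x l =>
    ∀ l' ∈ clauseAt w (c x), ¬TrueAt w (p x) l.compl → ¬TrueAt w (p x) l'.compl →
      l = l' ∧ l.positive = true) hc fun s =>
    .forall_mem_clauseAt (P := fun w (x : D × ℕ) l' => ¬TrueAt w (p x.1) ⟨nameAt w x.2, !s⟩ →
      ¬TrueAt w (p x.1) l'.compl → ⟨nameAt w x.2, s⟩ = l' ∧ s = true) hc.lift fun s' => by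
        have free := (Definable.trueAt (C := (D × ℕ) × ℕ) hp.lift.lift last.lift (!s)).not
        have free' := (Definable.trueAt (C := (D × ℕ) × ℕ) hp.lift.lift last (!s')).not
        exact free.imp (free'.imp ((Definable.literal_eq last.lift last s s').and (.const _))))

theorem definableClause_krom : DefinableClause KromClause := fun {D} _ {p c} hp hc =>
  (exists_trueAt_definable hp hc).or (.forall_mem_clauseAt (P := fun w x l =>
    ∀ l' ∈ clauseAt w (c x), ∀ l'' ∈ clauseAt w (c x), ¬TrueAt w (p x) l.compl →
      ¬TrueAt w (p x) l'.compl → ¬TrueAt w (p x) l''.compl → l = l' ∨ l = l'' ∨ l' = l'')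
      hc fun s =>
    .forall_mem_clauseAt (P := fun w (x : D × ℕ) l' => ∀ l'' ∈ clauseAt w (c x.1),
      ¬TrueAt w (p x.1) ⟨nameAt w x.2, !s⟩ → ¬TrueAt w (p x.1) l'.compl →
      ¬TrueAt w (p x.1) l''.compl → ⟨nameAt w x.2, s⟩ = l' ∨ ⟨nameAt w x.2, s⟩ = l'' ∨ l' = l'')
      hc.lift fun s' =>
    .forall_mem_clauseAt (P := fun w (x : (D × ℕ) × ℕ) l'' =>
      ¬TrueAt w (p x.1.1) ⟨nameAt w x.1.2, !s⟩ → ¬TrueAt w (p x.1.1) ⟨nameAt w x.2, !s'⟩ →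
      ¬TrueAt w (p x.1.1) l''.compl → (⟨nameAt w x.1.2, s⟩ : Literal) = ⟨nameAt w x.2, s'⟩ ∨
        ⟨nameAt w x.1.2, s⟩ = l'' ∨ ⟨nameAt w x.2, s'⟩ = l'') hc.lift.lift fun s'' => by
        have free :=
          (Definable.trueAt (C := ((D × ℕ) × ℕ) × ℕ) hp.lift.lift.lift last.lift.lift (!s)).not
        have free' :=
          (Definable.trueAt (C := ((D × ℕ) × ℕ) × ℕ) hp.lift.lift.lift last.lift (!s')).not
        have free'' :=
          (Definable.trueAt (C := ((D × ℕ) × ℕ) × ℕ) hp.lift.lift.lift last (!s'')).not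
        exact free.imp (free'.imp (free''.imp
          ((Definable.literal_eq last.lift.lift last.lift s s').or
            ((Definable.literal_eq last.lift.lift last s s'').or
              (.literal_eq last.lift last s' s''))))))

end Classes

end Definability

/-! ### Codes of instances are definable -/

/-- The listing of the variables of a backdoor in the code of an instance. -/
def encNames (B : List Var) : List Symbol := B.flatMap fun x => Symbol.name :: encVar x

/-- The condition that a symbol in the code of an instance imposes on the next symbol and on the
set of the later symbols. -/
def Rule (next later : Symbol → Prop) : Symbol → Prop
  | .zero | .one => True
  | .pos | .neg => later .backdoor
  | .clause => later .backdoor ∧ ¬next .zero ∧ ¬next .one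
  | .formula => later .backdoor ∧ (¬next .zero ∧ ¬next .one) ∧ (¬next .pos ∧ ¬next .neg) ∧
    (later .formula → later .goal)
  | .goal => later .backdoor ∧ next .formula ∧ ¬later .goal
  | .backdoor => ¬later .backdoor ∧ ¬next .zero ∧ ¬next .one
  | .name => ¬later .backdoor

/-- All symbols of the word satisfy their rules; this holds for the suffixes of the codes of
instances. -/
def RulesHold (x : List Symbol) : Prop :=
  ∀ i s, x[i]? = some s → Rule (fun s => x[i + 1]? = some s) (fun s => s ∈ x.drop (i + 1)) s

/-- `t` is the rest of a listing of clauses, from any position on, followed by `u`. -/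
def RestOfClauses (u t : List Symbol) : Prop := ∃ (b : Var) (ls : List Literal)
  (cs : List (List Literal)), t = encVar b ++ (ls.flatMap encLiteral ++ (cs.flatMap encClause ++ u))

theorem rulesHold_nil : RulesHold [] := fun _ _ h => nomatch h

theorem rulesHold_cons {s : Symbol} {t : List Symbol} : RulesHold (s :: t) ↔
    Rule (fun s => t.head? = some s) (fun s => s ∈ t) s ∧ RulesHold t := by
  simp only [RulesHold, ← Nat.and_forall_add_one (p := fun i => ∀ s', (s :: t)[i]? = some s' → _),
    List.getElem?_cons_zero, List.getElem?_cons_succ, List.drop_succ_cons, List.drop_zero,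
    Option.some.injEq, forall_eq', List.head?_eq_getElem?]

theorem notMem_encVar {s : Symbol} (hs : s ≠ .zero ∧ s ≠ .one) (x : Var) : s ∉ encVar x := by
  simp only [encVar, List.mem_map, not_exists, not_and]
  intro b _
  cases b
  exacts [hs.1.symm, hs.2.symm]

theorem notMem_flatMap_encLiteral {s : Symbol} (hs : s ≠ .zero ∧ s ≠ .one)
    (hsign : s ≠ .pos ∧ s ≠ .neg) (ls : List Literal) : s ∉ ls.flatMap encLiteral := by
  simp only [List.mem_flatMap, encLiteral, List.mem_cons, not_exists, not_and, not_or]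
  refine fun l _ => ⟨?_, notMem_encVar hs _⟩
  split
  exacts [hsign.1, hsign.2]

theorem notMem_flatMap_encClause {s : Symbol} (hs : s ≠ .zero ∧ s ≠ .one)
    (hsign : s ≠ .pos ∧ s ≠ .neg) (hclause : s ≠ .clause) (cs : List (List Literal)) :
    s ∉ cs.flatMap encClause := by
  simp only [List.mem_flatMap, encClause, List.mem_cons, not_exists, not_and, not_or]
  exact fun c _ => ⟨hclause, by simpa using notMem_flatMap_encLiteral hs hsign c⟩

theorem notMem_encCNF {s : Symbol} (hs : s ≠ .zero ∧ s ≠ .one) (hsign : s ≠ .pos ∧ s ≠ .neg)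
    (hclause : s ≠ .clause) (hformula : s ≠ .formula) (φ : List (List Literal)) : s ∉ encCNF φ :=
  List.not_mem_cons_of_ne_of_not_mem hformula (notMem_flatMap_encClause hs hsign hclause φ)

theorem notMem_encNames {s : Symbol} (hs : s ≠ .zero ∧ s ≠ .one)
    (hname : s ≠ .name) (B : List Var) : s ∉ encNames B := by
  simp only [encNames, List.mem_flatMap, List.mem_cons, not_exists, not_and, not_or]
  exact fun x _ => ⟨hname, notMem_encVar hs x⟩

section Parse

variable {t u : List Symbol}

theorem eq_nil_of_head_encVar {b : Var}
    (h : ¬(encVar b ++ t).head? = some .zero ∧ ¬(encVar b ++ t).head? = some .one) : b = [] := by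
  match b with
  | [] => rfl
  | true :: _ => exact (h.2 rfl).elim
  | false :: _ => exact (h.1 rfl).elim

theorem eq_nil_of_head_literals {ls : List Literal}
    (h : ¬(ls.flatMap encLiteral ++ t).head? = some .pos ∧
      ¬(ls.flatMap encLiteral ++ t).head? = some .neg) : ls = [] := by
  match ls with
  | [] => rfl
  | ⟨_, true⟩ :: _ => exact (h.1 rfl).elim
  | ⟨_, false⟩ :: _ => exact (h.2 rfl).elim

namespace RestOfClauses

theorem refl (u : List Symbol) : RestOfClauses u u := ⟨[], [], [], rfl⟩

theorem bit (h : RestOfClauses u t) (b : Bool) :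
    RestOfClauses u ((if b then .one else .zero) :: t) := by
  obtain ⟨x, ls, cs, rfl⟩ := h
  exact ⟨b :: x, ls, cs, rfl⟩

theorem sign (h : RestOfClauses u t) (s : Bool) :
    RestOfClauses u ((if s then .pos else .neg) :: t) := by
  obtain ⟨x, ls, cs, rfl⟩ := h
  exact ⟨[], ⟨x, s⟩ :: ls, cs, by simp [encLiteral, encVar]⟩

theorem clause (h : RestOfClauses u t) (hbit : ¬t.head? = some .zero ∧ ¬t.head? = some .one) :
    RestOfClauses u (.clause :: t) := by
  obtain ⟨x, ls, cs, rfl⟩ := h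
  obtain rfl := eq_nil_of_head_encVar hbit
  exact ⟨[], [], ls :: cs, by simp [encClause, encVar]⟩

theorem exists_eq_flatMap (h : RestOfClauses u t)
    (hbit : ¬t.head? = some .zero ∧ ¬t.head? = some .one)
    (hsign : ¬t.head? = some .pos ∧ ¬t.head? = some .neg) :
    ∃ cs : List (List Literal), t = cs.flatMap encClause ++ u := by
  obtain ⟨x, ls, cs, rfl⟩ := h
  obtain rfl := eq_nil_of_head_encVar hbit
  obtain rfl := eq_nil_of_head_literals hsign
  exact ⟨cs, rfl⟩

end RestOfClauses

namespace RulesHold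

theorem exists_eq_encNames (h : RulesHold t) (hback : .backdoor ∉ t) :
    ∃ x B, t = encVar x ++ encNames B := by
  induction t with
  | nil => exact ⟨[], [], rfl⟩
  | cons s t ih =>
    obtain ⟨rule, ht⟩ := rulesHold_cons.1 h
    have hback' : .backdoor ∉ t := fun h => hback (List.mem_cons_of_mem _ h)
    obtain ⟨x, B, rfl⟩ := ih ht hback'
    cases s with
    | zero => exact ⟨false :: x, B, rfl⟩
    | one => exact ⟨true :: x, B, rfl⟩
    | name => exact ⟨[], x :: B, by simp [encNames, encVar]⟩
    | backdoor => exact absurd List.mem_cons_self hback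
    | pos | neg => exact absurd rule hback'
    | clause | formula | goal => exact absurd rule.1 hback'

theorem restOfClauses_backdoor (h : RulesHold t) (hback : .backdoor ∈ t) (hgoal : .goal ∉ t)
    (hformula : .formula ∉ t) : ∃ B, RestOfClauses (.backdoor :: encNames B) t := by
  induction t with
  | nil => cases hback
  | cons s t ih =>
    obtain ⟨rule, ht⟩ := rulesHold_cons.1 h
    simp only [List.mem_cons, not_or] at hgoal hformula
    replace ih := fun hback => ih ht hback hgoal.2 hformula.2
    cases s with
    | zero => exact (ih (by simpa using hback)).imp fun B h => h.bit false
    | one => exact (ih (by simpa using hback)).imp fun B h => h.bit true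
    | pos => exact (ih rule).imp fun B h => h.sign true
    | neg => exact (ih rule).imp fun B h => h.sign false
    | clause => exact (ih rule.1).imp fun B h => h.clause rule.2
    | formula => exact absurd rfl hformula.1
    | goal => exact absurd rfl hgoal.1
    | name => exact absurd (by simpa using hback) rule
    | backdoor =>
      obtain ⟨x, B, rfl⟩ := ht.exists_eq_encNames rule.1
      obtain rfl := eq_nil_of_head_encVar rule.2
      exact ⟨B, .refl _⟩

theorem backdoor_mem (h : RulesHold t) (hgoal : .goal ∈ t) : .backdoor ∈ t := by
  obtain ⟨i, hi⟩ := List.mem_iff_getElem?.1 hgoal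
  exact List.mem_of_mem_drop (h i _ hi).1

theorem restOfClauses_encInst (h : RulesHold t) (hgoal : .goal ∈ t) :
    ∃ Φ ψ B, RestOfClauses (encInst Φ ψ B) t := by
  induction t with
  | nil => cases hgoal
  | cons s t ih =>
    obtain ⟨rule, ht⟩ := rulesHold_cons.1 h
    replace ih := ih ht
    rw [List.mem_cons] at hgoal
    cases s with
    | goal =>
      obtain ⟨-, head, goal⟩ := rule
      obtain ⟨t, rfl⟩ := List.head?_eq_some_iff.1 head
      obtain ⟨⟨hback, hbit, hsign, hformula⟩, ht⟩ := rulesHold_cons.1 ht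
      replace goal := fun mem => goal (List.mem_cons_of_mem _ mem)
      obtain ⟨B, rest⟩ := ht.restOfClauses_backdoor hback goal (mt hformula goal)
      obtain ⟨ψ, rfl⟩ := rest.exists_eq_flatMap hbit hsign
      exact ⟨[], ψ, B, .refl _⟩
    | formula =>
      obtain ⟨-, hbit, hsign, -⟩ := rule
      obtain ⟨Φ, ψ, B, rest⟩ := ih (by simpa using hgoal)
      obtain ⟨φ, rfl⟩ := rest.exists_eq_flatMap hbit hsign
      exact ⟨φ :: Φ, ψ, B, [], [], [], by simp [encVar, encInst, encCNF]⟩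
    | zero => exact let ⟨Φ, ψ, B, rest⟩ := ih (by simpa using hgoal); ⟨Φ, ψ, B, rest.bit false⟩
    | one => exact let ⟨Φ, ψ, B, rest⟩ := ih (by simpa using hgoal); ⟨Φ, ψ, B, rest.bit true⟩
    | pos => exact let ⟨Φ, ψ, B, rest⟩ := ih (by simpa using hgoal); ⟨Φ, ψ, B, rest.sign true⟩
    | neg => exact let ⟨Φ, ψ, B, rest⟩ := ih (by simpa using hgoal); ⟨Φ, ψ, B, rest.sign false⟩
    | clause =>
      obtain ⟨Φ, ψ, B, rest⟩ := ih (by simpa using hgoal)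
      exact ⟨Φ, ψ, B, rest.clause rule.2⟩
    | backdoor => exact absurd (ht.backdoor_mem (by simpa using hgoal)) rule.1
    | name => exact absurd (ht.backdoor_mem (by simpa using hgoal)) rule

end RulesHold

end Parse

section Encode

variable {t : List Symbol}

theorem RulesHold.encVar_append (h : RulesHold t) (x : Var) : RulesHold (encVar x ++ t) := by
  induction x with
  | nil => exact h
  | cons b x ih =>
    refine rulesHold_cons.2 ⟨?_, ih⟩
    cases b <;> exact trivial

/-- Words that may follow a listing of literals in the code of an instance. -/
structure ValidTail (t : List Symbol) : Prop where
  rulesHold : RulesHold t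
  backdoor_mem : .backdoor ∈ t
  head_ne_bit : ¬t.head? = some .zero ∧ ¬t.head? = some .one

theorem ValidTail.literals_append (h : ValidTail t) (ls : List Literal) :
    ValidTail (ls.flatMap encLiteral ++ t) := by
  induction ls with
  | nil => exact h
  | cons l ls ih =>
    obtain ⟨x, s⟩ := l
    rw [List.flatMap_cons, List.append_assoc]
    have hback := List.mem_append_right (encVar x) ih.backdoor_mem
    refine ⟨rulesHold_cons.2 ⟨?_, ih.rulesHold.encVar_append x⟩, List.mem_cons_of_mem _ hback, ?_⟩
    · cases s <;> exact hback
    · cases s <;> simp [encLiteral]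

theorem ValidTail.clauses_append (h : ValidTail t) (cs : List (List Literal)) :
    ValidTail (cs.flatMap encClause ++ t) := by
  induction cs with
  | nil => exact h
  | cons c cs ih =>
    obtain ⟨rulesHold, hback, hbit⟩ := ih.literals_append c
    rw [List.flatMap_cons, List.append_assoc]
    exact ⟨rulesHold_cons.2 ⟨⟨hback, hbit⟩, rulesHold⟩, List.mem_cons_of_mem _ hback,
      by simp [encClause]⟩

theorem ValidTail.encCNF_append (h : ValidTail t)
    (hsign : ¬t.head? = some .pos ∧ ¬t.head? = some .neg)
    (hformula : .formula ∈ t → .goal ∈ t) (φ : List (List Literal)) :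
    ValidTail (encCNF φ ++ t) := by
  obtain ⟨rulesHold, hback, hbit⟩ := h.clauses_append φ
  refine ⟨rulesHold_cons.2 ⟨⟨hback, hbit, ?_, fun mem => ?_⟩, rulesHold⟩,
    List.mem_cons_of_mem _ hback, by simp [encCNF]⟩
  · cases φ with
    | nil => exact hsign
    | cons c φ => simp [encClause]
  · exact List.mem_append_right _ (hformula ((List.mem_append.1 mem).resolve_left
      (notMem_flatMap_encClause (by decide) (by decide) (by decide) φ)))

theorem rulesHold_encNames (B : List Var) : RulesHold (encNames B) := by
  induction B with
  | nil => exact rulesHold_nil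
  | cons x B ih =>
    refine rulesHold_cons.2 ⟨fun mem => ?_, ih.encVar_append x⟩
    rcases List.mem_append.1 mem with mem | mem
    · exact notMem_encVar (by decide) x mem
    · exact notMem_encNames (by decide) (by decide) B mem

theorem validTail_backdoor (B : List Var) : ValidTail (.backdoor :: encNames B) := by
  refine ⟨rulesHold_cons.2 ⟨⟨notMem_encNames (by decide) (by decide) B, ?_⟩, rulesHold_encNames B⟩,
    List.mem_cons_self, by simp⟩
  cases B <;> simp [encNames]

theorem validTail_encInst_nil (ψ : List (List Literal)) (B : List Var) :
    ValidTail (encInst [] ψ B) := by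
  have hformula : .formula ∉ .backdoor :: encNames B :=
    List.not_mem_cons_of_ne_of_not_mem nofun (notMem_encNames (by decide) (by decide) B)
  have hgoal : .goal ∉ encCNF ψ ++ .backdoor :: encNames B := by
    simp only [encCNF, List.mem_append, List.mem_cons, not_or]
    exact ⟨⟨nofun, notMem_flatMap_encClause (by decide) (by decide) (by decide) ψ⟩, nofun,
      notMem_encNames (by decide) (by decide) B⟩
  obtain ⟨rulesHold, hback, -⟩ := (validTail_backdoor B).encCNF_append (by simp)
    (fun mem => absurd mem hformula) ψ
  exact ⟨rulesHold_cons.2 ⟨⟨hback, rfl, hgoal⟩, rulesHold⟩, List.mem_cons_of_mem _ hback,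
    by simp [encInst]⟩

theorem encInst_cons (φ : List (List Literal)) (Φ : List (List (List Literal)))
    (ψ : List (List Literal)) (B : List Var) :
    encInst (φ :: Φ) ψ B = encCNF φ ++ encInst Φ ψ B := by
  simp [encInst]

theorem goal_mem_encInst (Φ : List (List (List Literal))) (ψ : List (List Literal))
    (B : List Var) : .goal ∈ encInst Φ ψ B := by
  simp [encInst]

theorem head?_encInst (Φ : List (List (List Literal))) (ψ : List (List Literal)) (B : List Var) :
    (encInst Φ ψ B).head? = some .formula ∨ (encInst Φ ψ B).head? = some .goal := by
  cases Φ <;> simp [encInst, encCNF]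

theorem rulesHold_encInst (Φ : List (List (List Literal))) (ψ : List (List Literal))
    (B : List Var) : RulesHold (encInst Φ ψ B) := by
  suffices ValidTail (encInst Φ ψ B) from this.rulesHold
  induction Φ with
  | nil => exact validTail_encInst_nil ψ B
  | cons φ Φ ih =>
    rw [encInst_cons]
    refine ih.encCNF_append ?_ (fun _ => goal_mem_encInst Φ ψ B) φ
    rcases head?_encInst Φ ψ B with head | head <;> simp [head]

theorem exists_eq_encInst_iff : (∃ Φ ψ B, t = encInst Φ ψ B) ↔
    RulesHold t ∧ .goal ∈ t ∧ (t.head? = some .formula ∨ t.head? = some .goal) := by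
  constructor
  · rintro ⟨Φ, ψ, B, rfl⟩
    exact ⟨rulesHold_encInst Φ ψ B, goal_mem_encInst Φ ψ B, head?_encInst Φ ψ B⟩
  · rintro ⟨rulesHold, hgoal, head⟩
    obtain ⟨Φ, ψ, B, rest⟩ := rulesHold.restOfClauses_encInst hgoal
    obtain ⟨_ | c, rfl⟩ := rest.exists_eq_flatMap (by rcases head with h | h <;> simp [h])
      (by rcases head with h | h <;> simp [h])
    · exact ⟨Φ, ψ, B, rfl⟩
    · simp [encClause] at head

end Encode

/-- The first component of the coded pair is the code of an instance. -/
def IsCode (w : List Letter) : Prop :=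
  (∀ i s, w[i]? = some (.inl s) →
    Rule (fun s => w[i + 1]? = some (.inl s)) (fun s => .inl s ∈ w.drop (i + 1)) s) ∧
  .inl .goal ∈ w ∧ (w[0]? = some (.inl .formula) ∨ w[0]? = some (.inl .goal))

theorem encPair_getElem?_eq_inl_iff {Γ Δ : Type} {x : List Γ} {y : List Δ} {i : ℕ} {s : Γ} :
    (encPair (x, y))[i]? = some (.inl s) ↔ x[i]? = some s := by
  rcases lt_or_ge i x.length with hi | hi
  · simp [encPair, List.getElem?_append_left, hi]
  · simp [encPair, List.getElem?_append_right, hi]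

theorem inl_mem_drop_encPair_iff {Γ Δ : Type} {x : List Γ} {y : List Δ} {i : ℕ} {s : Γ} :
    .inl s ∈ (encPair (x, y)).drop i ↔ s ∈ x.drop i := by
  simp only [List.mem_iff_getElem?, List.getElem?_drop, encPair_getElem?_eq_inl_iff]

theorem isCode_encPair_iff {x : List Symbol} {y : List (Fin 3)} :
    IsCode (encPair (x, y)) ↔ ∃ Φ ψ B, x = encInst Φ ψ B := by
  have mem := inl_mem_drop_encPair_iff (x := x) (y := y) (i := 0) (s := .goal)
  rw [List.drop_zero, List.drop_zero] at mem
  simp only [exists_eq_encInst_iff, RulesHold, IsCode, encPair_getElem?_eq_inl_iff,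
    inl_mem_drop_encPair_iff, mem, List.head?_eq_getElem?]

namespace Definable

open IsProj

variable {C : Type} [PosTuple C]

theorem mem_drop {A : Type} {t : C → ℕ} (ht : IsProj t) (a : A) :
    Definable C fun w c => a ∈ w.drop (t c + 1) :=
  (ex (R := fun w c j => t c < j ∧ w[j]? = some a)
    ((Definable.lt ht.lift last).and (letter_eq last _))).congr fun w c => by
    simp only [List.mem_iff_getElem?, List.getElem?_drop]
    constructor
    · rintro ⟨j, hj⟩
      exact ⟨t c + 1 + j, (lt_length_of_getElem?_eq_some hj).le, by lia, hj⟩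
    · rintro ⟨j, -, lt, hj⟩
      exact ⟨j - (t c + 1), by rwa [Nat.add_sub_of_le lt]⟩

theorem rule {next later : List Letter → C → Symbol → Prop}
    (hnext : ∀ s, Definable C fun w c => next w c s)
    (hlater : ∀ s, Definable C fun w c => later w c s) (s : Symbol) :
    Definable C fun w c => Rule (next w c) (later w c) s := by
  have no_bit := (hnext .zero).not.and (hnext .one).not
  have no_sign := (hnext .pos).not.and (hnext .neg).not
  cases s with
  | zero | one => exact const True
  | pos | neg => exact hlater _
  | clause => exact (hlater _).and no_bit
  | formula => exact (hlater _).and (no_bit.and (no_sign.and ((hlater _).imp (hlater _))))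
  | goal => exact (hlater _).and ((hnext _).and (hlater _).not)
  | backdoor => exact (hlater _).not.and no_bit
  | name => exact (hlater _).not

theorem letter_succ_eq {A : Type} {t : C → ℕ} (ht : IsProj t) (a : A) :
    Definable C fun w c => w[t c + 1]? = some a :=
  (ex (R := fun w c j => j = t c + 1 ∧ w[j]? = some a)
    ((succ_eq ht.lift last).and (letter_eq last _))).congr fun _ _ =>
      ⟨fun h => ⟨_, (lt_length_of_getElem?_eq_some h).le, rfl, h⟩, fun ⟨_, _, eq, h⟩ => eq ▸ h⟩

theorem isCode : Definable C fun w _ => IsCode w := by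
  have rules : Definable C fun (w : List Letter) _ => ∀ s i, w[i]? = some (.inl s) →
      Rule (fun s => w[i + 1]? = some (.inl s)) (fun s => .inl s ∈ w.drop (i + 1)) s :=
    forall_finite fun s => forall_letter_eq (R := fun (w : List Letter) _ i =>
      Rule (fun s => w[i + 1]? = some (.inl s)) (fun s => .inl s ∈ w.drop (i + 1)) s) _
      (rule (fun _ => letter_succ_eq last _) (fun _ => mem_drop last _) s)
  have goal : Definable C fun (w : List Letter) _ =>
      ∃ i ≤ w.length, w[i]? = some (.inl .goal) :=
    ex (letter_eq last _)
  have head (s : Symbol) : Definable C fun (w : List Letter) _ =>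
      ∃ i ≤ w.length, i = 0 ∧ w[i]? = some (.inl s) :=
    ex ((eq_zero last).and (letter_eq last _))
  refine (rules.and (goal.and (((head .formula).or (head .goal))))).congr fun w _ => ?_
  refine and_congr forall_comm (and_congr ?_ ?_)
  · rw [List.mem_iff_getElem?]
    exact exists_congr fun i =>
      (and_iff_right_of_imp fun h => (lt_length_of_getElem?_eq_some h).le).symm
  · simp

end Definable

/-! ### The listings in the code of an instance -/

/-- The clauses listed in a word. -/
def clausesOf (t : List Letter) : List Clause :=
  listed (.inl .clause) (fun s => (litsOf s).toFinset) t

/-- The clauses of the conclusion. -/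
def conclusions (w : List Letter) : Set Clause := {C | ∃ d, IsConclusion w d ∧ clauseAt w d = C}

/-- A clause that is listed right before the word is complete. -/
def EndsClause (t : List Letter) : Prop := ¬IsBit t.head? ∧ ¬IsSign t.head?

theorem flatMap_append_of_append {A α β : Type} {P : List A → Prop} {F : List A → List β}
    {g : α → List A} {h : α → List β}
    (append : ∀ a t, P t → P (g a ++ t) ∧ F (g a ++ t) = h a ++ F t) {t : List A} (ht : P t)
    (L : List α) : P (L.flatMap g ++ t) ∧ F (L.flatMap g ++ t) = L.flatMap h ++ F t := by
  induction L with
  | nil => exact ⟨ht, rfl⟩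
  | cons a L ih =>
    rw [List.flatMap_cons, List.flatMap_cons, List.append_assoc, List.append_assoc, ← ih.2]
    exact append a _ ih.1

section Listed

variable {β : Type} {m : Letter} {f : List Letter → β}

theorem listed_append_of_notMem {s t : List Letter} (h : m ∉ s) :
    listed m f (s ++ t) = listed m f t := by
  induction s with
  | nil => rfl
  | cons a s ih =>
    obtain ⟨ne, h⟩ := not_or.1 (List.mem_cons.not.1 h)
    rw [List.cons_append, listed, if_neg (Ne.symm ne), ih h]

theorem listed_eq_nil {s : List Letter} (h : m ∉ s) : listed m f s = [] := by
  simpa [listed] using listed_append_of_notMem (f := f) (t := []) h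

end Listed

theorem mem_clausesOf_iff {w : List Letter} {C : Clause} :
    C ∈ clausesOf w ↔ ∃ c : ℕ, w[c]? = some (.inl .clause) ∧ clauseAt w c = C :=
  mem_listed_iff

theorem inl_notMem_map_inl {Γ Δ : Type} {s : Γ} {x : List Γ} (h : s ∉ x) :
    (.inl s : Γ ⊕ Δ) ∉ x.map .inl :=
  (List.mem_map_of_injective Sum.inl_injective).not.2 h

theorem isBit_inl_iff {s : Symbol} : IsBit (some (.inl s)) ↔ s = .zero ∨ s = .one := by
  simp [IsBit, bitLetter, Bool.exists_bool]

theorem isSign_inl_iff {s : Symbol} : IsSign (some (.inl s)) ↔ s = .pos ∨ s = .neg := by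
  simp [IsSign, signLetter, Bool.exists_bool, or_comm]

theorem endsClause_cons {s : Symbol} (hs : s ≠ .zero ∧ s ≠ .one) (hsign : s ≠ .pos ∧ s ≠ .neg)
    (t : List Letter) : EndsClause (.inl s :: t) :=
  ⟨isBit_inl_iff.not.2 (not_or.2 hs), isSign_inl_iff.not.2 (not_or.2 hsign)⟩

theorem map_encVar (x : Var) : (encVar x).map (Sum.inl : Symbol → Letter) = x.map bitLetter :=
  List.map_map

theorem map_encLiteral (l : Literal) : (encLiteral l).map (Sum.inl : Symbol → Letter) =
    signLetter l.positive :: l.var.map bitLetter := by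
  rw [← map_encVar, encLiteral, List.map_cons, signLetter]

section Read

variable {t u : List Letter}

theorem nameOf_map_bitLetter (ht : ¬IsBit t.head?) (x : Var) :
    nameOf (x.map bitLetter ++ t) = x := by
  induction x with
  | nil => exact nameOf_eq_nil ht
  | cons b x ih => rw [List.map_cons, List.cons_append, nameOf_cons_bitLetter, ih]

theorem litsOf_map_bitLetter (x : Var) : litsOf (x.map bitLetter ++ t) = litsOf t := by
  induction x with
  | nil => rfl
  | cons b x ih => rw [List.map_cons, List.cons_append, litsOf_cons_bitLetter, ih]

theorem litsOf_literals (ht : EndsClause t) (ls : List Literal) :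
    litsOf ((ls.flatMap encLiteral).map .inl ++ t) = ls := by
  have append (l : Literal) (t : List Letter) (ht : ¬IsBit t.head?) :
      ¬IsBit ((encLiteral l).map Sum.inl ++ t).head? ∧
        litsOf ((encLiteral l).map Sum.inl ++ t) = [l] ++ litsOf t := by
    rw [map_encLiteral, List.cons_append, litsOf_cons_signLetter, nameOf_map_bitLetter ht,
      litsOf_map_bitLetter]
    exact ⟨fun ⟨b, h⟩ => bitLetter_ne_signLetter b _ (Option.some.inj h).symm, rfl⟩
  rw [List.map_flatMap, (flatMap_append_of_append (h := fun l => [l]) append ht.1 ls).2,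
    litsOf_eq_nil ht.1 ht.2, List.flatMap_singleton', List.append_nil]

theorem clausesOf_clauses (ht : EndsClause t) (cs : List (List Literal)) :
    EndsClause ((cs.flatMap encClause).map .inl ++ t) ∧
      clausesOf ((cs.flatMap encClause).map .inl ++ t) = cs.map List.toFinset ++ clausesOf t := by
  rw [List.map_flatMap, List.map_eq_flatMap]
  refine flatMap_append_of_append (fun c t ht => ⟨endsClause_cons (by decide) (by decide) _, ?_⟩)
    ht cs
  have rest : clausesOf ((c.flatMap encLiteral).map .inl ++ t) = clausesOf t :=
    listed_append_of_notMem (inl_notMem_map_inl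
      (notMem_flatMap_encLiteral (by decide) (by decide) c))
  calc clausesOf ((encClause c).map .inl ++ t)
    _ = (litsOf ((c.flatMap encLiteral).map .inl ++ t)).toFinset ::
          clausesOf ((c.flatMap encLiteral).map .inl ++ t) := rfl
    _ = [c.toFinset] ++ clausesOf t := by rw [litsOf_literals ht, rest, List.singleton_append]

theorem clausesOf_formulas (ht : EndsClause t) (Φ : List (List (List Literal))) :
    clausesOf ((Φ.flatMap encCNF).map .inl ++ t) =
      Φ.flatten.map List.toFinset ++ clausesOf t := by
  rw [List.map_flatMap, List.map_flatten, ← List.flatMap_def]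
  exact (flatMap_append_of_append (P := EndsClause) (g := fun φ => (encCNF φ).map .inl)
    (fun φ t ht => ⟨endsClause_cons (s := .formula) (by decide) (by decide) _,
      (clausesOf_clauses ht φ).2⟩) ht Φ).2

theorem namesOf_names (ht : ¬IsBit t.head?) (B : List Var) :
    namesOf ((encNames B).map .inl ++ t) = B ++ namesOf t := by
  rw [encNames, List.map_flatMap]
  convert (flatMap_append_of_append (P := fun t => ¬IsBit t.head?) (F := namesOf)
    (h := fun x => [x]) (fun x t ht => ⟨?_, ?_⟩) ht B).2
  · exact (List.flatMap_singleton' B).symm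
  · exact (endsClause_cons (s := .name) (by decide) (by decide) _).1
  · have rest : namesOf ((encVar x).map .inl ++ t) = namesOf t :=
      listed_append_of_notMem (inl_notMem_map_inl (notMem_encVar (by decide) x))
    calc namesOf ((Symbol.name :: encVar x).map .inl ++ t)
      _ = nameOf ((encVar x).map .inl ++ t) :: namesOf ((encVar x).map .inl ++ t) := rfl
      _ = [x] ++ namesOf t := by
        rw [rest, map_encVar, nameOf_map_bitLetter ht, List.singleton_append]

theorem nameOf_append (ht : ¬IsBit t.head?) : nameOf (u ++ t) = nameOf u := by
  induction u with
  | nil => exact nameOf_eq_nil ht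
  | cons a u ih =>
    by_cases h : IsBit (some a)
    · obtain ⟨b, h⟩ := h
      obtain rfl := Option.some.inj h
      rw [List.cons_append, nameOf_cons_bitLetter, nameOf_cons_bitLetter, ih]
    · rw [nameOf_eq_nil (t := a :: u) h, List.cons_append, nameOf_eq_nil (t := a :: (u ++ t)) h]

theorem litsOf_append (ht : EndsClause t) : litsOf (u ++ t) = litsOf u := by
  induction u with
  | nil => exact litsOf_eq_nil ht.1 ht.2
  | cons a u ih =>
    by_cases h : IsBit (some a)
    · obtain ⟨b, h⟩ := h
      obtain rfl := Option.some.inj h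
      rw [List.cons_append, litsOf_cons_bitLetter, litsOf_cons_bitLetter, ih]
    by_cases h' : IsSign (some a)
    · obtain ⟨b, h'⟩ := h'
      obtain rfl := Option.some.inj h'
      rw [List.cons_append, litsOf_cons_signLetter, litsOf_cons_signLetter, ih,
        nameOf_append ht.1]
    · rw [litsOf_eq_nil (t := a :: u) h h', List.cons_append,
        litsOf_eq_nil (t := a :: (u ++ t)) h h']

end Read

section Split

variable {u v : List Letter}

theorem clauseAt_append_left (hv : EndsClause v) {c : ℕ} (hc : c < u.length) :
    clauseAt (u ++ v) c = clauseAt u c := by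
  rw [clauseAt, List.drop_append_of_le_length hc, litsOf_append hv, clauseAt]

theorem clauseAt_append_right (i : ℕ) : clauseAt (u ++ v) (u.length + i) = clauseAt v i := by
  rw [clauseAt, add_assoc, List.drop_append, List.drop_of_length_le (by lia),
    Nat.add_sub_cancel_left, List.nil_append, clauseAt]

theorem beforeGoal_append_iff (hu : .inl .goal ∉ u) {c : ℕ} :
    BeforeGoal (u ++ .inl .goal :: v) c ↔ c ≤ u.length := by
  refine ⟨fun h => not_lt.1 fun lt => h _ lt ?_, fun hc j hj h =>
    hu (List.mem_of_getElem? (i := j) ?_)⟩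
  · rw [List.getElem?_append_right le_rfl, Nat.sub_self, List.getElem?_cons_zero]
  · rwa [List.getElem?_append_left (by lia)] at h

theorem premises_append (hu : .inl .goal ∉ u) :
    premises (u ++ .inl .goal :: v) = {C | C ∈ clausesOf u} := by
  have clauseAt_eq {c : ℕ} (hc : c < u.length) :
      clauseAt (u ++ .inl .goal :: v) c = clauseAt u c :=
    clauseAt_append_left (endsClause_cons (by decide) (by decide) v) hc
  ext C
  rw [Set.mem_ofPred_eq, mem_clausesOf_iff]
  constructor
  · rintro ⟨c, ⟨marker, before⟩, rfl⟩
    rcases ((beforeGoal_append_iff hu).1 before).eq_or_lt with rfl | lt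
    · simp at marker
    · exact ⟨c, by rwa [List.getElem?_append_left lt] at marker, (clauseAt_eq lt).symm⟩
  · rintro ⟨c, marker, rfl⟩
    have lt := lt_length_of_getElem?_eq_some marker
    exact ⟨c, ⟨by rwa [List.getElem?_append_left lt], (beforeGoal_append_iff hu).2 lt.le⟩,
      clauseAt_eq lt⟩

theorem conclusions_append (hu : .inl .goal ∉ u) :
    conclusions (u ++ .inl .goal :: v) = {C | C ∈ clausesOf (.inl .goal :: v)} := by
  ext C
  rw [Set.mem_ofPred_eq, mem_clausesOf_iff]
  constructor
  · rintro ⟨d, ⟨marker, after⟩, rfl⟩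
    obtain ⟨i, rfl⟩ :=
      Nat.exists_eq_add_of_le (not_le.1 ((beforeGoal_append_iff hu).not.1 after)).le
    rw [List.getElem?_append_right (Nat.le_add_right _ _), Nat.add_sub_cancel_left] at marker
    exact ⟨i, marker, (clauseAt_append_right i).symm⟩
  · rintro ⟨i, marker, rfl⟩
    refine ⟨u.length + i, ⟨?_, (beforeGoal_append_iff hu).not.2 fun le => ?_⟩,
      clauseAt_append_right i⟩
    · rwa [List.getElem?_append_right (Nat.le_add_right _ _), Nat.add_sub_cancel_left]
    · obtain rfl : i = 0 := by lia
      simp at marker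

end Split

section Code

variable (Φ : List (List (List Literal))) (ψ : List (List Literal)) (B : List Var)
  (y : List (Fin 3))

theorem encPair_append {Γ Δ : Type} (u x : List Γ) (y : List Δ) :
    encPair (u ++ x, y) = u.map .inl ++ encPair (x, y) := by
  simp only [encPair, List.map_append, List.append_assoc]

theorem encPair_encInst : encPair (encInst Φ ψ B, y) =
    (Φ.flatMap encCNF).map .inl ++ encPair (encInst [] ψ B, y) := by
  rw [← encPair_append]
  simp only [encInst, List.flatMap_nil, List.nil_append, List.append_assoc]

theorem clausesOf_encPair_nil :
    clausesOf (encPair (encInst [] ψ B, y)) = ψ.map List.toFinset := by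
  have ends : EndsClause (encPair (.backdoor :: encNames B, y)) :=
    endsClause_cons (by decide) (by decide) _
  have rest : clausesOf (encPair (.backdoor :: encNames B, y)) = [] :=
    listed_eq_nil (by simp [encPair, notMem_encNames])
  calc clausesOf (encPair (encInst [] ψ B, y))
    _ = clausesOf ((ψ.flatMap encClause).map .inl ++ encPair (.backdoor :: encNames B, y)) := by
      rw [← encPair_append]
      rfl
    _ = ψ.map List.toFinset := by
      rw [(clausesOf_clauses ends ψ).2, rest, List.append_nil]

theorem clausesOf_encPair : clausesOf (encPair (encInst Φ ψ B, y)) =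
    Φ.flatten.map List.toFinset ++ ψ.map List.toFinset := by
  have ends : EndsClause (encPair (encInst [] ψ B, y)) :=
    endsClause_cons (by decide) (by decide) _
  rw [encPair_encInst, clausesOf_formulas ends, clausesOf_encPair_nil]

theorem goal_notMem_formulas : (.inl .goal : Letter) ∉ (Φ.flatMap encCNF).map .inl :=
  inl_notMem_map_inl fun mem => by
    obtain ⟨φ, -, mem⟩ := List.mem_flatMap.1 mem
    exact notMem_encCNF (by decide) (by decide) (by decide) (by decide) φ mem

theorem premises_encPair :
    premises (encPair (encInst Φ ψ B, y)) = {C | C ∈ Φ.flatten.map List.toFinset} := by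
  have listing := clausesOf_formulas (t := []) ⟨nofun, nofun⟩ Φ
  rw [List.append_nil] at listing
  rw [encPair_encInst]
  refine (premises_append (goal_notMem_formulas Φ)).trans ?_
  rw [listing]
  simp [clausesOf, listed]

theorem conclusions_encPair :
    conclusions (encPair (encInst Φ ψ B, y)) = {C | C ∈ ψ.map List.toFinset} := by
  rw [encPair_encInst, ← clausesOf_encPair_nil ψ B y]
  exact conclusions_append (goal_notMem_formulas Φ)

theorem namesOf_encPair : namesOf (encPair (encInst Φ ψ B, y)) = B := by
  have notMem : .name ∉ Φ.flatMap encCNF ++ .goal :: encCNF ψ := by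
    simp [List.mem_flatMap, notMem_encCNF]
  have advice : namesOf (y.map .inr) = [] := listed_eq_nil (by simp)
  calc namesOf (encPair (encInst Φ ψ B, y))
    _ = namesOf (encPair (.backdoor :: encNames B, y)) := by
      rw [encInst, encPair_append, namesOf, listed_append_of_notMem (inl_notMem_map_inl notMem)]
      rfl
    _ = namesOf ((encNames B).map .inl ++ y.map .inr) := rfl
    _ = B := by
      rw [namesOf_names, advice, List.append_nil]
      rintro ⟨b, h⟩
      cases y <;> simp [bitLetter] at h

end Code

/-! ### The advice -/

/-- The bit strings of length `k`, which stand for the assignments to `k` variables. -/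
def allBits : ℕ → List (List Bool)
  | 0 => [[]]
  | k + 1 => (allBits k).flatMap fun β => [false :: β, true :: β]

/-- A bit string as a block of the advice: the letter `2` marks its beginning. -/
def adviceBlock (β : List Bool) : List (Fin 3) := 2 :: β.map fun b => bif b then 1 else 0

/-- The advice for the parameter `k`: a block for each bit string of length `k`. -/
def advice (k : ℕ) : List (Fin 3) := (allBits k).flatMap adviceBlock

theorem mem_allBits {k : ℕ} {β : List Bool} : β ∈ allBits k ↔ β.length = k := by
  induction k generalizing β with
  | zero => simp [allBits]
  | succ k ih =>
    simp only [allBits, List.mem_flatMap, ih]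
    cases β with
    | nil => simp
    | cons b β => cases b <;> simp

theorem primrec_allBits : Primrec allBits := by
  have step : Primrec₂ fun (_ : ℕ) (L : List (List Bool)) =>
      L.flatMap fun β => [false :: β, true :: β] := by
    refine Primrec.list_flatMap Primrec.snd ?_
    exact Primrec.list_cons.comp (Primrec.list_cons.comp (Primrec.const false) Primrec.snd)
      (Primrec.list_cons.comp (Primrec.list_cons.comp (Primrec.const true) Primrec.snd)
        (Primrec.const []))
  refine (Primrec.nat_rec₁ [[]] step).of_eq fun k => ?_
  induction k with
  | zero => rfl
  | succ k ih => simp only [allBits, ← ih]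

theorem computable_advice : Computable advice := by
  refine (Primrec.list_flatMap primrec_allBits ?_).to_comp
  refine Primrec.list_cons.comp (Primrec.const 2) (Primrec.list_map Primrec.snd ?_)
  exact (Primrec.cond Primrec.id (Primrec.const 1) (Primrec.const 0)).comp Primrec.snd

theorem map_adviceBlock (β : List Bool) :
    (adviceBlock β).map (Sum.inr : Fin 3 → Letter) = .inr 2 :: β.map adviceLetter := by
  rw [adviceBlock, List.map_cons, List.map_map]
  congr 2
  funext b
  cases b <;> rfl

theorem adviceOf_map_adviceLetter {t : List Letter} (ht : ¬IsAdvice t.head?) (β : List Bool) :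
    adviceOf (β.map adviceLetter ++ t) = β := by
  induction β with
  | nil => exact adviceOf_eq_nil ht
  | cons b β ih => rw [List.map_cons, List.cons_append, adviceOf_cons_adviceLetter, ih]

theorem inr_two_ne_adviceLetter (b : Bool) : (.inr 2 : Letter) ≠ adviceLetter b := by
  cases b <;> simp [adviceLetter]

theorem listed_adviceOf_advice (x : List Symbol) (k : ℕ) :
    listed (.inr 2) adviceOf (encPair (x, advice k)) = allBits k := by
  have append (β : List Bool) (t : List Letter) (ht : ¬IsAdvice t.head?) :
      ¬IsAdvice ((adviceBlock β).map Sum.inr ++ t).head? ∧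
        listed (.inr 2) adviceOf ((adviceBlock β).map Sum.inr ++ t) =
          [β] ++ listed (.inr 2) adviceOf t := by
    have notMem : (.inr 2 : Letter) ∉ β.map adviceLetter := fun mem => by
      obtain ⟨b, -, eq⟩ := List.mem_map.1 mem
      exact inr_two_ne_adviceLetter b eq.symm
    rw [map_adviceBlock, List.cons_append, listed, if_pos rfl, adviceOf_map_adviceLetter ht,
      listed_append_of_notMem notMem]
    exact ⟨fun ⟨b, h⟩ => inr_two_ne_adviceLetter b (Option.some.inj h), rfl⟩
  rw [encPair, listed_append_of_notMem (by simp), advice, List.map_flatMap]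
  simpa [listed] using
    (flatMap_append_of_append (h := fun β => [β]) append (t := []) nofun (allBits k)).2

/-! ### Correctness -/

section ListsTrue

theorem mem_zip_map_iff {α β : Type} {D : List α} {f : α → β} {x : α} {b : β} :
    (x, b) ∈ D.zip (D.map f) ↔ x ∈ D ∧ f x = b := by
  have zip_eq : D.zip (D.map f) = D.map fun a => (a, f a) := by
    simpa using List.zip_map' (f := id) (g := f) (l := D)
  simp [zip_eq]

theorem exists_map_eq {α β : Type} [Inhabited β] {D : List α} (hD : D.Nodup) {L : List β}
    (h : D.length = L.length) : ∃ f : α → β, D.map f = L := by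
  classical
  refine ⟨fun x => L.getD (D.idxOf x) default, List.ext_getElem (by simpa) fun i hi hi' => ?_⟩
  rw [List.getElem_map, hD.idxOf_getElem, List.getD_eq_getElem _ _ hi']

theorem listsTrue_map_dedup (B : List Var) (f : Var → Bool) :
    ListsTrue B (B.dedup.map f) = Assignment.Sets (X := B.toFinset) fun x => f x := by
  funext l
  rw [ListsTrue, mem_zip_map_iff, Assignment.sets_iff, List.mem_dedup]
  simp only [exists_prop, List.mem_toFinset]

theorem forall_assignment_iff {B : List Var} {P : (Literal → Prop) → Prop} :
    (∀ θ : Assignment B.toFinset, P θ.Sets) ↔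
      ∀ β, B.dedup.length = β.length → P (ListsTrue B β) := by
  constructor
  · intro h β hβ
    obtain ⟨f, rfl⟩ := exists_map_eq (List.nodup_dedup B) hβ
    rw [listsTrue_map_dedup]
    exact h _
  · intro h θ
    let f (x : Var) : Bool := if hx : x ∈ B.toFinset then θ ⟨x, hx⟩ else false
    have eq : θ = fun x => f x.1 := funext fun x => by simp only [f, x.2, dif_pos]
    rw [eq, ← listsTrue_map_dedup]
    exact h _ (List.length_map f).symm

end ListsTrue

section Word

variable {K : (Literal → Prop) → Clause → Prop} {w : List Letter} {k : ℕ}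

/-- The names that can be read in a word, which include all variables of its clauses. -/
def namesIn (w : List Letter) : Set Var := {x | ∃ a ≤ w.length, nameAt w a = x}

theorem premises_subset_clausesOf {C : Clause} (hC : C ∈ premises w) : C ∈ clausesOf w := by
  obtain ⟨c, ⟨marker, -⟩, eq⟩ := hC
  exact mem_clausesOf_iff.2 ⟨c, marker, eq⟩

theorem var_mem_namesIn {C : Clause} (hC : C ∈ clausesOf w) {l : Literal} (hl : l ∈ C) :
    l.var ∈ namesIn w := by
  obtain ⟨c, -, rfl⟩ := mem_clausesOf_iff.1 hC
  exact exists_nameAt_of_mem_clauseAt hl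

theorem accepts_iff_forall_listed : Accepts K w ↔ ∀ β ∈ listed (.inr 2) adviceOf w,
    (namesOf w).dedup.length = β.length ∧
      (∀ C ∈ clausesOf w, K (ListsTrue (namesOf w) β) C) ∧
      ∀ D ∈ conclusions w, ∃ x ∈ namesIn w, ∀ s,
        Conflict (premises w) (refutationBase (ListsTrue (namesOf w) β) D ⟨x, s⟩) := by
  simp only [Accepts, TrueAt, mem_listed_iff, mem_clausesOf_iff, conclusions, namesIn,
    Set.mem_ofPred_eq, forall_exists_index, and_imp, exists_exists_and_eq_and,
    forall_apply_eq_imp_iff₂]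

theorem accepts_iff_forall_assignment (hw : listed (.inr 2) adviceOf w = allBits k) :
    Accepts K w ↔ (namesOf w).toFinset.card = k ∧ ∀ θ : Assignment (namesOf w).toFinset,
      (∀ C ∈ clausesOf w, K θ.Sets C) ∧ ∀ D ∈ conclusions w, ∃ x ∈ namesIn w, ∀ s,
        Conflict (premises w) (refutationBase θ.Sets D ⟨x, s⟩) := by
  rw [accepts_iff_forall_listed, hw, forall_assignment_iff (P := fun τ =>
    (∀ C ∈ clausesOf w, K τ C) ∧ ∀ D ∈ conclusions w, ∃ x ∈ namesIn w, ∀ s,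
      Conflict (premises w) (refutationBase τ D ⟨x, s⟩)), List.card_toFinset]
  simp only [mem_allBits]
  constructor
  · intro h
    have card : (namesOf w).dedup.length = k := by
      simpa using (h (List.replicate k false) List.length_replicate).1
    exact ⟨card, fun β hβ => (h β (hβ.symm.trans card)).2⟩
  · rintro ⟨card, h⟩ β hβ
    exact ⟨card.trans hβ.symm, h β (card.trans hβ.symm)⟩

theorem accepts_iff_entails (hw : listed (.inr 2) adviceOf w = allBits k)
    (hK : (∀ τ C, K τ C → HornClause τ C) ∨ ∀ τ C, K τ C → KromClause τ C) :
    Accepts K w ↔ (namesOf w).toFinset.card = k ∧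
      (∀ θ : Assignment (namesOf w).toFinset, ∀ C ∈ clausesOf w, K θ.Sets C) ∧
      ∀ v : Var → Bool, (∀ C ∈ premises w, ∃ l ∈ C, l.Holds v) →
        ∀ D ∈ conclusions w, ∃ l ∈ D, l.Holds v := by
  rw [accepts_iff_forall_assignment hw, forall_and]
  have nonempty : (namesIn w).Nonempty := ⟨_, 0, Nat.zero_le _, rfl⟩
  refine and_congr_right fun _ => and_congr_right fun classes => (entails_iff_conflict nonempty
    (fun C hC l hl => var_mem_namesIn (premises_subset_clausesOf hC) hl) fun θ => ?_).symm
  exact hK.imp (fun h C hC => h _ _ (classes θ C (premises_subset_clausesOf hC)))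
    fun h C hC => h _ _ (classes θ C (premises_subset_clausesOf hC))

end Word

section Instance

variable {F : Set CNF} {K : (Literal → Prop) → Clause → Prop} {Φ : List (List (List Literal))}
  {ψ : List (List Literal)} {B : List Var}

theorem mem_toCNF {C : Clause} : C ∈ toCNF ψ ↔ C ∈ ψ.map List.toFinset :=
  List.mem_toFinset

theorem forall_mem_premises_iff {p : Clause → Prop} :
    (∀ φ ∈ (Φ.map toCNF).toFinset, ∀ C ∈ φ, p C) ↔ ∀ C ∈ Φ.flatten.map List.toFinset, p C := by
  simp only [List.mem_toFinset, List.forall_mem_map, mem_toCNF, List.forall_mem_flatten]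

theorem isStrongBackdoor_iff
    (hF : ∀ {X : Finset Var} (θ : Assignment X) {φ : CNF}, φ.reduct θ ∈ F ↔ ∀ C ∈ φ, K θ.Sets C) :
    (⟨(Φ.map toCNF).toFinset, toCNF ψ, B.toFinset⟩ : Inst).IsStrongBackdoor F ↔
      ∀ θ : Assignment B.toFinset,
        ∀ C ∈ Φ.flatten.map List.toFinset ++ ψ.map List.toFinset, K θ.Sets C := by
  refine forall_congr' fun θ => ?_
  simp only [hF, forall_mem_premises_iff, mem_toCNF]
  rw [← List.forall_mem_append]

theorem entails_iff : Entails (Φ.map toCNF).toFinset (toCNF ψ) ↔ ∀ v : Var → Bool,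
    (∀ C ∈ Φ.flatten.map List.toFinset, ∃ l ∈ C, l.Holds v) →
      ∀ D ∈ ψ.map List.toFinset, ∃ l ∈ D, l.Holds v := by
  refine forall_congr' fun v => imp_congr forall_mem_premises_iff ?_
  simp only [Satisfies, mem_toCNF, Literal.Holds]

theorem accepts_encPair_iff {k : ℕ}
    (hF : ∀ {X : Finset Var} (θ : Assignment X) {φ : CNF}, φ.reduct θ ∈ F ↔ ∀ C ∈ φ, K θ.Sets C)
    (hK : (∀ τ C, K τ C → HornClause τ C) ∨ ∀ τ C, K τ C → KromClause τ C) :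
    Accepts K (encPair (encInst Φ ψ B, advice k)) ↔
      (⟨(Φ.map toCNF).toFinset, toCNF ψ, B.toFinset⟩ : Inst).IsStrongBackdoor F ∧
      B.toFinset.card = k ∧ Entails (Φ.map toCNF).toFinset (toCNF ψ) := by
  rw [accepts_iff_entails (listed_adviceOf_advice _ k) hK, namesOf_encPair, clausesOf_encPair,
    premises_encPair, conclusions_encPair, isStrongBackdoor_iff hF, entails_iff, and_left_comm]
  rfl

theorem mem_bdimp_iff
    (hF : ∀ {X : Finset Var} (θ : Assignment X) {φ : CNF}, φ.reduct θ ∈ F ↔ ∀ C ∈ φ, K θ.Sets C)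
    (hK : (∀ τ C, K τ C → HornClause τ C) ∨ ∀ τ C, K τ C → KromClause τ C)
    (x : List Symbol) (k : ℕ) : (x, k) ∈ BDIMP F ↔
      IsCode (encPair (x, advice k)) ∧ Accepts K (encPair (x, advice k)) := by
  rw [isCode_encPair_iff]
  constructor
  · rintro ⟨⟨Φ', ψ', B'⟩, ⟨Φ, ψ, B, rfl, rfl, rfl, rfl⟩, spec⟩
    exact ⟨⟨Φ, ψ, B, rfl⟩, (accepts_encPair_iff hF hK).2 spec⟩
  · rintro ⟨⟨Φ, ψ, B, rfl⟩, accepts⟩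
    exact ⟨_, ⟨Φ, ψ, B, rfl, rfl, rfl, rfl⟩, (accepts_encPair_iff hF hK).1 accepts⟩

theorem isFPT_bdimp_of_definableClause
    (hF : ∀ {X : Finset Var} (θ : Assignment X) {φ : CNF}, φ.reduct θ ∈ F ↔ ∀ C ∈ φ, K θ.Sets C)
    (hK : (∀ τ C, K τ C → HornClause τ C) ∨ ∀ τ C, K τ C → KromClause τ C)
    (hD : DefinableClause K) : IsFPT (BDIMP F) :=
  ⟨3, advice, _, computable_advice, inP_of_definable (Definable.isCode.and (Definable.accepts hD)),
    mem_bdimp_iff hF hK⟩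

end Instance

end BackdoorImp

theorem mainTheorem9 (F : Set BackdoorImp.CNF)
    (hF : F ∈ ({BackdoorImp.ID, BackdoorImp.Horn, BackdoorImp.Krom} :
      Set (Set BackdoorImp.CNF))) :
    BackdoorImp.IsFPT (BackdoorImp.BDIMP F) := by
  rcases hF with rfl | rfl | rfl
  · exact BackdoorImp.isFPT_bdimp_of_definableClause BackdoorImp.reduct_mem_id_iff
      (.inl fun _ _ h => h.hornClause) BackdoorImp.definableClause_id
  · exact BackdoorImp.isFPT_bdimp_of_definableClause BackdoorImp.reduct_mem_horn_iff
      (.inl fun _ _ h => h) BackdoorImp.definableClause_horn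
  · exact BackdoorImp.isFPT_bdimp_of_definableClause BackdoorImp.reduct_mem_krom_iff
      (.inr fun _ _ h => h) BackdoorImp.definableClause_krom
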